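/- Let $\mathcal T>0$, $\mathbb T=\mathbb R/\mathcal T\mathbb Z$ with normalized Haar measure, $G=\mathbb T\times\mathbb R^3$ with the product measure, and $\lambda\in\mathbb R\setminus\{0\}$. For $x\in\mathbb R^3$ put $s(x)=|x|+x_1$. Let $$\Gamma_{0,j\ell}^\lambda(x)=\frac1{4\pi\lambda}\big[\delta_{j\ell}\Delta-\partial_j\partial_\ell\big]\int_0^{s(\lambda x)/2}\frac{1-e^{-\tau}}{\tau}\,d\tau\qquad(x\neq0),$$ and let $\Gamma_\perp$ be the tempered distribution on $G$ $$\Gamma_\perp=\mathscr F_G^{-1}\Big[\frac{1-\delta_{\mathbb Z}(k)}{|\xi|^2+i(\frac{2\pi}{\mathcal T}k-\lambda\xi_1)}\Big(I-\frac{\xi\otimes\xi}{|\xi|^2}\Big)\Big],\qquad (k,\xi)\in\mathbb Z\times\mathbb R^3,$$ where $\delta_{\mathbb Z}(0)=1$, $\delta_{\mathbb Z}(k)=0$ for $k\ne0$, and $\mathscr F_G f(k,\xi)=\int_G f(t,x)e^{-i\frac{2\pi}{\mathcal T}kt-i\xi\cdot x}\,d(t,x)$. For $f\colon G\to\mathbb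 R^3$ let $\mathcal Pf(x)=\int_{\mathbb T}f(t,x)\,dt$ and $\mathcal P_\perp f=f-\mathcal Pf$. Let $R_0>0$, let $f\in C_0^\infty(\mathbb T\times\mathbb R^3)^3$ with $\operatorname{supp}f\subset\mathbb T\times B_{R_0}$, where $B_{R_0}=\{|x|<R_0\}$, and let $\alpha\in\mathbb N_0^3$ with $|\alpha|\le1$. Then the distribution $D_x^\alpha\Gamma_\perp$ is a locally integrable function on $G$ for which $x\mapsto D_x^\alpha\Gamma_\perp(\cdot,x)\in L^1(\mathbb T)^{3\times3}$ is well defined and continuous on $\mathbb R^3\setminus\{0\}$, the convolution integrals below converge absolutely, and there is a constant $C>0$ such that for all $t\in\mathbb T$ and $x\in\mathbb R^3$ $$|D^\alpha\Gamma_0^\lambda*\mathcal Pf(x)|\le C\big[(1+|x|)(1+s(\lambda x))\big]^{-1-|\alpha|/2},$$ $$|D_x^\alpha\Gamma_\perp*\mathcal P_\perp f(t,x)|\le C(1+|x|)^{-3-|\alpha|},$$ and for all $t\in\mathbb T$ and $|x|\ge2R_0$ $$\Big|D^\alpha\Gamma_0^\lambda*\mathcal Pf(x)-D^\alpha\Gamma_0^\lambda(x)\cdot\int_{\mathbb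 R^3}\mathcal Pf(y)\,dy\Big|\le C\big[|x|(1+s(\lambda x))\big]^{-3/2-|\alpha|/2},$$ $$\Big|D_x^\alpha\Gamma_\perp*\mathcal P_\perp f(t,x)-\Big(D_x^\alpha\Gamma_\perp(\cdot,x)*_{\mathbb T}\int_{\mathbb R^3}\mathcal P_\perp f(\cdot,y)\,dy\Big)(t)\Big|\le C|x|^{-4-|\alpha|}.$$ Here the convolutions of $\Gamma_0^\lambda$, of $\Gamma_\perp$, and those marked $*_{\mathbb T}$ are taken over $\mathbb R^3$, $G$ and $\mathbb T$, respectively. -/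

import Mathlib

open MeasureTheory Filter Topology
open scoped ContDiff

noncomputable section

namespace TPOseen

/-- Euclidean space `ℝ³`; the coordinate `x₁` is `x 0`. -/
abbrev E3 : Type := EuclideanSpace ℝ (Fin 3)

/-- Normalized Haar measure on the torus `ℝ / Tℤ`. -/
abbrev muT (T : ℝ) [Fact (0 < T)] : Measure (AddCircle T) := AddCircle.haarAddCircle

/-- The product measure on the group `G = ℝ / Tℤ × ℝ³`. -/
abbrev muG (T : ℝ) [Fact (0 < T)] : Measure (AddCircle T × E3) :=
  (AddCircle.haarAddCircle (T := T)).prod (volume : Measure E3)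

/-! ### Spatial derivatives -/

/-- The partial derivative `∂_j g`. -/
def pd {F : Type*} [NormedAddCommGroup F] [NormedSpace ℝ F] (j : Fin 3) (g : E3 → F) : E3 → F :=
  fun x => fderiv ℝ g x (EuclideanSpace.single j 1)

/-- The length `|α|` of a multi-index. -/
def len (α : Fin 3 → ℕ) : ℕ := ∑ i, α i

/-- The derivative `D^α g` for a multi-index `α`. -/
def mpd {F : Type*} [NormedAddCommGroup F] [NormedSpace ℝ F] (α : Fin 3 → ℕ) (g : E3 → F) :
    E3 → F :=
  (pd 0)^[α 0] ((pd 1)^[α 1] ((pd 2)^[α 2] g))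

/-- The Laplacian `Δ g = ∑ ∂_i ∂_i g`. -/
def lap (g : E3 → ℝ) : E3 → ℝ := fun x => ∑ i, pd i (pd i g) x

/-! ### Functions on `G` -/

/-- The function on `ℝ × ℝ³`, periodic in the first variable, induced by a function on `G`. -/
def lift {T : ℝ} {F : Type*} (f : AddCircle T × E3 → F) : ℝ × E3 → F :=
  fun p => f ((p.1 : AddCircle T), p.2)

/-- Smoothness of a function on `G`. -/
def SmoothOnG {T : ℝ} {F : Type*} [NormedAddCommGroup F] [NormedSpace ℝ F]
    (f : AddCircle T × E3 → F) : Prop :=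
  ContDiff ℝ ∞ (lift f)

/-- The steady-state part `P f (x) = ∫_T f(t,x) dt`. -/
def steady {T : ℝ} [Fact (0 < T)] (f : AddCircle T × E3 → E3) : E3 → E3 :=
  fun x => ∫ t, f (t, x) ∂(muT T)

/-- The purely periodic part `P_⊥ f = f - P f`. -/
def purelyPeriodic {T : ℝ} [Fact (0 < T)] (f : AddCircle T × E3 → E3) : AddCircle T × E3 → E3 :=
  fun p => f p - steady f p.2

/-! ### The steady-state fundamental solution -/

/-- `s(x) = |x| + x₁`. -/
def wake (x : E3) : ℝ := ‖x‖ + x 0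

/-- `x ↦ ∫_0^{s(λ x)/2} (1 - e^{-τ}) / τ dτ`. -/
def oseenPotential (lam : ℝ) (x : E3) : ℝ :=
  ∫ τ in (0 : ℝ)..(wake (lam • x) / 2), (1 - Real.exp (-τ)) / τ

/-- The entries of the steady-state fundamental solution
`Γ₀,jl = (4 π λ)⁻¹ (δ_jl Δ - ∂_j ∂_l) ∫_0^{s(λ x)/2} (1 - e^{-τ}) / τ dτ`, meant for `x ≠ 0`. -/
def Gamma0 (lam : ℝ) (j l : Fin 3) (x : E3) : ℝ :=
  1 / (4 * Real.pi * lam) *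
    ((if j = l then lap (oseenPotential lam) x else 0) - pd j (pd l (oseenPotential lam)) x)

/-! ### The purely periodic fundamental solution as a tempered distribution on `G` -/

/-- Schwartz–Bruhat functions on `G`: smooth, all derivatives rapidly decreasing in `x`. -/
structure IsSchwartz {T : ℝ} (φ : AddCircle T × E3 → ℂ) : Prop where
  smooth : SmoothOnG φ
  decay : ∀ N n : ℕ, ∃ C : ℝ, ∀ p : ℝ × E3, ‖p.2‖ ^ N * ‖iteratedFDeriv ℝ n (lift φ) p‖ ≤ C

/-- `∫_G φ(t,x) e^{i (2π/T) k t + i ξ·x} d(t,x)`, a function on the dual group `ℤ × ℝ³`. -/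
def dualFourier {T : ℝ} [Fact (0 < T)] (φ : AddCircle T × E3 → ℂ) (k : ℤ) (ξ : E3) : ℂ :=
  ∫ p, φ p * (fourier k p.1 * Complex.exp (Complex.I * (inner ℝ ξ p.2 : ℝ))) ∂(muG T)

/-- The tempered distribution `F_G⁻¹ m` on `G`, for a symbol `m` on `ℤ × ℝ³`:
`⟨F_G⁻¹ m, φ⟩ = (2π)⁻³ ∑_k ∫ m(k,ξ) (∫_G φ(t,x) e^{i (2π/T) k t + i ξ·x} d(t,x)) dξ`,
that is, formally, `F_G⁻¹ m (t,x) = (2π)⁻³ ∑_k ∫ m(k,ξ) e^{i (2π/T) k t + i ξ·x} dξ`,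
the inverse of `F_G f (k,ξ) = ∫_G f(t,x) e^{- i (2π/T) k t - i ξ·x} d(t,x)`. -/
def invFourierDist {T : ℝ} [Fact (0 < T)] (m : ℤ → E3 → ℂ) (φ : AddCircle T × E3 → ℂ) : ℂ :=
  (((2 * Real.pi) ^ 3)⁻¹ : ℝ) * ∑' k : ℤ, ∫ ξ, m k ξ * dualFourier φ k ξ

/-- The entries of the symbol
`(1 - δ_ℤ(k)) / (|ξ|² + i (2π k / T - λ ξ₁)) · (I - ξ ⊗ ξ / |ξ|²)`. -/
def symbolPerp (T lam : ℝ) (j l : Fin 3) (k : ℤ) (ξ : E3) : ℂ :=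
  (1 - if k = 0 then 1 else 0) /
      ((‖ξ‖ ^ 2 : ℝ) + Complex.I * ((2 * Real.pi / T * k - lam * ξ 0 : ℝ) : ℂ)) *
    (((if j = l then 1 else 0) - ξ j * ξ l / ‖ξ‖ ^ 2 : ℝ) : ℂ)

/-- The entries of the purely periodic fundamental solution `Γ_⊥`, a tempered distribution. -/
def GammaPerp (T : ℝ) [Fact (0 < T)] (lam : ℝ) (j l : Fin 3) (φ : AddCircle T × E3 → ℂ) : ℂ :=
  invFourierDist (symbolPerp T lam j l) φ

/-- The distributional derivative `D_x^α u` of a distribution `u` on `G`: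
`⟨D_x^α u, φ⟩ = (-1)^|α| ⟨u, D_x^α φ⟩`. -/
def distDeriv {T : ℝ} (α : Fin 3 → ℕ) (u : (AddCircle T × E3 → ℂ) → ℂ)
    (φ : AddCircle T × E3 → ℂ) : ℂ :=
  (-1) ^ len α * u (fun p => mpd α (fun x => φ (p.1, x)) p.2)

/-- The distribution `u` on `G` is the locally integrable function `K`, where moreover the
slices `K(·,x) ∈ L¹(ℝ/Tℤ)` depend continuously on `x ≠ 0`.  The first two conditions determine `K`
almost everywhere; with the last two, `K(·,x)` is determined as an element of `L¹(ℝ/Tℤ)` for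
every `x ≠ 0`, which gives its meaning to the slice `u(·,x)`. -/
structure IsFunction {T : ℝ} [Fact (0 < T)] (u : (AddCircle T × E3 → ℂ) → ℂ)
    (K : AddCircle T × E3 → ℝ) : Prop where
  locallyIntegrable : LocallyIntegrable K (muG T)
  pairing : ∀ φ : AddCircle T × E3 → ℂ, IsSchwartz φ →
    Integrable (fun p => (K p : ℂ) * φ p) (muG T) ∧ ∫ p, (K p : ℂ) * φ p ∂(muG T) = u φ
  slice_integrable : ∀ x : E3, x ≠ 0 → Integrable (fun t => K (t, x)) (muT T)
  slice_continuous : ∀ x : E3, x ≠ 0 →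
    Tendsto (fun x' => ∫ t, |K (t, x') - K (t, x)| ∂(muT T)) (𝓝 x) (𝓝 0)

/-! ### Convolution of a matrix kernel with a vector field -/

/-- Matrix times vector in Euclidean space. -/
def act (A : Fin 3 → Fin 3 → ℝ) (v : E3) : E3 := WithLp.toLp 2 fun j => ∑ l, A j l * v l

/-- The convolution integral `(k * g)(x)` on `ℝ³` converges absolutely. -/
def ConvExists (k : Fin 3 → Fin 3 → E3 → ℝ) (g : E3 → E3) (x : E3) : Prop :=
  ∀ j l, Integrable fun y => k j l (x - y) * g y l

/-- `(k * g)(x) = ∫ k(x - y) g(y) dy` on `ℝ³`. -/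
def conv (k : Fin 3 → Fin 3 → E3 → ℝ) (g : E3 → E3) (x : E3) : E3 :=
  WithLp.toLp 2 fun j => ∑ l, ∫ y, k j l (x - y) * g y l

/-- The convolution integral `(K * g)(p)` on `G` converges absolutely. -/
def ConvGExists {T : ℝ} [Fact (0 < T)] (K : Fin 3 → Fin 3 → AddCircle T × E3 → ℝ)
    (g : AddCircle T × E3 → E3) (p : AddCircle T × E3) : Prop :=
  ∀ j l, Integrable (fun q => K j l (p - q) * g q l) (muG T)

/-- `(K * g)(t,x) = ∫_G K(t - s, x - y) g(s,y) d(s,y)` on `G`. -/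
def convG {T : ℝ} [Fact (0 < T)] (K : Fin 3 → Fin 3 → AddCircle T × E3 → ℝ)
    (g : AddCircle T × E3 → E3) (p : AddCircle T × E3) : E3 :=
  WithLp.toLp 2 fun j => ∑ l, ∫ q, K j l (p - q) * g q l ∂(muG T)

/-- The convolution integral `(k * h)(t)` on the torus converges absolutely. -/
def ConvTExists {T : ℝ} [Fact (0 < T)] (k : Fin 3 → Fin 3 → AddCircle T → ℝ)
    (h : AddCircle T → E3) (t : AddCircle T) : Prop :=
  ∀ j l, Integrable (fun s => k j l (t - s) * h s l) (muT T)

/-- `(k * h)(t) = ∫_T k(t - s) h(s) ds` on the torus. -/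
def convT {T : ℝ} [Fact (0 < T)] (k : Fin 3 → Fin 3 → AddCircle T → ℝ)
    (h : AddCircle T → E3) (t : AddCircle T) : E3 :=
  WithLp.toLp 2 fun j => ∑ l, ∫ s, k j l (t - s) * h s l ∂(muT T)

end TPOseen

end

noncomputable section

namespace TPOseen

/-! ### Gaussians -/

/-! Periodic part. As `|ξ|² > 0` for almost every `ξ`, the symbol `1/(|ξ|² + i(2πk/T - λξ₁))` is the
Laplace integral over `s > 0` of `exp(-s(|ξ|² + i(2πk/T - λξ₁)))`. Hence the time frequencies of
`Γ_⊥` are those of the `T`-periodization of `kern`, the fundamental solution of the time-dependent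
Oseen system, and the factor `1 - δ_ℤ(k)` subtracts the time mean. So `D_x^β Γ_⊥` is the function
`perKernel`: `T ∑ₙ kern(t + nT, x) - ∫₀^∞ kern(s, x) ds` with `t ∈ (0, T]`. This is
`isFunction_perKernel`; `IsFunction.slice_ae_eq` shows that any other representative has the same
slices.

By parabolic scaling, `kern` with `β` spatial derivatives is `O((√s + |x + sλe₁|)^{-(3+|β|)})`
(`exists_kern_le`). Sum and integral separately decay too slowly in `x`; the gain comes from their
difference. It has zero mean over a period, so it is controlled by its time derivative, and `∂ₛ kern
= Δ kern + λ∂₁ kern` turns that into higher spatial derivatives, which decay faster. Iterating, all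
that remains is `∫₀^∞ ∂ₛ kern ds = -kern(0+)`, of order `|x|^{-(3+|β|)}` because for small `s` the
drift has not moved the point. The iteration is `OseenFamily.exists_perFluct_le_aux`, stated for
abstract families so that it applies both to `kern(s, x)` and to the differences `kern(s, x - y) -
kern(s, x)`, which decay by one more order and give the leading-term estimate.

Steady part. `Γ₀` consists of second derivatives of `E(s(λx)/2)` with `E' = (1 - e^{-τ})/τ`. The
`i`-th derivative of `E'` is `O((1 + τ)^{-(i+1)})`, the gradient satisfies `|∇ s(λx)|² = 2|λ|
s(λx)/|x|`, and derivatives of order `i` of `s(λx)` are `O(|x|^{1-i})` by homogeneity. Combined by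
the chain rule at scale `1 + s(λx)`, these give each derivative of the potential one factor `[|x|(1
+ s(λx))]^{-1/2}` (`exists_oseenPotential_far`).

In both parts the data are bounded and supported in `|y| < R₀`. Close to the support, weighted local
integrability of the kernel bounds the convolution; for `|x| ≥ 2R₀` the kernel at `x - y` is
comparable with its bound at `x`, and the mean value theorem gives the leading term. -/

theorem pow_mul_exp_neg_le (n : ℕ) {s : ℝ} (hs : 0 < s) :
    ∃ C : ℝ, 0 ≤ C ∧ ∀ r : ℝ, 0 ≤ r → r ^ n * Real.exp (-(s * r ^ 2)) ≤ C := by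
  -- From `r ^ n ≤ n! e ^ r`, and `r - s r ^ 2 ≤ 1 / (4 s)` by completing the square.
  refine ⟨n.factorial * (Real.exp (1 / (4 * s))), by positivity, fun r hr => ?_⟩
  have h1 : r ^ n ≤ n.factorial * Real.exp r := by
    have := Real.pow_div_factorial_le_exp r hr n
    rw [div_le_iff₀ (by positivity)] at this
    linarith
  calc r ^ n * Real.exp (-(s * r ^ 2)) ≤ n.factorial * Real.exp r * Real.exp (-(s * r ^ 2)) := by
        gcongr
    _ = n.factorial * Real.exp (r - s * r ^ 2) := by
        rw [mul_assoc, ← Real.exp_add]; ring_nf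
    _ ≤ _ := by
        gcongr
        have : 1 / (4 * s) - (r - s * r ^ 2) = (2 * s * r - 1) ^ 2 / (4 * s) := by
          field_simp; ring
        have h2 : 0 ≤ (2 * s * r - 1) ^ 2 / (4 * s) := by positivity
        linarith

theorem integrable_exp_neg_mul_norm_sq {s : ℝ} (hs : 0 < s) :
    Integrable fun ξ : E3 => Real.exp (-(s * ‖ξ‖ ^ 2)) := by
  have h := (GaussianFourier.integrable_cexp_neg_mul_sq_norm_add (V := E3) (b := (s : ℂ))
    (by simpa using hs) 0 0).norm
  refine h.congr (Eventually.of_forall fun ξ => ?_)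
  simp only [zero_mul, add_zero, Complex.norm_exp]
  congr 1
  norm_cast
  simp

theorem integrable_pow_mul_exp_neg_mul_norm_sq (n : ℕ) {s : ℝ} (hs : 0 < s) :
    Integrable fun ξ : E3 => ‖ξ‖ ^ n * Real.exp (-(s * ‖ξ‖ ^ 2)) := by
  obtain ⟨C, hC, h⟩ := pow_mul_exp_neg_le n (half_pos hs)
  refine ((integrable_exp_neg_mul_norm_sq (half_pos hs)).const_mul C).mono'
    (by fun_prop) (Eventually.of_forall fun ξ => ?_)
  rw [Real.norm_of_nonneg (by positivity)]
  calc ‖ξ‖ ^ n * Real.exp (-(s * ‖ξ‖ ^ 2))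
      = (‖ξ‖ ^ n * Real.exp (-(s / 2 * ‖ξ‖ ^ 2))) * Real.exp (-(s / 2 * ‖ξ‖ ^ 2)) := by
        rw [mul_assoc, ← Real.exp_add]; ring_nf
    _ ≤ _ := by gcongr; exact h _ (norm_nonneg _)

/-- The Gaussian `exp (-‖ξ‖²)` as a Schwartz function. -/
def gaussian : SchwartzMap E3 ℝ where
  toFun ξ := Real.exp (-‖ξ‖ ^ 2)
  smooth' := (Real.contDiff_exp.comp (contDiff_norm_sq ℝ).neg)
  decay' k n := by
    obtain ⟨l, C, hC, h⟩ :=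
      (Function.HasTemperateGrowth.neg
        (Function.hasTemperateGrowth_norm_sq (H := E3))).norm_iteratedFDeriv_le_uniform n
    obtain ⟨A, hA, hA'⟩ := pow_mul_exp_neg_le (0 : ℕ) (s := 1) one_pos
    -- With `M ≥ 1` the base `M (1 + r) ^ l` is at least `1`, hence at most its own positive powers,
    -- the shape that the chain rule bound requires.
    set M : ℝ := max C 1
    have hM : 1 ≤ M := le_max_right _ _
    obtain ⟨B, hB, hB'⟩ := pow_mul_exp_neg_le 0 (s := 1) one_pos
    have key : ∃ B : ℝ, ∀ r : ℝ, 0 ≤ r →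
        r ^ k * (n.factorial * Real.exp (-r ^ 2) * (M * (1 + r) ^ l) ^ n) ≤ B := by
      obtain ⟨B, hB, hB'⟩ := pow_mul_exp_neg_le (k + l * n) (s := 1) one_pos
      refine ⟨n.factorial * M ^ n * (2 ^ (k + l * n) * (1 + B)), fun r hr => ?_⟩
      have h1 : r ^ k * ((1 + r) ^ l) ^ n ≤ (1 + r) ^ (k + l * n) := by
        rw [pow_add, pow_mul]; gcongr; linarith
      have h2 : (1 + r) ^ (k + l * n) ≤ 2 ^ (k + l * n) * (1 + r ^ (k + l * n)) := by
        rcases le_total r 1 with h | h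
        · calc (1 + r) ^ (k + l * n) ≤ 2 ^ (k + l * n) * 1 := by
                rw [mul_one]; gcongr; linarith
            _ ≤ _ := by gcongr; linarith [pow_nonneg hr (k + l * n)]
        · calc (1 + r) ^ (k + l * n) ≤ (2 * r) ^ (k + l * n) := by gcongr; linarith
            _ ≤ _ := by rw [mul_pow]; gcongr; linarith
      have h3 : Real.exp (-r ^ 2) ≤ 1 := Real.exp_le_one_iff.2 (by nlinarith)
      have h4 := hB' r hr
      rw [one_mul] at h4
      calc _ = n.factorial * M ^ n * ((r ^ k * ((1 + r) ^ l) ^ n) * Real.exp (-r ^ 2)) := by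
            rw [mul_pow]; ring
        _ ≤ n.factorial * M ^ n * ((2 ^ (k + l * n) * (1 + r ^ (k + l * n)))
              * Real.exp (-r ^ 2)) := by
            exact mul_le_mul_of_nonneg_left (mul_le_mul_of_nonneg_right (h1.trans h2)
              (Real.exp_pos _).le) (by positivity)
        _ ≤ _ := by
            rw [mul_assoc (2 ^ (k + l * n))]
            gcongr
            nlinarith
    obtain ⟨B, hB⟩ := key
    refine ⟨B, fun x => le_trans ?_ (hB ‖x‖ (norm_nonneg x))⟩
    gcongr
    -- Faà di Bruno bound: every derivative of `exp` is `exp`, and the inner function has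
    -- polynomially bounded derivatives.
    refine norm_iteratedFDeriv_comp_le (g := Real.exp) (f := fun ξ : E3 => -‖ξ‖ ^ 2)
      (N := ⊤) Real.contDiff_exp (contDiff_norm_sq ℝ).neg (mod_cast le_top) x ?_ ?_
    · intro i hi
      rw [norm_iteratedFDeriv_eq_norm_iteratedDeriv, iteratedDeriv_eq_iterate, Real.iter_deriv_exp]
      simp [Real.abs_exp]
    · intro i hi hin
      have h1 : (1 : ℝ) ≤ M * (1 + ‖x‖) ^ l :=
        one_le_mul_of_one_le_of_one_le hM (one_le_pow₀ (by linarith [norm_nonneg x]))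
      calc _ ≤ C * (1 + ‖x‖) ^ l := h i hin x
        _ ≤ M * (1 + ‖x‖) ^ l := by gcongr; exact le_max_left _ _
        _ ≤ _ := le_self_pow₀ h1 (by omega)

/-! ### Gaussian integrals with symbols -/

/-- The monomial symbol `(i ξ)^β`. -/
def mon (β : Fin 3 → ℕ) (ξ : E3) : ℂ := ∏ i, (Complex.I * ξ i) ^ β i

/-- `∫ q(ξ) e^{- s |ξ|² + i ξ·y} dξ`. -/
def waveInt (q : E3 → ℂ) (s : ℝ) (y : E3) : ℂ :=
  ∫ ξ, q ξ * Complex.exp (((-(s * ‖ξ‖ ^ 2) : ℝ) : ℂ) + Complex.I * (inner ℝ ξ y : ℝ))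

/-- Measurable symbols of growth `O(|ξ|ⁿ)`. -/
structure SymbolBound (n : ℕ) (q : E3 → ℂ) : Prop where
  measurable : Measurable q
  bound : ∃ C : ℝ, 0 ≤ C ∧ ∀ ξ, ‖q ξ‖ ≤ C * ‖ξ‖ ^ n

theorem norm_cexp_gauss (s : ℝ) (ξ y : E3) :
    ‖Complex.exp (((-(s * ‖ξ‖ ^ 2) : ℝ) : ℂ) + Complex.I * (inner ℝ ξ y : ℝ))‖
      = Real.exp (-(s * ‖ξ‖ ^ 2)) := by
  rw [Complex.norm_exp]; congr 1
  simp only [Complex.add_re, Complex.ofReal_re, Complex.mul_re, Complex.I_re, Complex.I_im,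
    Complex.ofReal_im]; ring

theorem SymbolBound.mul {m n : ℕ} {q p : E3 → ℂ} (hq : SymbolBound m q) (hp : SymbolBound n p) :
    SymbolBound (m + n) (fun ξ => q ξ * p ξ) := by
  obtain ⟨C, hC, h⟩ := hq.bound
  obtain ⟨D, hD, h'⟩ := hp.bound
  refine ⟨hq.measurable.mul hp.measurable, C * D, by positivity, fun ξ => ?_⟩
  rw [norm_mul]
  calc _ ≤ (C * ‖ξ‖ ^ m) * (D * ‖ξ‖ ^ n) := mul_le_mul (h ξ) (h' ξ) (norm_nonneg _) (by positivity)
    _ = _ := by ring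

theorem SymbolBound.integrable {n : ℕ} {q : E3 → ℂ} (hq : SymbolBound n q) {s : ℝ} (hs : 0 < s)
    (y : E3) : Integrable fun ξ =>
      q ξ * Complex.exp (((-(s * ‖ξ‖ ^ 2) : ℝ) : ℂ) + Complex.I * (inner ℝ ξ y : ℝ)) := by
  obtain ⟨C, hC, h⟩ := hq.bound
  refine ((integrable_pow_mul_exp_neg_mul_norm_sq n hs).const_mul C).mono'
    (hq.measurable.aestronglyMeasurable.mul (by fun_prop)) (Eventually.of_forall fun ξ => ?_)
  rw [norm_mul, norm_cexp_gauss, ← mul_assoc]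
  gcongr
  exact h ξ

theorem mon_symbolBound (β : Fin 3 → ℕ) : SymbolBound (len β) (mon β) := by
  refine ⟨by unfold mon; fun_prop, 1, zero_le_one, fun ξ => ?_⟩
  rw [mon, norm_prod, len, one_mul, ← Finset.prod_pow_eq_pow_sum]
  refine Finset.prod_le_prod (fun i _ => norm_nonneg _) fun i _ => ?_
  rw [norm_pow, norm_mul, Complex.norm_I, one_mul, Complex.norm_real]
  gcongr
  exact PiLp.norm_apply_le ξ i

theorem mon_add_single (β : Fin 3 → ℕ) (i : Fin 3) (n : ℕ) (ξ : E3) :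
    mon (β + Pi.single i n) ξ = mon β ξ * (Complex.I * ξ i) ^ n := by
  simp only [mon, Pi.add_apply, pow_add, Finset.prod_mul_distrib]
  congr 1
  rw [Finset.prod_eq_single i]
  · simp
  · intro b _ hb; simp [hb]
  · simp

theorem len_add_single (β : Fin 3 → ℕ) (i : Fin 3) (n : ℕ) :
    len (β + Pi.single i n) = len β + n := by
  simp [len, Finset.sum_add_distrib]

/-- Differentiation of `waveInt` along a line. -/
theorem hasDerivAt_waveInt {n : ℕ} {q : E3 → ℂ} (hq : SymbolBound n q) (a b : ℝ) (x v : E3)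
    {r : ℝ} (hr : 0 < a + b * r) :
    HasDerivAt (fun r : ℝ => waveInt q (a + b * r) (x + r • v))
      (waveInt (fun ξ => q ξ * (((-(b * ‖ξ‖ ^ 2) : ℝ) : ℂ) + Complex.I * (inner ℝ ξ v : ℝ)))
        (a + b * r) (x + r • v)) r := by
  obtain ⟨C, hC, h⟩ := hq.bound
  -- Near `r` the Gaussian rate stays above `c`, which provides the dominating function. The choice
  -- `b = 0` yields spatial derivatives; `a = 0`, `b = 1`, `v = drift lam` yields the time
  -- derivative along the drift.
  set c := (a + b * r) / 2 with hc
  have hc0 : 0 < c := by positivity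
  have hopen : {r' : ℝ | c < a + b * r'} ∈ 𝓝 r :=
    (isOpen_lt continuous_const (by fun_prop)).mem_nhds (by
      change c < a + b * r; linarith)
  refine (hasDerivAt_integral_of_dominated_loc_of_deriv_le (μ := volume)
    (F := fun r' ξ => q ξ * Complex.exp (((-((a + b * r') * ‖ξ‖ ^ 2) : ℝ) : ℂ)
      + Complex.I * (inner ℝ ξ (x + r' • v) : ℝ)))
    (F' := fun r' ξ => q ξ * (((-(b * ‖ξ‖ ^ 2) : ℝ) : ℂ) + Complex.I * (inner ℝ ξ v : ℝ))
      * Complex.exp (((-((a + b * r') * ‖ξ‖ ^ 2) : ℝ) : ℂ)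
      + Complex.I * (inner ℝ ξ (x + r' • v) : ℝ)))
    (bound := fun ξ => C * |b| * (‖ξ‖ ^ (n + 2) * Real.exp (-(c * ‖ξ‖ ^ 2)))
      + C * ‖v‖ * (‖ξ‖ ^ (n + 1) * Real.exp (-(c * ‖ξ‖ ^ 2))))
    hopen ?_ (hq.integrable hr _) ?_ ?_ ?_ ?_).2
  · exact Eventually.of_forall fun r' =>
      hq.measurable.aestronglyMeasurable.mul (by fun_prop)
  · exact (hq.measurable.aestronglyMeasurable.mul (by fun_prop)).mul (by fun_prop)
  · refine Eventually.of_forall fun ξ r' hr' => ?_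
    rw [norm_mul, norm_cexp_gauss, norm_mul]
    have h1 : ‖((-(b * ‖ξ‖ ^ 2) : ℝ) : ℂ) + Complex.I * (inner ℝ ξ v : ℝ)‖
        ≤ |b| * ‖ξ‖ ^ 2 + ‖ξ‖ * ‖v‖ := by
      refine (norm_add_le _ _).trans (add_le_add ?_ ?_)
      · rw [Complex.norm_real, norm_neg, norm_mul, norm_pow, norm_norm]; rfl
      · rw [norm_mul, Complex.norm_I, one_mul, Complex.norm_real]
        exact norm_inner_le_norm _ _
    have h2 : Real.exp (-((a + b * r') * ‖ξ‖ ^ 2)) ≤ Real.exp (-(c * ‖ξ‖ ^ 2)) := by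
      gcongr
      exact le_of_lt hr'
    calc _ ≤ (C * ‖ξ‖ ^ n) * (|b| * ‖ξ‖ ^ 2 + ‖ξ‖ * ‖v‖) * Real.exp (-(c * ‖ξ‖ ^ 2)) := by
          gcongr; exact h ξ
      _ = _ := by ring
  · exact ((integrable_pow_mul_exp_neg_mul_norm_sq _ hc0).const_mul _).add
      ((integrable_pow_mul_exp_neg_mul_norm_sq _ hc0).const_mul _)
  · refine Eventually.of_forall fun ξ r' _ => ?_
    have hd : HasDerivAt (fun r' : ℝ => ((-((a + b * r') * ‖ξ‖ ^ 2) : ℝ) : ℂ)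
        + Complex.I * (inner ℝ ξ (x + r' • v) : ℝ))
        (((-(b * ‖ξ‖ ^ 2) : ℝ) : ℂ) + Complex.I * (inner ℝ ξ v : ℝ)) r' := by
      refine HasDerivAt.add (HasDerivAt.ofReal_comp ?_)
        (HasDerivAt.const_mul _ (HasDerivAt.ofReal_comp ?_))
      · have := (((hasDerivAt_id r').const_mul b).const_add a).mul_const (‖ξ‖ ^ 2)
        simpa using this.fun_neg
      · simp_rw [inner_add_right, inner_smul_right]
        simpa using ((hasDerivAt_id r').mul_const (inner ℝ ξ v)).const_add (inner ℝ ξ x)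
    exact ((hd.cexp).const_mul (q ξ)).congr_deriv (by ring)

/-- Parabolic scaling: the substitution `ξ ↦ r ξ` reduces every time to time `1`. -/
theorem waveInt_scale {n : ℕ} {q : E3 → ℂ} (hq : ∀ (r : ℝ) ξ, q (r • ξ) = r ^ n * q ξ)
    {r : ℝ} (hr : 0 < r) (y : E3) :
    waveInt q (r ^ 2) y = ((r ^ (3 + n))⁻¹ : ℝ) * waveInt q 1 (r⁻¹ • y) := by
  have h := Measure.integral_comp_smul (volume : Measure E3) (fun ξ =>
    q ξ * Complex.exp (((-(1 * ‖ξ‖ ^ 2) : ℝ) : ℂ) + Complex.I * (inner ℝ ξ (r⁻¹ • y) : ℝ))) r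
  rw [finrank_euclideanSpace_fin, abs_of_pos (by positivity)] at h
  unfold waveInt
  have h2 : ∀ ξ : E3, q (r • ξ) * Complex.exp (((-(1 * ‖r • ξ‖ ^ 2) : ℝ) : ℂ)
      + Complex.I * (inner ℝ (r • ξ) (r⁻¹ • y) : ℝ))
      = r ^ n * (q ξ * Complex.exp (((-(r ^ 2 * ‖ξ‖ ^ 2) : ℝ) : ℂ)
      + Complex.I * (inner ℝ ξ y : ℝ))) := by
    intro ξ
    rw [hq, norm_smul, Real.norm_of_nonneg hr.le, inner_smul_left, inner_smul_right, mul_assoc]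
    congr 4
    · push_cast; ring
    · congr 1; simp [hr.ne']
  simp_rw [h2] at h
  rw [integral_const_mul] at h
  have hr' : ((r : ℂ)) ≠ 0 := by exact_mod_cast hr.ne'
  have h3 : (r ^ n : ℂ) ≠ 0 := pow_ne_zero _ hr'
  rw [← mul_right_inj' h3, h, Complex.real_smul]
  push_cast
  rw [pow_add]
  field_simp

theorem mon_smul (β : Fin 3 → ℕ) (r : ℝ) (ξ : E3) : mon β (r • ξ) = r ^ len β * mon β ξ := by
  rw [mon, mon, len, ← Finset.prod_pow_eq_pow_sum, ← Finset.prod_mul_distrib]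
  refine Finset.prod_congr rfl fun i _ => ?_
  rw [← mul_pow]
  simp only [PiLp.smul_apply, smul_eq_mul, Complex.ofReal_mul]
  ring

theorem mon_hasTemperateGrowth (β : Fin 3 → ℕ) : (mon β).HasTemperateGrowth := by
  have h : ∀ i : Fin 3, Function.HasTemperateGrowth fun ξ : E3 => Complex.I * (ξ i : ℂ) := fun i =>
    ((Complex.I • Complex.ofRealCLM).comp
      (EuclideanSpace.proj i : E3 →L[ℝ] ℝ)).hasTemperateGrowth
  have h2 : mon β = fun ξ => (Complex.I * (ξ 0 : ℂ)) ^ β 0 * (Complex.I * (ξ 1 : ℂ)) ^ β 1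
      * (Complex.I * (ξ 2 : ℂ)) ^ β 2 := by
    funext ξ; simp [mon, Fin.prod_univ_three]
  rw [h2]
  exact (((h 0).pow _).mul ((h 1).pow _)).mul ((h 2).pow _)

/-- The Schwartz function whose inverse Fourier transform is `waveInt (mon β) 1`. -/
def monGaussian (β : Fin 3 → ℕ) : SchwartzMap E3 ℂ :=
  SchwartzMap.smulLeftCLM ℂ (mon β) (gaussian.postcompCLM Complex.ofRealCLM)

open FourierTransform in
-- A polynomial times a Gaussian is a Schwartz function, so its inverse Fourier transform decays
-- rapidly. This needs a smooth symbol and does not apply to the Helmholtz projection, which is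
-- singular at `ξ = 0`.
theorem waveInt_one (β : Fin 3 → ℕ) (y : E3) :
    waveInt (mon β) 1 y = 𝓕⁻ (monGaussian β) ((2 * Real.pi)⁻¹ • y) := by
  rw [SchwartzMap.fourierInv_coe, Real.fourierInv_eq', waveInt]
  refine integral_congr_ae (Eventually.of_forall fun ξ => ?_)
  simp only [monGaussian, SchwartzMap.smulLeftCLM_apply_apply (mon_hasTemperateGrowth β),
    SchwartzMap.postcompCLM_apply, smul_eq_mul]
  have : gaussian ξ = Real.exp (-‖ξ‖ ^ 2) := rfl
  rw [this, mul_comm (Complex.exp _), mul_assoc, Complex.ofRealCLM_apply, Complex.ofReal_exp,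
    ← Complex.exp_add, inner_smul_right]
  congr 3
  · simp
  · rw [mul_comm]; congr 1; push_cast
    have : (Real.pi : ℂ) ≠ 0 := by exact_mod_cast Real.pi_ne_zero
    field_simp

theorem exists_waveInt_one_le (β : Fin 3 → ℕ) (N : ℕ) :
    ∃ C : ℝ, 0 ≤ C ∧ ∀ y, (1 + ‖y‖) ^ N * ‖waveInt (mon β) 1 y‖ ≤ C := by
  obtain ⟨C0, h0⟩ := (FourierTransform.fourierInv (monGaussian β)).decay 0 0
  obtain ⟨C1, h1⟩ := (FourierTransform.fourierInv (monGaussian β)).decay N 0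
  have hC0 : 0 ≤ C0 := le_trans (by positivity) (h0.2 0)
  have hC1 : 0 ≤ C1 := le_trans (by positivity) (h1.2 0)
  refine ⟨2 ^ N * (C0 + (2 * Real.pi) ^ N * C1), by positivity, fun y => ?_⟩
  rw [waveInt_one]
  have a0 := h0.2 ((2 * Real.pi)⁻¹ • y)
  have a1 := h1.2 ((2 * Real.pi)⁻¹ • y)
  simp only [pow_zero, one_mul, norm_iteratedFDeriv_zero] at a0 a1
  rw [norm_smul, Real.norm_of_nonneg (by positivity), mul_pow, inv_pow] at a1
  set w := ‖(FourierTransform.fourierInv (monGaussian β)) ((2 * Real.pi)⁻¹ • y)‖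
  have hw : 0 ≤ w := norm_nonneg _
  have a2 : ‖y‖ ^ N * w ≤ (2 * Real.pi) ^ N * C1 := by
    have : (0 : ℝ) < (2 * Real.pi) ^ N := by positivity
    calc ‖y‖ ^ N * w = (2 * Real.pi) ^ N * (((2 * Real.pi) ^ N)⁻¹ * ‖y‖ ^ N * w) := by
          field_simp
      _ ≤ _ := by gcongr
  have a3 : (1 + ‖y‖) ^ N ≤ 2 ^ N * (1 + ‖y‖ ^ N) := by
    rcases le_total ‖y‖ 1 with h | h
    · calc (1 + ‖y‖) ^ N ≤ 2 ^ N * 1 := by rw [mul_one]; gcongr; linarith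
        _ ≤ _ := by gcongr; linarith [pow_nonneg (norm_nonneg y) N]
    · calc (1 + ‖y‖) ^ N ≤ (2 * ‖y‖) ^ N := by gcongr; linarith
        _ ≤ _ := by rw [mul_pow]; gcongr; linarith
  calc _ ≤ 2 ^ N * (1 + ‖y‖ ^ N) * w := by gcongr
    _ = 2 ^ N * (w + ‖y‖ ^ N * w) := by ring
    _ ≤ _ := by gcongr

/-- Of the rapid decay at time `1`, exactly `3 + len β` powers are spent: they match the scaling
factor, so the bound is uniform in `s`. -/
theorem exists_waveInt_mon_le (β : Fin 3 → ℕ) :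
    ∃ C : ℝ, 0 ≤ C ∧ ∀ s : ℝ, 0 < s → ∀ y,
      ‖waveInt (mon β) s y‖ ≤ C / (Real.sqrt s + ‖y‖) ^ (3 + len β) := by
  obtain ⟨C, hC, h⟩ := exists_waveInt_one_le β (3 + len β)
  refine ⟨C, hC, fun s hs y => ?_⟩
  have hr : 0 < Real.sqrt s := Real.sqrt_pos.2 hs
  have h1 := waveInt_scale (mon_smul β) hr y
  rw [Real.sq_sqrt hs.le] at h1
  have h2 := h ((Real.sqrt s)⁻¹ • y)
  rw [norm_smul, Real.norm_of_nonneg (by positivity)] at h2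
  rw [h1, norm_mul, Complex.norm_real, Real.norm_of_nonneg (by positivity), le_div_iff₀
    (by positivity)]
  calc _ = (((Real.sqrt s)⁻¹ * (Real.sqrt s + ‖y‖)) ^ (3 + len β))
        * ‖waveInt (mon β) 1 ((Real.sqrt s)⁻¹ • y)‖ := by rw [mul_pow, inv_pow]; ring
    _ = (1 + (Real.sqrt s)⁻¹ * ‖y‖) ^ (3 + len β)
        * ‖waveInt (mon β) 1 ((Real.sqrt s)⁻¹ • y)‖ := by congr 2; field_simp
    _ ≤ C := h2

/-! ### The kernel of the time-dependent Oseen system -/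

/-- Integration of `∫_{s₀}^∞ e^{-zs} ds = e^{-z s₀} / z` against `h`, where `z` has real part
`|ξ|²`. It serves twice: with `c = 0` it removes the division by `|ξ|²` in the Helmholtz projection,
and with `s₀ = 0` it produces the resolvent symbol of `Γ_⊥`. -/
theorem laplace_fubini {h : E3 → ℂ} (hm : AEStronglyMeasurable h) {c : E3 → ℝ}
    (hc : Measurable c) (s₀ : ℝ)
    (hint : Integrable fun ξ => ‖h ξ‖ / ‖ξ‖ ^ 2 * Real.exp (-(s₀ * ‖ξ‖ ^ 2))) :
    Integrable (fun p : ℝ × E3 =>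
        h p.2 * Complex.exp (-(((‖p.2‖ ^ 2 : ℝ) : ℂ) + Complex.I * (c p.2 : ℂ)) * p.1))
      ((volume.restrict (Set.Ioi s₀)).prod volume) ∧
    ∫ s in Set.Ioi s₀, ∫ ξ, h ξ * Complex.exp (-(((‖ξ‖ ^ 2 : ℝ) : ℂ) + Complex.I * (c ξ : ℂ)) * s)
      = ∫ ξ, h ξ / (((‖ξ‖ ^ 2 : ℝ) : ℂ) + Complex.I * (c ξ : ℂ)) *
          Complex.exp (-(((‖ξ‖ ^ 2 : ℝ) : ℂ) + Complex.I * (c ξ : ℂ)) * s₀) := by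
  have hne : ∀ᵐ ξ : E3, ξ ≠ 0 := by
    simp [ae_iff]
  have hre : ∀ ξ : E3, ξ ≠ 0 →
      (-(((‖ξ‖ ^ 2 : ℝ) : ℂ) + Complex.I * (c ξ : ℂ))).re < 0 := by
    intro ξ hξ
    have : 0 < ‖ξ‖ := norm_pos_iff.2 hξ
    simp only [Complex.neg_re, Complex.add_re, Complex.ofReal_re, Complex.mul_re, Complex.I_re,
      Complex.I_im, Complex.ofReal_im, zero_mul, one_mul, sub_zero, add_zero]
    have : 0 < ‖ξ‖ ^ 2 := by positivity
    linarith
  have hnorm : ∀ (ξ : E3) (s : ℝ),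
      ‖h ξ * Complex.exp (-(((‖ξ‖ ^ 2 : ℝ) : ℂ) + Complex.I * (c ξ : ℂ)) * s)‖
      = ‖h ξ‖ * Real.exp (-‖ξ‖ ^ 2 * s) := by
    intro ξ s
    rw [norm_mul, Complex.norm_exp]
    congr 2
    simp [-Complex.ofReal_pow]
  have hI : Integrable (fun p : ℝ × E3 =>
        h p.2 * Complex.exp (-(((‖p.2‖ ^ 2 : ℝ) : ℂ) + Complex.I * (c p.2 : ℂ)) * p.1))
      ((volume.restrict (Set.Ioi s₀)).prod volume) := by
    have hmeas : AEStronglyMeasurable (fun p : ℝ × E3 =>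
        h p.2 * Complex.exp (-(((‖p.2‖ ^ 2 : ℝ) : ℂ) + Complex.I * (c p.2 : ℂ)) * p.1))
        ((volume.restrict (Set.Ioi s₀)).prod volume) :=
      AEStronglyMeasurable.mul hm.comp_snd (Measurable.aestronglyMeasurable (by fun_prop))
    rw [integrable_prod_iff' hmeas]
    constructor
    · filter_upwards [hne] with ξ hξ
      exact (integrableOn_exp_mul_complex_Ioi (hre ξ hξ) s₀).const_mul _
    · refine hint.congr ?_
      filter_upwards [hne] with ξ hξ
      have : 0 < ‖ξ‖ := norm_pos_iff.2 hξ
      simp_rw [hnorm]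
      rw [integral_const_mul, integral_exp_mul_Ioi (by simp [hξ])]
      rw [show -‖ξ‖ ^ 2 * s₀ = -(s₀ * ‖ξ‖ ^ 2) by ring, neg_div_neg_eq]
      ring
  refine ⟨hI, ?_⟩
  rw [integral_integral_swap hI]
  refine integral_congr_ae ?_
  filter_upwards [hne] with ξ hξ
  rw [integral_const_mul, integral_exp_mul_complex_Ioi (hre ξ hξ), neg_div_neg_eq]
  ring

/-- The function `-(2/k) (√τ + b)^{-k}` has derivative `(√τ)⁻¹ (√τ + b)^{-(k+1)}`, which dominates
the integrand because `√τ ≤ √τ + b`. -/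
theorem integral_inv_sqrt_add_pow (k : ℕ) (hk : 0 < k) {s b : ℝ} (hs : 0 < s) (hb : 0 ≤ b) :
    IntegrableOn (fun τ => ((Real.sqrt τ + b) ^ (k + 2))⁻¹) (Set.Ioi s) ∧
    ∫ τ in Set.Ioi s, ((Real.sqrt τ + b) ^ (k + 2))⁻¹ ≤ 2 / k * ((Real.sqrt s + b) ^ k)⁻¹ := by
  have hk' : (0 : ℝ) < k := by exact_mod_cast hk
  have hpos : ∀ τ, s ≤ τ → 0 < Real.sqrt τ := fun τ h => Real.sqrt_pos.2 (hs.trans_le h)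
  set g : ℝ → ℝ := fun τ => -(2 / k) * ((Real.sqrt τ + b) ^ k)⁻¹ with hg
  set g' : ℝ → ℝ := fun τ => (Real.sqrt τ)⁻¹ * ((Real.sqrt τ + b) ^ (k + 1))⁻¹ with hg'
  have hd : ∀ τ, s ≤ τ → HasDerivAt g (g' τ) τ := by
    intro τ hτ
    have h1 := hpos τ hτ
    have h2 := (((Real.hasDerivAt_sqrt (hs.trans_le hτ).ne').add_const b).pow k).inv
      (by simp only [Pi.pow_apply]; positivity)
    refine (h2.const_mul (-(2 / (k : ℝ)))).congr_deriv ?_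
    simp only [hg', Pi.pow_apply]
    obtain ⟨m, rfl⟩ : ∃ m, k = m + 1 := ⟨k - 1, by omega⟩
    simp only [Nat.add_sub_cancel]
    field_simp
    ring
  have hnn : ∀ τ ∈ Set.Ioi s, 0 ≤ g' τ := fun τ hτ => by
    simp only [hg']; positivity
  have hlim : Tendsto g atTop (𝓝 0) := by
    have h1 : Tendsto (fun τ => (Real.sqrt τ + b) ^ k) atTop atTop :=
      (tendsto_pow_atTop hk.ne').comp (tendsto_atTop_add_const_right _ _ Real.tendsto_sqrt_atTop)
    simpa [hg] using! h1.inv_tendsto_atTop.const_mul (-(2 / (k : ℝ)))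
  have hint := integrableOn_Ioi_deriv_of_nonneg' (fun τ hτ => hd τ hτ) hnn hlim
  have hval := integral_Ioi_of_hasDerivAt_of_nonneg' (fun τ hτ => hd τ hτ) hnn hlim
  have hle : ∀ τ ∈ Set.Ioi s, ((Real.sqrt τ + b) ^ (k + 2))⁻¹ ≤ g' τ := by
    intro τ hτ
    have h1 := hpos τ (le_of_lt hτ)
    simp only [hg']
    rw [← mul_inv]
    gcongr
    rw [pow_succ _ (k + 1), mul_comm]
    gcongr
    linarith
  have hi : IntegrableOn (fun τ => ((Real.sqrt τ + b) ^ (k + 2))⁻¹) (Set.Ioi s) := by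
    refine Integrable.mono' hint (by fun_prop) ?_
    filter_upwards [ae_restrict_mem measurableSet_Ioi] with τ hτ
    have h1 := hpos τ (le_of_lt hτ)
    rw [Real.norm_of_nonneg (by positivity)]
    exact hle τ hτ
  refine ⟨hi, (setIntegral_mono_on hi hint measurableSet_Ioi hle).trans (le_of_eq ?_)⟩
  rw [hval]
  simp [hg]

/-- The symbol `(i ξ)^β (δ_jl - ξ_j ξ_l / |ξ|²)`. -/
def osym (j l : Fin 3) (β : Fin 3 → ℕ) (ξ : E3) : ℂ :=
  mon β ξ * (((if j = l then 1 else 0) - ξ j * ξ l / ‖ξ‖ ^ 2 : ℝ) : ℂ)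

theorem abs_helmholtz_le (j l : Fin 3) (ξ : E3) :
    |(if j = l then (1 : ℝ) else 0) - ξ j * ξ l / ‖ξ‖ ^ 2| ≤ 2 := by
  have h1 : |ξ j * ξ l / ‖ξ‖ ^ 2| ≤ 1 := by
    rw [abs_div, abs_mul, abs_of_nonneg (by positivity : (0 : ℝ) ≤ ‖ξ‖ ^ 2)]
    refine div_le_one_of_le₀ ?_ (by positivity)
    rw [sq]
    exact mul_le_mul (PiLp.norm_apply_le ξ j) (PiLp.norm_apply_le ξ l) (abs_nonneg _)
      (norm_nonneg _)
  have h2 : |(if j = l then (1 : ℝ) else 0)| ≤ 1 := by split_ifs <;> simp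
  exact (abs_sub _ _).trans (by linarith)

theorem osym_symbolBound (j l : Fin 3) (β : Fin 3 → ℕ) : SymbolBound (len β) (osym j l β) := by
  have h : SymbolBound 0 fun ξ : E3 =>
      (((if j = l then 1 else 0) - ξ j * ξ l / ‖ξ‖ ^ 2 : ℝ) : ℂ) := by
    refine ⟨by fun_prop, 2, by norm_num, fun ξ => ?_⟩
    rw [Complex.norm_real, pow_zero, mul_one]
    exact abs_helmholtz_le j l ξ
  exact (mon_symbolBound β).mul h

/-- Since `e^{-s|ξ|²} / |ξ|² = ∫_s^∞ e^{-τ|ξ|²} dτ`, the nonsmooth part of the projection is a time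
integral of the polynomial symbol with two more factors, `(iξ_j)(iξ_l) = -ξ_j ξ_l`. -/
theorem waveInt_osym (j l : Fin 3) (β : Fin 3 → ℕ) {s : ℝ} (hs : 0 < s) (y : E3) :
    waveInt (osym j l β) s y = (if j = l then 1 else 0) * waveInt (mon β) s y
      + ∫ τ in Set.Ioi s, waveInt (mon (β + Pi.single j 1 + Pi.single l 1)) τ y := by
  set β' := β + Pi.single j 1 + Pi.single l 1 with hβ'
  have hlen : len β' = len β + 2 := by rw [hβ', len_add_single, len_add_single]
  have hmon : ∀ ξ, mon β' ξ = -(mon β ξ * (ξ j * ξ l)) := by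
    intro ξ
    rw [hβ', mon_add_single, mon_add_single, pow_one, pow_one]
    linear_combination (mon β ξ * ξ j * ξ l) * Complex.I_mul_I
  obtain ⟨C, hC, hb⟩ := (mon_symbolBound β').bound
  have hint : Integrable fun ξ : E3 => ‖mon β' ξ * Complex.exp (Complex.I * (inner ℝ ξ y : ℝ))‖
      / ‖ξ‖ ^ 2 * Real.exp (-(s * ‖ξ‖ ^ 2)) := by
    refine ((integrable_pow_mul_exp_neg_mul_norm_sq (len β) hs).const_mul C).mono' ?_ ?_
    · have := (mon_symbolBound β').measurable
      exact Measurable.aestronglyMeasurable (by fun_prop)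
    · refine Eventually.of_forall fun ξ => ?_
      rw [Real.norm_of_nonneg (by positivity), ← mul_assoc]
      gcongr
      rw [norm_mul, mul_comm Complex.I, Complex.norm_exp_ofReal_mul_I, mul_one]
      refine div_le_of_le_mul₀ (by positivity) (by positivity) ((hb ξ).trans (le_of_eq ?_))
      rw [hlen]; ring
  have hF := (laplace_fubini (h := fun ξ => mon β' ξ * Complex.exp (Complex.I * (inner ℝ ξ y : ℝ)))
    ((mon_symbolBound β').measurable.aestronglyMeasurable.mul (by fun_prop))
    (c := fun _ => 0) measurable_const s hint).2
  have hL : ∀ τ : ℝ, ∫ ξ, mon β' ξ * Complex.exp (Complex.I * (inner ℝ ξ y : ℝ)) *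
      Complex.exp (-(((‖ξ‖ ^ 2 : ℝ) : ℂ) + Complex.I * ((0 : ℝ) : ℂ)) * τ)
      = waveInt (mon β') τ y := by
    intro τ
    unfold waveInt
    refine integral_congr_ae (Eventually.of_forall fun ξ => ?_)
    simp only
    rw [mul_assoc, ← Complex.exp_add]
    congr 2
    push_cast; ring
  simp_rw [hL] at hF
  rw [hF]
  have h2 : waveInt (osym j l β) s y
      = ∫ ξ, ((if j = l then 1 else 0) * (mon β ξ *
          Complex.exp (((-(s * ‖ξ‖ ^ 2) : ℝ) : ℂ) + Complex.I * (inner ℝ ξ y : ℝ)))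
        + mon β' ξ * Complex.exp (Complex.I * (inner ℝ ξ y : ℝ)) /
            (((‖ξ‖ ^ 2 : ℝ) : ℂ) + Complex.I * ((0 : ℝ) : ℂ)) *
          Complex.exp (-(((‖ξ‖ ^ 2 : ℝ) : ℂ) + Complex.I * ((0 : ℝ) : ℂ)) * s)) := by
    refine integral_congr_ae (Eventually.of_forall fun ξ => ?_)
    simp only [osym]
    rw [hmon]
    have : Complex.exp (((-(s * ‖ξ‖ ^ 2) : ℝ) : ℂ) + Complex.I * (inner ℝ ξ y : ℝ))
        = Complex.exp (Complex.I * (inner ℝ ξ y : ℝ)) *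
          Complex.exp (-(((‖ξ‖ ^ 2 : ℝ) : ℂ) + Complex.I * ((0 : ℝ) : ℂ)) * s) := by
      rw [← Complex.exp_add]; congr 1; push_cast; ring
    rw [this]
    push_cast
    simp only [mul_zero, add_zero]
    split_ifs <;> push_cast <;> ring
  rw [h2, integral_add, integral_const_mul]
  · rfl
  · exact ((mon_symbolBound β).integrable hs y).const_mul _
  · refine hint.mono' ?_ (Eventually.of_forall fun ξ => le_of_eq ?_)
    · have := (mon_symbolBound β').measurable
      exact Measurable.aestronglyMeasurable (by fun_prop)
    · rw [norm_mul, norm_div, Complex.norm_exp]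
      congr 2
      · simp
      · simp [mul_comm, -Complex.ofReal_pow]

/-- The two additional derivatives cost two powers of the parabolic distance, and the integral over
`τ` wins them back, so the projection leaves the heat kernel bound intact. -/
theorem exists_waveInt_osym_le (j l : Fin 3) (β : Fin 3 → ℕ) :
    ∃ C : ℝ, 0 ≤ C ∧ ∀ s : ℝ, 0 < s → ∀ y,
      ‖waveInt (osym j l β) s y‖ ≤ C / (Real.sqrt s + ‖y‖) ^ (3 + len β) := by
  obtain ⟨C, hC, h⟩ := exists_waveInt_mon_le β
  obtain ⟨D, hD, h'⟩ := exists_waveInt_mon_le (β + Pi.single j 1 + Pi.single l 1)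
  rw [len_add_single, len_add_single] at h'
  refine ⟨C + D * (2 / (3 + len β : ℕ)), by positivity, fun s hs y => ?_⟩
  obtain ⟨hi, hle⟩ := integral_inv_sqrt_add_pow (3 + len β) (by omega) hs (norm_nonneg y)
  rw [waveInt_osym j l β hs y, add_div]
  refine (norm_add_le _ _).trans (add_le_add ?_ ?_)
  · refine le_trans ?_ (h s hs y)
    rw [norm_mul]
    split_ifs <;> simp
  · calc _ ≤ ∫ τ in Set.Ioi s, D * ((Real.sqrt τ + ‖y‖) ^ (3 + len β + 2))⁻¹ := by
          refine norm_integral_le_of_norm_le (hi.const_mul D) ?_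
          filter_upwards [ae_restrict_mem measurableSet_Ioi] with τ hτ
          exact h' τ (hs.trans hτ) y
      _ ≤ _ := by
          rw [integral_const_mul, mul_div_assoc, div_eq_mul_inv (2 / _ : ℝ)]
          exact mul_le_mul_of_nonneg_left hle hD

/-- The drift vector `λ e₁`. -/
def drift (lam : ℝ) : E3 := lam • EuclideanSpace.single 0 1

theorem inner_drift (lam : ℝ) (ξ : E3) : inner ℝ ξ (drift lam) = lam * ξ 0 := by
  rw [drift, inner_smul_right, EuclideanSpace.inner_single_right]
  simp

theorem norm_drift (lam : ℝ) : ‖drift lam‖ = |lam| := by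
  simp [drift, norm_smul]

/-- The entries of `∂_x^β` of the fundamental solution of the time-dependent Oseen system. -/
def kern (lam : ℝ) (j l : Fin 3) (β : Fin 3 → ℕ) (s : ℝ) (x : E3) : ℝ :=
  ((2 * Real.pi) ^ 3)⁻¹ * (waveInt (osym j l β) s (x + s • drift lam)).re

/-- The symbol takes conjugate values at `ξ` and `-ξ`. The integral is therefore real, and the real
part in `kern` loses nothing. -/
theorem conj_waveInt_osym (j l : Fin 3) (β : Fin 3 → ℕ) (s : ℝ) (y : E3) :
    (starRingEnd ℂ) (waveInt (osym j l β) s y) = waveInt (osym j l β) s y := by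
  unfold waveInt
  rw [← integral_conj, ← integral_neg_eq_self]
  refine integral_congr_ae (Eventually.of_forall fun ξ => ?_)
  simp only [map_mul, osym, mon, map_prod, map_pow, ← Complex.exp_conj, map_add, Complex.conj_ofReal,
    Complex.conj_I, PiLp.neg_apply, norm_neg, inner_neg_left, neg_mul_neg, Complex.ofReal_neg,
    map_neg]

theorem kern_ofReal (lam : ℝ) (j l : Fin 3) (β : Fin 3 → ℕ) (s : ℝ) (x : E3) :
    (kern lam j l β s x : ℂ)
      = (((2 * Real.pi) ^ 3)⁻¹ : ℝ) * waveInt (osym j l β) s (x + s • drift lam) := by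
  rw [kern, Complex.ofReal_mul]
  congr 1
  exact Complex.conj_eq_iff_re.1 (conj_waveInt_osym j l β s _)

theorem exists_kern_le (lam : ℝ) (j l : Fin 3) (β : Fin 3 → ℕ) :
    ∃ C : ℝ, 0 ≤ C ∧ ∀ s : ℝ, 0 < s → ∀ x,
      |kern lam j l β s x| ≤ C / (Real.sqrt s + ‖x + s • drift lam‖) ^ (3 + len β) := by
  obtain ⟨C, hC, h⟩ := exists_waveInt_osym_le j l β
  refine ⟨((2 * Real.pi) ^ 3)⁻¹ * C, by positivity, fun s hs x => ?_⟩
  rw [kern, abs_mul, abs_of_nonneg (by positivity : (0 : ℝ) ≤ ((2 * Real.pi) ^ 3)⁻¹), mul_div_assoc]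
  gcongr
  exact (Complex.abs_re_le_norm _).trans (h s hs _)

theorem waveInt_sum {ι : Type*} (t : Finset ι) {q : ι → E3 → ℂ} {n : ι → ℕ}
    (hq : ∀ i, SymbolBound (n i) (q i)) (c : ι → ℂ) {s : ℝ} (hs : 0 < s) (y : E3) :
    waveInt (fun ξ => ∑ i ∈ t, c i * q i ξ) s y = ∑ i ∈ t, c i * waveInt (q i) s y := by
  unfold waveInt
  simp_rw [Finset.sum_mul, mul_assoc]
  rw [integral_finsetSum _ fun i _ => ((hq i).integrable hs y).const_mul (c i)]
  simp_rw [integral_const_mul]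

theorem osym_add_single (j l : Fin 3) (β : Fin 3 → ℕ) (i : Fin 3) (n : ℕ) (ξ : E3) :
    osym j l (β + Pi.single i n) ξ = osym j l β ξ * (Complex.I * ξ i) ^ n := by
  rw [osym, osym, mon_add_single]; ring

theorem hasDerivAt_kern_line (lam : ℝ) (j l : Fin 3) (β : Fin 3 → ℕ) {s : ℝ} (hs : 0 < s)
    (x v : E3) (r : ℝ) :
    HasDerivAt (fun r : ℝ => kern lam j l β s (x + r • v))
      (∑ i, v i * kern lam j l (β + Pi.single i 1) s (x + r • v)) r := by
  have h := hasDerivAt_waveInt (osym_symbolBound j l β) s 0 (x + s • drift lam) v (r := r)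
    (by linarith)
  have hq : (fun ξ => osym j l β ξ * (((-(0 * ‖ξ‖ ^ 2) : ℝ) : ℂ) + Complex.I * (inner ℝ ξ v : ℝ)))
      = fun ξ => ∑ i, (v i : ℂ) * osym j l (β + Pi.single i 1) ξ := by
    funext ξ
    simp_rw [osym_add_single]
    simp only [PiLp.inner_apply, RCLike.inner_apply, conj_trivial, Complex.ofReal_sum,
      Finset.mul_sum, zero_mul, neg_zero, Complex.ofReal_zero, zero_add, pow_one]
    refine Finset.sum_congr rfl fun i _ => ?_
    push_cast; ring
  have hsum := waveInt_sum Finset.univ (q := fun i : Fin 3 => osym j l (β + Pi.single i 1))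
    (fun i => osym_symbolBound j l (β + Pi.single i 1)) (fun i => (v i : ℂ)) (s := s + 0 * r)
    (by linarith) (x + s • drift lam + r • v)
  rw [hq, hsum] at h
  simp only [zero_mul, add_zero] at h
  have h2 := (Complex.reCLM.hasFDerivAt.comp_hasDerivAt r h).const_mul (((2 * Real.pi) ^ 3)⁻¹ : ℝ)
  have e : ∀ r' : ℝ, x + s • drift lam + r' • v = x + r' • v + s • drift lam := fun r' => by abel
  simp_rw [Function.comp_def, e] at h2
  refine h2.congr_deriv ?_
  simp only [Complex.reCLM_apply, Complex.re_sum, Complex.re_ofReal_mul, Finset.mul_sum, kern]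
  refine Finset.sum_congr rfl fun i _ => ?_
  ring

/-- The Oseen equation `∂ₛ = Δ + λ ∂₁`: differentiation in `s` brings down `-|ξ|² + iλξ₁`, which is
`∑ (iξᵢ)² + λ (iξ₁)`. This trade of a time derivative for spatial ones drives the decay argument. -/
theorem hasDerivAt_kern_time (lam : ℝ) (j l : Fin 3) (β : Fin 3 → ℕ) {s : ℝ} (hs : 0 < s) (x : E3) :
    HasDerivAt (fun s : ℝ => kern lam j l β s x)
      (∑ i, kern lam j l (β + Pi.single i 2) s x + lam * kern lam j l (β + Pi.single 0 1) s x) s := by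
  have h := hasDerivAt_waveInt (osym_symbolBound j l β) 0 1 x (drift lam) (r := s)
    (by linarith)
  have hq : (fun ξ => osym j l β ξ * (((-(1 * ‖ξ‖ ^ 2) : ℝ) : ℂ) +
        Complex.I * (inner ℝ ξ (drift lam) : ℝ)))
      -- The index `none` carries the drift term and `some i` the second derivatives, so that one
      -- application of `waveInt_sum` covers both.
      = fun ξ => ∑ i : Option (Fin 3), (i.elim (lam : ℂ) fun _ => 1) *
        i.elim (osym j l (β + Pi.single 0 1)) (fun i => osym j l (β + Pi.single i 2)) ξ := by
    funext ξ
    rw [Fintype.sum_option]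
    simp only [Option.elim_none, Option.elim_some, one_mul, osym_add_single, inner_drift, mul_pow,
      Complex.I_sq, pow_one]
    rw [← Finset.mul_sum, EuclideanSpace.norm_sq_eq]
    simp only [Real.norm_eq_abs, sq_abs, Complex.ofReal_neg, Complex.ofReal_sum, Complex.ofReal_pow,
      Complex.ofReal_mul, neg_mul, one_mul, Finset.sum_neg_distrib]
    ring
  have hb : ∀ i : Option (Fin 3), SymbolBound (i.elim (len (β + Pi.single 0 1))
      (fun i => len (β + Pi.single i 2)))
      (i.elim (osym j l (β + Pi.single 0 1)) (fun i => osym j l (β + Pi.single i 2))) := by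
    rintro (_ | i)
    · exact osym_symbolBound j l _
    · exact osym_symbolBound j l _
  rw [hq, waveInt_sum _ hb _ (by linarith), Fintype.sum_option] at h
  simp only [zero_add, one_mul, Option.elim_none, Option.elim_some] at h
  have h2 := (Complex.reCLM.hasFDerivAt.comp_hasDerivAt s h).const_mul (((2 * Real.pi) ^ 3)⁻¹ : ℝ)
  refine h2.congr_deriv ?_
  simp only [Complex.reCLM_apply, Complex.add_re, Complex.re_sum, Complex.re_ofReal_mul,
    kern, ← Finset.mul_sum]
  ring

theorem measurable_kern (lam : ℝ) (j l : Fin 3) (β : Fin 3 → ℕ) :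
    Measurable fun p : ℝ × E3 => kern lam j l β p.1 p.2 := by
  have := (osym_symbolBound j l β).measurable
  have h : StronglyMeasurable fun p : (ℝ × E3) × E3 => osym j l β p.2 *
      Complex.exp (((-(p.1.1 * ‖p.2‖ ^ 2) : ℝ) : ℂ) +
        Complex.I * (inner ℝ p.2 (p.1.2 + p.1.1 • drift lam) : ℝ)) :=
    Measurable.stronglyMeasurable (by fun_prop)
  have h2 := (h.integral_prod_right' (ν := volume)).measurable
  exact (Complex.measurable_re.comp h2).const_mul _

theorem continuous_kern (lam : ℝ) (j l : Fin 3) (β : Fin 3 → ℕ) {s : ℝ} (hs : 0 < s) :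
    Continuous fun x => kern lam j l β s x := by
  have hq := osym_symbolBound j l β
  refine continuous_const.mul (Complex.continuous_re.comp ?_)
  refine continuous_of_dominated (bound := fun ξ => ‖osym j l β ξ *
    Complex.exp (((-(s * ‖ξ‖ ^ 2) : ℝ) : ℂ) + Complex.I * (inner ℝ ξ (0 : E3) : ℝ))‖)
    (fun x => (hq.integrable hs _).aestronglyMeasurable) (fun x => Eventually.of_forall fun ξ => ?_)
    (hq.integrable hs 0).norm (Eventually.of_forall fun ξ => by fun_prop)
  rw [norm_mul, norm_mul, norm_cexp_gauss, norm_cexp_gauss]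

/-! ### Periodization -/

theorem integrable_tsum_of_summable_integral_norm {Z E : Type*} [MeasurableSpace Z]
    [NormedAddCommGroup E] [CompleteSpace E] {ζ : Measure Z} {f : ℕ → Z → E}
    (hf : ∀ n, Integrable (f n) ζ) (hs : Summable fun n => ∫ z, ‖f n z‖ ∂ζ) :
    (∀ᵐ z ∂ζ, Summable fun n => ‖f n z‖) ∧ Integrable (fun z => ∑' n, ‖f n z‖) ζ ∧
    Integrable (fun z => ∑' n, f n z) ζ := by
  have he : ∑' n, eLpNorm (f n) 1 ζ ≠ ⊤ := by
    have : ∀ n, eLpNorm (f n) 1 ζ = ENNReal.ofReal (∫ z, ‖f n z‖ ∂ζ) := fun n => by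
      rw [eLpNorm_one_eq_lintegral_enorm, ofReal_integral_norm_eq_lintegral_enorm (hf n)]
    simp_rw [this]
    exact hs.tsum_ofReal_ne_top
  have hsum := summable_norm_of_tsum_eLpNorm_ne_top le_rfl (fun n => (hf n).1) he
  have hm : AEStronglyMeasurable (fun z => ∑' n, f n z) ζ := by
    refine aestronglyMeasurable_of_tendsto_ae atTop
      (f := fun N z => ∑ n ∈ Finset.range N, f n z)
      (fun N => (integrable_finsetSum _ fun n _ => hf n).1) ?_
    filter_upwards [hsum] with z hz
    exact hz.of_norm.hasSum.tendsto_sum_nat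
  have hI : Integrable (fun z => ∑' n, ‖f n z‖) ζ := by
    have hm' : AEStronglyMeasurable (fun z => ∑' n, ‖f n z‖) ζ := by
      refine aestronglyMeasurable_of_tendsto_ae atTop
        (f := fun N z => ∑ n ∈ Finset.range N, ‖f n z‖)
        (fun N => (integrable_finsetSum _ fun n _ => (hf n).norm).1) ?_
      filter_upwards [hsum] with z hz
      exact hz.hasSum.tendsto_sum_nat
    refine ⟨hm', ?_⟩
    rw [hasFiniteIntegral_iff_enorm]
    calc ∫⁻ z, ‖∑' n, ‖f n z‖‖ₑ ∂ζ = ∫⁻ z, ∑' n, ‖f n z‖ₑ ∂ζ := by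
          refine lintegral_congr_ae ?_
          filter_upwards [hsum] with z hz
          rw [Real.enorm_of_nonneg (tsum_nonneg fun n => norm_nonneg _),
            ENNReal.ofReal_tsum_of_nonneg (fun n => norm_nonneg _) hz]
          simp
      _ = ∑' n, eLpNorm (f n) 1 ζ := by
          rw [lintegral_tsum fun n => (hf n).1.enorm]
          simp_rw [eLpNorm_one_eq_lintegral_enorm]
      _ < ⊤ := he.lt_top
  refine ⟨hsum, hI, hI.mono' hm ?_⟩
  filter_upwards [hsum] with z hz
  exact norm_tsum_le_tsum_norm hz

/-- Unfolding in abstract form: if `Z` is carried by `e n` onto the cell `A n`, integrating over all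
cells is integrating over `Z` the sum over cells. The cells used later are `(nT, nT + T]`, alone or
times `ℝ³`. -/
theorem integral_tsum_comp_measurePreserving {Y Z E : Type*} [MeasurableSpace Y]
    [MeasurableSpace Z] [NormedAddCommGroup E] [NormedSpace ℝ E] [CompleteSpace E]
    {ζ : Measure Z} {ν : Measure Y} {e : ℕ → Z → Y} {A : ℕ → Set Y}
    (hA : ∀ n, MeasurableSet (A n)) (hd : Pairwise (Function.onFun Disjoint A))
    (he : ∀ n, MeasurePreserving (e n) ζ (ν.restrict (A n))) {g : Y → E}
    (hg : IntegrableOn g (⋃ n, A n) ν) :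
    (∀ᵐ z ∂ζ, Summable fun n => ‖g (e n z)‖) ∧ Integrable (fun z => ∑' n, ‖g (e n z)‖) ζ ∧
    Integrable (fun z => ∑' n, g (e n z)) ζ ∧
    ∫ z, ∑' n, g (e n z) ∂ζ = ∫ y in ⋃ n, A n, g y ∂ν ∧
    ∫ z, ∑' n, ‖g (e n z)‖ ∂ζ = ∫ y in ⋃ n, A n, ‖g y‖ ∂ν := by
  have hgn : ∀ n, IntegrableOn g (A n) ν := fun n => hg.mono_set (Set.subset_iUnion A n)
  have hf : ∀ n, Integrable (fun z => g (e n z)) ζ := fun n =>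
    ((he n).integrable_comp (hgn n).1).2 (hgn n)
  have hint : ∀ n, ∫ z, g (e n z) ∂ζ = ∫ y in A n, g y ∂ν := fun n => by
    rw [← (he n).map_eq, integral_map (he n).aemeasurable]
    rw [(he n).map_eq]; exact (hgn n).1
  have hintn : ∀ n, ∫ z, ‖g (e n z)‖ ∂ζ = ∫ y in A n, ‖g y‖ ∂ν := fun n => by
    rw [← (he n).map_eq, integral_map (he n).aemeasurable]
    rw [(he n).map_eq]; exact (hgn n).1.norm
  have hs := hasSum_integral_iUnion hA hd hg
  have hsn := hasSum_integral_iUnion hA hd hg.norm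
  simp_rw [← hint] at hs
  simp_rw [← hintn] at hsn
  obtain ⟨h1, h2, h3⟩ := integrable_tsum_of_summable_integral_norm hf hsn.summable
  refine ⟨h1, h2, h3, ?_, ?_⟩
  · exact (hasSum_integral_of_summable_integral_norm hf hsn.summable).unique hs
  · exact (hasSum_integral_of_summable_integral_norm (fun n => (hf n).norm)
      (by simpa using hsn.summable)).unique hsn

theorem iUnion_Ioc_add_natCast_mul {T : ℝ} (hT : 0 < T) :
    ⋃ n : ℕ, Set.Ioc (n * T) (n * T + T) = Set.Ioi 0 := by
  ext s
  simp only [Set.mem_iUnion, Set.mem_Ioc, Set.mem_Ioi]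
  constructor
  · rintro ⟨n, h, -⟩
    exact lt_of_le_of_lt (by positivity) h
  · intro hs
    have h1 : 0 < s / T := by positivity
    -- The cells are open on the left and closed on the right, so the index is the ceiling minus
    -- one.
    obtain ⟨m, hm⟩ : ∃ m, ⌈s / T⌉₊ = m + 1 := ⟨⌈s / T⌉₊ - 1, by
      have := Nat.ceil_pos.2 h1; omega⟩
    refine ⟨m, ?_, ?_⟩
    · have := (Nat.lt_ceil (a := s / T) (n := m)).1 (by omega)
      rwa [lt_div_iff₀ hT] at this
    · have := Nat.le_ceil (s / T)
      rw [hm, div_le_iff₀ hT] at this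
      push_cast at this; linarith

theorem pairwise_disjoint_Ioc_natCast_mul {T : ℝ} (hT : 0 < T) :
    Pairwise (Function.onFun Disjoint fun n : ℕ => Set.Ioc (n * T) (n * T + T)) := by
  have key : ∀ m n : ℕ, m < n → Disjoint (Set.Ioc (m * T) (m * T + T))
      (Set.Ioc (n * T) (n * T + T)) := by
    intro m n hmn
    rw [Set.disjoint_left]
    rintro s ⟨_, h1⟩ ⟨h2, _⟩
    have : (m : ℝ) + 1 ≤ n := by exact_mod_cast hmn
    nlinarith
  intro m n hmn
  rcases lt_or_gt_of_ne hmn with h | h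
  · exact key m n h
  · exact (key n m h).symm

theorem measurePreserving_add_Ioc (T c : ℝ) :
    MeasurePreserving (fun s => s + c) (volume.restrict (Set.Ioc 0 T))
      (volume.restrict (Set.Ioc c (c + T))) := by
  have h := (measurePreserving_add_right (volume : Measure ℝ) c).restrict_preimage
    (measurableSet_Ioc (a := c) (b := c + T))
  convert h using 2
  ext s; simp [add_comm]

/-- The sum `∑ₙ g(t + nT)`. -/
def perSum (T : ℝ) (g : ℝ → ℝ) (t : ℝ) : ℝ := ∑' n : ℕ, g (t + n * T)

theorem setIntegral_perSum {T : ℝ} (hT : 0 < T) {g : ℝ → ℝ} (hg : IntegrableOn g (Set.Ioi 0)) :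
    IntegrableOn (perSum T g) (Set.Ioc 0 T) ∧
    ∫ t in Set.Ioc 0 T, perSum T g t = ∫ s in Set.Ioi 0, g s := by
  rw [← iUnion_Ioc_add_natCast_mul hT] at hg ⊢
  have h := integral_tsum_comp_measurePreserving (fun n => measurableSet_Ioc)
    (pairwise_disjoint_Ioc_natCast_mul hT) (fun n : ℕ => measurePreserving_add_Ioc T (n * T)) hg
  exact ⟨h.2.2.1, h.2.2.2.1⟩

/-- The deviation of `T ∑ₙ g(t + nT)` from its mean `∫_0^∞ g`. -/
def perFluct (T : ℝ) (g : ℝ → ℝ) (t : ℝ) : ℝ := T * perSum T g t - ∫ s in Set.Ioi 0, g s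

/-! ### Decay of periodized families -/

/-- The weight `(R + s)^{-3/2}`. -/
def decayWeight (R s : ℝ) : ℝ := (s + R) ^ (-(3 / 2) : ℝ)

theorem decayWeight_nonneg {R s : ℝ} (hR : 0 < R) (hs : 0 ≤ s) : 0 ≤ decayWeight R s := by
  unfold decayWeight; positivity

theorem integrableOn_decayWeight {R : ℝ} (hR : 0 < R) :
    IntegrableOn (decayWeight R) (Set.Ioi 0) :=
  integrableOn_add_rpow_Ioi_of_lt (by norm_num) (by linarith)

theorem summable_decayWeight {R T : ℝ} (hR : 0 < R) (hT : 0 < T) :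
    Summable fun n : ℕ => decayWeight R (n * T) := by
  have h := ((Real.summable_one_div_nat_add_rpow (R / T) (3 / 2)).2 (by norm_num)).mul_left
    (T ^ (-(3 / 2) : ℝ))
  refine h.congr fun n => ?_
  have h1 : (0 : ℝ) < n + R / T := by positivity
  rw [decayWeight, abs_of_pos h1, one_div, ← Real.rpow_neg h1.le,
    ← Real.mul_rpow hT.le h1.le]
  congr 1
  field_simp

theorem decayWeight_anti {R s t : ℝ} (hR : 0 < R) (hs : 0 ≤ s) (h : s ≤ t) :
    decayWeight R t ≤ decayWeight R s := by
  unfold decayWeight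
  exact Real.rpow_le_rpow_of_nonpos (by linarith) (by linarith) (by norm_num)

/-- A family of functions of time closed under differentiation as the derivatives of a solution
of the drift-diffusion equation are, with parabolic decay at distance `r`. -/
structure OseenFamily (lam κ R : ℝ) (a : ℕ) (A : (Fin 3 → ℕ) → ℝ) (r : ℝ) (ρ : ℝ → ℝ)
    (Φ : (Fin 3 → ℕ) → ℝ → ℝ) : Prop where
  le_r : R ≤ r
  deriv : ∀ β s, 0 < s → HasDerivAt (Φ β)
    (∑ i, Φ (β + Pi.single i 2) s + lam * Φ (β + Pi.single 0 1) s) s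
  bound : ∀ β s, 0 < s → |Φ β s| ≤ A β / ρ s ^ (a + len β)
  pos : ∀ s, 0 < s → 0 < ρ s
  lower : ∀ s, 0 < s → κ * Real.sqrt (r + s) ≤ ρ s
  near : ∃ s₀ > 0, ∀ s, 0 < s → s < s₀ → r / 2 ≤ ρ s

section Family

variable {lam κ R T : ℝ} {a : ℕ} {A : (Fin 3 → ℕ) → ℝ} {r : ℝ} {ρ : ℝ → ℝ}
  {Φ : (Fin 3 → ℕ) → ℝ → ℝ}

/-- The constant in the crude bound for an `OseenFamily`. -/
def crudeConst (κ R : ℝ) (a : ℕ) (A : (Fin 3 → ℕ) → ℝ) (β : Fin 3 → ℕ) : ℝ :=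
  A β / (κ ^ (a + len β) * Real.sqrt R ^ (a - 3))

/-- The bound is a power `a + len β` of `κ √(r + s)`. Of it, `len β` factors are kept as `√r`, three
become the integrable weight `(s + R)^{-3/2}` in time, and the other `a - 3` are absorbed into the
constant. -/
theorem OseenFamily.crude (hκ : 0 < κ) (hR : 0 < R) (ha : 3 ≤ a) (hA : ∀ β, 0 ≤ A β)
    (h : OseenFamily lam κ R a A r ρ Φ) (β : Fin 3 → ℕ) {s : ℝ} (hs : 0 < s) :
    |Φ β s| ≤ crudeConst κ R a A β / Real.sqrt r ^ len β * decayWeight R s := by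
  have hr : 0 < r := hR.trans_le h.le_r
  refine (h.bound β s hs).trans ?_
  have hσ : 0 < Real.sqrt (r + s) := Real.sqrt_pos.2 (by linarith)
  have h3 : decayWeight R s = (Real.sqrt (s + R) ^ 3)⁻¹ := by
    rw [decayWeight, Real.sqrt_eq_rpow, ← Real.rpow_natCast, ← Real.rpow_mul (by linarith),
      ← Real.rpow_neg (by linarith)]
    norm_num
  have hsr : 0 < Real.sqrt r := Real.sqrt_pos.2 hr
  have hsR : 0 < Real.sqrt R := Real.sqrt_pos.2 hR
  have hsR' : 0 < Real.sqrt (s + R) := Real.sqrt_pos.2 (by linarith)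
  rw [h3, crudeConst, div_div, ← div_eq_mul_inv, div_div]
  refine div_le_div_of_nonneg_left (hA β) (by positivity) ?_
  calc κ ^ (a + len β) * Real.sqrt R ^ (a - 3) * Real.sqrt r ^ len β * Real.sqrt (s + R) ^ 3
      ≤ κ ^ (a + len β) * Real.sqrt (r + s) ^ (a - 3) * Real.sqrt (r + s) ^ len β
        * Real.sqrt (r + s) ^ 3 := by
        have h0 := h.le_r
        have q1 : Real.sqrt R ≤ Real.sqrt (r + s) := Real.sqrt_le_sqrt (by linarith)
        have q2 : Real.sqrt r ≤ Real.sqrt (r + s) := Real.sqrt_le_sqrt (by linarith)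
        have q3 : Real.sqrt (s + R) ≤ Real.sqrt (r + s) := Real.sqrt_le_sqrt (by linarith)
        gcongr
    _ = (κ * Real.sqrt (r + s)) ^ (a + len β) := by
        rw [mul_pow, mul_assoc, mul_assoc, ← pow_add, ← pow_add]
        congr 2; omega
    _ ≤ _ := pow_le_pow_left₀ (by positivity) (h.lower s hs) _

theorem crudeConst_nonneg (hκ : 0 < κ) (hA : ∀ β, 0 ≤ A β) (β : Fin 3 → ℕ) :
    0 ≤ crudeConst κ R a A β := by
  have := hA β
  unfold crudeConst; positivity

theorem OseenFamily.integrableOn (hκ : 0 < κ) (hR : 0 < R) (ha : 3 ≤ a) (hA : ∀ β, 0 ≤ A β)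
    (h : OseenFamily lam κ R a A r ρ Φ) (β : Fin 3 → ℕ) : IntegrableOn (Φ β) (Set.Ioi 0) := by
  refine ((integrableOn_decayWeight hR).const_mul
    (crudeConst κ R a A β / Real.sqrt r ^ len β)).mono' ?_ ?_
  · refine ContinuousOn.aestronglyMeasurable (fun s hs => ?_) measurableSet_Ioi
    exact (h.deriv β s hs).continuousAt.continuousWithinAt
  · filter_upwards [ae_restrict_mem measurableSet_Ioi] with s hs
    exact h.crude hκ hR ha hA β hs

theorem OseenFamily.summable (hκ : 0 < κ) (hR : 0 < R) (ha : 3 ≤ a) (hA : ∀ β, 0 ≤ A β)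
    (hT : 0 < T) (h : OseenFamily lam κ R a A r ρ Φ) (β : Fin 3 → ℕ) :
    Summable (fun n : ℕ => crudeConst κ R a A β / Real.sqrt r ^ len β * decayWeight R (n * T)) ∧
    (∀ (n : ℕ) (t : ℝ), 0 < t → |Φ β (t + n * T)| ≤
      crudeConst κ R a A β / Real.sqrt r ^ len β * decayWeight R (n * T)) ∧
    ∀ t, 0 < t → Summable fun n : ℕ => Φ β (t + n * T) := by
  have h1 := (summable_decayWeight hR hT).mul_left (crudeConst κ R a A β / Real.sqrt r ^ len β)
  have h2 : ∀ (n : ℕ) (t : ℝ), 0 < t → |Φ β (t + n * T)| ≤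
      crudeConst κ R a A β / Real.sqrt r ^ len β * decayWeight R (n * T) := by
    intro n t ht
    refine (h.crude hκ hR ha hA β (by positivity)).trans ?_
    have h4 := crudeConst_nonneg (R := R) (a := a) hκ hA β
    exact mul_le_mul_of_nonneg_left (decayWeight_anti hR (by positivity) (by linarith))
      (by positivity)
  exact ⟨h1, h2, fun t ht => Summable.of_norm_bounded h1 fun n => h2 n t ht⟩

/-- The terms have summable bounds uniform in `t > 0`, which justifies termwise differentiation. -/
theorem OseenFamily.hasDerivAt_perSum (hκ : 0 < κ) (hR : 0 < R) (ha : 3 ≤ a) (hA : ∀ β, 0 ≤ A β)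
    (hT : 0 < T) (h : OseenFamily lam κ R a A r ρ Φ) (β : Fin 3 → ℕ) {t : ℝ} (ht : 0 < t) :
    HasDerivAt (perSum T (Φ β)) (∑ i, perSum T (Φ (β + Pi.single i 2)) t
      + lam * perSum T (Φ (β + Pi.single 0 1)) t) t := by
  have hsum := fun β => h.summable hκ hR ha hA hT β
  set g' : ℕ → ℝ → ℝ := fun n t => ∑ i, Φ (β + Pi.single i 2) (t + n * T)
    + lam * Φ (β + Pi.single 0 1) (t + n * T) with hg'
  obtain ⟨u, hu, hgu⟩ : ∃ u : ℕ → ℝ, Summable u ∧ ∀ n y, 0 < y → ‖g' n y‖ ≤ u n := by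
    have hx : ∀ β' : Fin 3 → ℕ, ∃ u : ℕ → ℝ, Summable u ∧
        ∀ (n : ℕ) (t : ℝ), 0 < t → |Φ β' (t + n * T)| ≤ u n :=
      fun β' => ⟨_, (hsum β').1, (hsum β').2.1⟩
    choose u hu1 hu2 using hx
    have s1 : Summable fun n => ∑ i : Fin 3, u (β + Pi.single i 2) n :=
      summable_sum fun i _ => hu1 (β + Pi.single i 2)
    have s2 : Summable fun n => |lam| * u (β + Pi.single 0 1) n := (hu1 _).mul_left |lam|
    refine ⟨_, s1.add s2, fun n y hy => ?_⟩
    rw [Real.norm_eq_abs]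
    refine (abs_add_le _ _).trans (add_le_add ?_ ?_)
    · refine (Finset.abs_sum_le_sum_abs _ _).trans (Finset.sum_le_sum fun i _ => ?_)
      exact hu2 _ n y hy
    · rw [abs_mul]
      exact mul_le_mul_of_nonneg_left (hu2 _ n y hy) (abs_nonneg _)
  have hg : ∀ (n : ℕ) (y : ℝ), y ∈ Set.Ioi (0 : ℝ) →
      HasDerivAt (fun t => Φ β (t + n * T)) (g' n y) y := by
    intro n y hy
    have hy' : (0 : ℝ) < y := hy
    exact (h.deriv β (y + n * T) (by positivity)).comp_add_const y (n * T)
  have h1 : HasDerivAt (fun t => ∑' n : ℕ, Φ β (t + n * T)) (∑' n : ℕ, g' n t) t :=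
    hasDerivAt_tsum_of_isPreconnected (y₀ := t) hu isOpen_Ioi isPreconnected_Ioi hg hgu
      (Set.mem_Ioi.2 ht) ((hsum β).2.2 t ht) (Set.mem_Ioi.2 ht)
  refine h1.congr_deriv ?_
  have t1 : ∀ β', Summable fun n : ℕ => Φ β' (t + n * T) := fun β' => (hsum β').2.2 t ht
  have t2 : Summable fun n : ℕ => ∑ i : Fin 3, Φ (β + Pi.single i 2) (t + n * T) :=
    summable_sum fun i _ => t1 (β + Pi.single i 2)
  have t3 : Summable fun n : ℕ => lam * Φ (β + Pi.single 0 1) (t + n * T) := (t1 _).mul_left lam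
  have t4 := t2.tsum_add t3
  have t5 := Summable.tsum_finsetSum (s := Finset.univ)
    fun (i : Fin 3) _ => t1 (β + Pi.single i 2)
  rw [t5, tsum_mul_left] at t4
  exact t4

/-- The combined integrand is the time derivative of `Φ β`, which vanishes at infinity; only the
value near `s = 0` is left, where `ρ ≥ r / 2`. The combination is thus of order `r^{-(a + len β)}`,
with a full power of `r` per derivative where the crude bound gives `√r`. -/
theorem OseenFamily.abs_integral_deriv_le (hκ : 0 < κ) (hR : 0 < R) (ha : 3 ≤ a)
    (hA : ∀ β, 0 ≤ A β) (h : OseenFamily lam κ R a A r ρ Φ) (β : Fin 3 → ℕ) :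
    |∑ i, (∫ s in Set.Ioi 0, Φ (β + Pi.single i 2) s)
      + lam * ∫ s in Set.Ioi 0, Φ (β + Pi.single 0 1) s| ≤ A β / (r / 2) ^ (a + len β) := by
  have hr : 0 < r := hR.trans_le h.le_r
  have hint := fun β => h.integrableOn hκ hR ha hA β
  set D : ℝ → ℝ := fun s => ∑ i, Φ (β + Pi.single i 2) s + lam * Φ (β + Pi.single 0 1) s with hD
  have hDint : IntegrableOn D (Set.Ioi 0) :=
    (integrable_finsetSum _ fun i _ => hint _).add ((hint _).const_mul lam)
  have e1 : ∑ i, (∫ s in Set.Ioi 0, Φ (β + Pi.single i 2) s)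
      + lam * ∫ s in Set.Ioi 0, Φ (β + Pi.single 0 1) s = ∫ s in Set.Ioi 0, D s := by
    rw [hD, integral_add (integrable_finsetSum _ fun i _ => hint _) ((hint _).const_mul lam),
      integral_finsetSum _ fun i _ => hint _, integral_const_mul]
  rw [e1]
  obtain ⟨s₀, hs₀, hnear⟩ := h.near
  -- Nothing is assumed about `Φ β` at `s = 0` itself, so the integral is reached as a limit of
  -- integrals over `(ε, ∞)`.
  have hlim : Tendsto (fun ε => |∫ s in Set.Ioi ε, D s|) (𝓝[>] 0) (𝓝 |∫ s in Set.Ioi 0, D s|) := by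
    refine Tendsto.abs ?_
    have h0 : Tendsto (fun ε => ∫ s in (0 : ℝ)..ε, D s) (𝓝[>] 0) (𝓝 0) := by
      have hi : IntegrableOn D (Set.Icc 0 1) := by
        rw [integrableOn_Icc_iff_integrableOn_Ioc]
        exact hDint.mono_set Set.Ioc_subset_Ioi_self
      have hc := intervalIntegral.continuousOn_primitive_interval (a := 0) (b := 1) (f := D)
        (μ := volume) (by rwa [Set.uIcc_of_le zero_le_one])
      have h2 := (hc 0 (by simp)).tendsto
      rw [intervalIntegral.integral_same, Set.uIcc_of_le zero_le_one] at h2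
      refine h2.mono_left (nhdsWithin_le_iff.2 ?_)
      filter_upwards [Ioo_mem_nhdsGT (zero_lt_one (α := ℝ))] with x hx
      exact ⟨hx.1.le, hx.2.le⟩
    have h3 : Tendsto (fun ε => (∫ s in Set.Ioi 0, D s) - ∫ s in (0 : ℝ)..ε, D s) (𝓝[>] 0)
        (𝓝 ((∫ s in Set.Ioi 0, D s) - 0)) := tendsto_const_nhds.sub h0
    rw [sub_zero] at h3
    refine h3.congr' ?_
    filter_upwards [self_mem_nhdsWithin] with ε hε
    have h4 := intervalIntegral.integral_Ioi_sub_Ioi hDint (le_of_lt hε)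
    linarith
  refine le_of_tendsto hlim ?_
  filter_upwards [Ioo_mem_nhdsGT hs₀] with ε hε
  have hD' : IntegrableOn D (Set.Ioi ε) := hDint.mono_set (Set.Ioi_subset_Ioi hε.1.le)
  have hlimΦ : Tendsto (Φ β) atTop (𝓝 0) := by
    have h5 : Tendsto (fun s => crudeConst κ R a A β / Real.sqrt r ^ len β * decayWeight R s)
        atTop (𝓝 0) := by
      have h6 : Tendsto (decayWeight R) atTop (𝓝 0) :=
        (tendsto_rpow_neg_atTop (by norm_num : (0 : ℝ) < 3 / 2)).comp
          (tendsto_atTop_add_const_right _ R tendsto_id)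
      simpa using h6.const_mul (crudeConst κ R a A β / Real.sqrt r ^ len β)
    refine squeeze_zero_norm' ?_ h5
    filter_upwards [eventually_gt_atTop 0] with s hs
    exact h.crude hκ hR ha hA β hs
  have h7 := integral_Ioi_of_hasDerivAt_of_tendsto' (f := Φ β) (f' := D)
    (fun s hs => h.deriv β s (hε.1.trans_le hs)) hD' hlimΦ
  rw [h7, zero_sub, abs_neg]
  refine (h.bound β ε hε.1).trans ?_
  have := hA β
  have := hnear ε hε.1 hε.2
  gcongr

/-- Induction on `m`, each step gaining one factor `(√r)⁻¹`. For `m = 0` sum and integral are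
estimated separately by the crude bound. In the step, the zero mean reduces the fluctuation to the
time derivative of the periodized sum, which involves the indices with two more derivatives, or one
more for the drift. Splitting these sums into fluctuation and mean, the fluctuations fall under the
induction hypothesis and the means together under `abs_integral_deriv_le`. The drift term adds a
single derivative, hence a single power per step. -/
theorem OseenFamily.exists_perFluct_le_aux (lam : ℝ) (hκ : 0 < κ) (hR : 0 < R) (hT : 0 < T)
    (ha : 3 ≤ a) (hA : ∀ β, 0 ≤ A β) (m : ℕ) (β : Fin 3 → ℕ) :
    ∃ C : ℝ, 0 ≤ C ∧ ∀ r ρ Φ, OseenFamily lam κ R a A r ρ Φ → ∀ t, 0 < t → t ≤ T →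
      |perFluct T (Φ β) t| ≤ C * ((r ^ (a + len β))⁻¹ + (Real.sqrt r ^ (len β + m))⁻¹) := by
  induction m generalizing β with
  | zero =>
    set B := T * ∑' n : ℕ, decayWeight R (n * T) + ∫ s in Set.Ioi 0, decayWeight R s with hB
    have hw0 : 0 ≤ ∑' n : ℕ, decayWeight R (n * T) :=
      tsum_nonneg fun n => decayWeight_nonneg hR (by positivity)
    have hw1 : 0 ≤ ∫ s in Set.Ioi 0, decayWeight R s :=
      setIntegral_nonneg measurableSet_Ioi fun s hs => decayWeight_nonneg hR (le_of_lt hs)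
    have hc := crudeConst_nonneg (R := R) (a := a) hκ hA β
    refine ⟨crudeConst κ R a A β * B, by positivity, fun r ρ Φ h t ht _ => ?_⟩
    have hr : 0 < r := hR.trans_le h.le_r
    obtain ⟨hs1, hs2, hs3⟩ := h.summable hκ hR ha hA hT β
    have b1 : |perSum T (Φ β) t| ≤ crudeConst κ R a A β / Real.sqrt r ^ len β *
        ∑' n : ℕ, decayWeight R (n * T) := by
      rw [← tsum_mul_left]
      rw [← Real.norm_eq_abs, perSum]
      exact tsum_of_norm_bounded hs1.hasSum fun n => hs2 n t ht
    have b2 : |∫ s in Set.Ioi 0, Φ β s| ≤ crudeConst κ R a A β / Real.sqrt r ^ len β *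
        ∫ s in Set.Ioi 0, decayWeight R s := by
      rw [← integral_const_mul, ← Real.norm_eq_abs]
      refine norm_integral_le_of_norm_le ((integrableOn_decayWeight hR).const_mul _) ?_
      filter_upwards [ae_restrict_mem measurableSet_Ioi] with s hs
      exact h.crude hκ hR ha hA β hs
    calc |perFluct T (Φ β) t| ≤ T * |perSum T (Φ β) t| + |∫ s in Set.Ioi 0, Φ β s| := by
          unfold perFluct
          refine (abs_sub _ _).trans (le_of_eq ?_)
          rw [abs_mul, abs_of_pos hT]
      _ ≤ T * (crudeConst κ R a A β / Real.sqrt r ^ len β * ∑' n : ℕ, decayWeight R (n * T))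
          + crudeConst κ R a A β / Real.sqrt r ^ len β * ∫ s in Set.Ioi 0, decayWeight R s := by
          gcongr
      _ = crudeConst κ R a A β * B * (Real.sqrt r ^ (len β + 0))⁻¹ := by
          rw [hB, add_zero]; ring
      _ ≤ _ := by
          gcongr
          have : 0 ≤ (r ^ (a + len β))⁻¹ := by positivity
          linarith
  | succ m ih =>
    choose C2 hC2 h2 using fun i : Fin 3 => ih (β + Pi.single i 2)
    obtain ⟨C1, hC1, h1⟩ := ih (β + Pi.single 0 1)
    set B := ∑ i, C2 i * (1 / R ^ 2 + 1 / Real.sqrt R) + |lam| * C1 * (1 / R + 1)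
      + A β * 2 ^ (a + len β) with hB
    have hsR : 0 < Real.sqrt R := Real.sqrt_pos.2 hR
    have hB0 : 0 ≤ B := by
      have := hA β
      have h3 : 0 ≤ ∑ i, C2 i * (1 / R ^ 2 + 1 / Real.sqrt R) :=
        Finset.sum_nonneg fun i _ => mul_nonneg (hC2 i) (by positivity)
      positivity
    refine ⟨T * B, by positivity, fun r ρ Φ h t ht htT => ?_⟩
    have hr : 0 < r := hR.trans_le h.le_r
    have hsr : 0 < Real.sqrt r := Real.sqrt_pos.2 hr
    have hsRr : Real.sqrt R ≤ Real.sqrt r := Real.sqrt_le_sqrt h.le_r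
    set M := (r ^ (a + len β))⁻¹ + (Real.sqrt r ^ (len β + (m + 1)))⁻¹ with hM
    have hM0 : 0 < M := by positivity
    have k2 : ∀ i : Fin 3, (r ^ (a + len (β + Pi.single i 2)))⁻¹
        + (Real.sqrt r ^ (len (β + Pi.single i 2) + m))⁻¹ ≤ (1 / R ^ 2 + 1 / Real.sqrt R) * M := by
      intro i
      rw [len_add_single, hM]
      have e1 : (r ^ (a + (len β + 2)))⁻¹ ≤ 1 / R ^ 2 * (r ^ (a + len β))⁻¹ := by
        rw [← add_assoc, pow_add, mul_inv, mul_comm, one_div]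
        gcongr
        exact h.le_r
      have e2 : (Real.sqrt r ^ (len β + 2 + m))⁻¹
          ≤ 1 / Real.sqrt R * (Real.sqrt r ^ (len β + (m + 1)))⁻¹ := by
        rw [show len β + 2 + m = len β + (m + 1) + 1 by ring, pow_succ, mul_inv, mul_comm, one_div]
        gcongr
      have p1 : 0 ≤ 1 / R ^ 2 * (Real.sqrt r ^ (len β + (m + 1)))⁻¹ := by positivity
      have p2 : 0 ≤ 1 / Real.sqrt R * (r ^ (a + len β))⁻¹ := by positivity
      nlinarith
    have k1 : (r ^ (a + len (β + Pi.single 0 1)))⁻¹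
        + (Real.sqrt r ^ (len (β + Pi.single 0 1) + m))⁻¹ ≤ (1 / R + 1) * M := by
      rw [len_add_single, hM]
      have e1 : (r ^ (a + (len β + 1)))⁻¹ ≤ 1 / R * (r ^ (a + len β))⁻¹ := by
        rw [← add_assoc, pow_succ, mul_inv, mul_comm, one_div]
        gcongr
        exact h.le_r
      have e2 : (Real.sqrt r ^ (len β + 1 + m))⁻¹ = (Real.sqrt r ^ (len β + (m + 1)))⁻¹ := by
        congr 2; ring
      have p1 : 0 ≤ 1 / R * (Real.sqrt r ^ (len β + (m + 1)))⁻¹ := by positivity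
      have p2 : 0 ≤ (r ^ (a + len β))⁻¹ := by positivity
      rw [e2]
      nlinarith
    have hderiv : ∀ τ, 0 < τ → τ ≤ T → |∑ i, perSum T (Φ (β + Pi.single i 2)) τ
        + lam * perSum T (Φ (β + Pi.single 0 1)) τ| ≤ T⁻¹ * (B * M) := by
      intro τ hτ hτT
      -- Each `perSum` is `T⁻¹` times the sum of its fluctuation and its integral; the integrals are
      -- kept together since only their combination is small enough.
      have e0 : ∑ i, perSum T (Φ (β + Pi.single i 2)) τ + lam * perSum T (Φ (β + Pi.single 0 1)) τ
          = T⁻¹ * (∑ i, perFluct T (Φ (β + Pi.single i 2)) τ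
            + lam * perFluct T (Φ (β + Pi.single 0 1)) τ
            + (∑ i, (∫ s in Set.Ioi 0, Φ (β + Pi.single i 2) s)
              + lam * ∫ s in Set.Ioi 0, Φ (β + Pi.single 0 1) s)) := by
        simp only [perFluct, Finset.sum_sub_distrib, ← Finset.mul_sum]
        field_simp
        ring
      rw [e0, abs_mul, abs_of_pos (inv_pos.2 hT)]
      refine mul_le_mul_of_nonneg_left ?_ (inv_pos.2 hT).le
      rw [hB, add_mul, add_mul]
      refine (abs_add_le _ _).trans (add_le_add ((abs_add_le _ _).trans (add_le_add ?_ ?_)) ?_)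
      · rw [Finset.sum_mul]
        refine (Finset.abs_sum_le_sum_abs _ _).trans (Finset.sum_le_sum fun i _ => ?_)
        rw [mul_assoc]
        exact (h2 i r ρ Φ h τ hτ hτT).trans (mul_le_mul_of_nonneg_left (k2 i) (hC2 i))
      · rw [abs_mul, mul_assoc, mul_assoc]
        exact mul_le_mul_of_nonneg_left ((h1 r ρ Φ h τ hτ hτT).trans
          (mul_le_mul_of_nonneg_left k1 hC1)) (abs_nonneg _)
      · refine (h.abs_integral_deriv_le hκ hR ha hA β).trans ?_
        have e3 : A β / (r / 2) ^ (a + len β) = A β * 2 ^ (a + len β) * (r ^ (a + len β))⁻¹ := by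
          rw [div_pow]; field_simp
        rw [e3]
        have := hA β
        have p2 : 0 ≤ (Real.sqrt r ^ (len β + (m + 1)))⁻¹ := by positivity
        gcongr
        linarith
    have hlip : ∀ τ, 0 < τ → τ ≤ T →
        |perSum T (Φ β) t - perSum T (Φ β) τ| ≤ B * M := by
      intro τ hτ hτT
      have := (convex_Ioc (0 : ℝ) T).norm_image_sub_le_of_norm_hasDerivWithin_le
        (f := perSum T (Φ β)) (C := T⁻¹ * (B * M))
        (fun x hx => (h.hasDerivAt_perSum hκ hR ha hA hT β hx.1).hasDerivWithinAt)
        (fun x hx => hderiv x hx.1 hx.2) (x := τ) (y := t) ⟨hτ, hτT⟩ ⟨ht, htT⟩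
      rw [Real.norm_eq_abs, Real.norm_eq_abs] at this
      refine this.trans ?_
      have h5 : |t - τ| ≤ T := by rw [abs_le]; constructor <;> linarith
      calc T⁻¹ * (B * M) * |t - τ| ≤ T⁻¹ * (B * M) * T := by gcongr
        _ = B * M := by field_simp
    obtain ⟨hi, he⟩ := setIntegral_perSum hT (h.integrableOn hκ hR ha hA β)
    -- Zero mean: by unfolding, `∫₀^∞ Φ β` is the integral of `perSum` over a period, so the
    -- fluctuation is an integral of oscillations.
    have e4 : perFluct T (Φ β) t
        = ∫ τ in Set.Ioc 0 T, (perSum T (Φ β) t - perSum T (Φ β) τ) := by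
      rw [integral_sub (by simp) hi, he, perFluct]
      simp [hT.le]
    rw [e4]
    have := norm_setIntegral_le_of_norm_le_const (μ := volume) (s := Set.Ioc 0 T)
      (f := fun τ => perSum T (Φ β) t - perSum T (Φ β) τ) (C := B * M)
      (by simp) (fun τ hτ => hlip τ hτ.1 hτ.2)
    rw [Real.norm_eq_abs] at this
    refine this.trans (le_of_eq ?_)
    simp [Measure.real, hT.le]
    ring

theorem OseenFamily.exists_perFluct_le (lam : ℝ) (hκ : 0 < κ) (hR : 0 < R) (hT : 0 < T)
    (ha : 3 ≤ a) (hA : ∀ β, 0 ≤ A β) (β : Fin 3 → ℕ) :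
    ∃ C : ℝ, 0 ≤ C ∧ ∀ r ρ Φ, OseenFamily lam κ R a A r ρ Φ → ∀ t, 0 < t → t ≤ T →
      |perFluct T (Φ β) t| ≤ C / r ^ (a + len β) := by
  -- With `m = 2a + len β` the power of `√r` becomes `r ^ (a + len β)` and both error terms
  -- coincide.
  obtain ⟨C, hC, h⟩ := OseenFamily.exists_perFluct_le_aux lam hκ hR hT ha hA (2 * a + len β) β
  refine ⟨2 * C, by positivity, fun r ρ Φ hΦ t ht htT => (h r ρ Φ hΦ t ht htT).trans ?_⟩
  have hr : 0 < r := hR.trans_le hΦ.le_r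
  have : Real.sqrt r ^ (len β + (2 * a + len β)) = r ^ (a + len β) := by
    rw [show len β + (2 * a + len β) = 2 * (a + len β) by ring, pow_mul, Real.sq_sqrt hr.le]
  rw [this]
  apply le_of_eq; ring

end Family

/-! ### Unfolding integrals over the torus -/

/-- The representative in `(0, T]` of a point of `ℝ / Tℤ`. -/
def tau {T : ℝ} [hT : Fact (0 < T)] (t : AddCircle T) : ℝ := AddCircle.equivIoc T 0 t

section Torus

variable {T : ℝ} [hT : Fact (0 < T)]

theorem tau_pos (t : AddCircle T) : 0 < tau t := (AddCircle.equivIoc T 0 t).2.1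

theorem tau_le (t : AddCircle T) : tau t ≤ T := by
  have h : tau t ≤ 0 + T := (AddCircle.equivIoc T 0 t).2.2
  linarith

theorem coe_tau (t : AddCircle T) : (tau t : AddCircle T) = t := AddCircle.coe_equivIoc

theorem measurePreserving_tau :
    MeasurePreserving (tau (T := T)) volume (volume.restrict (Set.Ioc 0 T)) := by
  have h1 := AddCircle.measurePreserving_equivIoc T (a := 0)
  have h2 := measurePreserving_subtype_coe (μa := (volume : Measure ℝ))
    (measurableSet_Ioc (a := (0 : ℝ)) (b := 0 + T))
  have e : (volume : Measure ℝ).restrict (Set.Ioc 0 (0 + T)) = volume.restrict (Set.Ioc 0 T) := by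
    rw [zero_add]
  rw [← e]
  exact h2.comp h1

theorem measurePreserving_tau_add (n : ℕ) :
    MeasurePreserving (fun t : AddCircle T => tau t + n * T) volume
      (volume.restrict (Set.Ioc (n * T) (n * T + T))) :=
  (measurePreserving_add_Ioc T (n * T)).comp measurePreserving_tau

theorem volume_eq_smul_muT :
    (volume : Measure (AddCircle T)) = ENNReal.ofReal T • muT T :=
  AddCircle.volume_eq_smul_haarAddCircle

theorem volume_prod_eq_smul_muG :
    (volume : Measure (AddCircle T)).prod (volume : Measure E3) = ENNReal.ofReal T • muG T := by
  rw [volume_eq_smul_muT, Measure.prod_smul_left]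

theorem integrable_muG_iff {E : Type*} [NormedAddCommGroup E] {g : AddCircle T × E3 → E} :
    Integrable g (muG T) ↔
      Integrable g ((volume : Measure (AddCircle T)).prod (volume : Measure E3)) := by
  rw [volume_prod_eq_smul_muG, integrable_smul_measure (by simp [hT.out]) (by simp)]

theorem integrable_muT_iff {E : Type*} [NormedAddCommGroup E] {g : AddCircle T → E} :
    Integrable g (muT T) ↔ Integrable g volume := by
  rw [volume_eq_smul_muT, integrable_smul_measure (by simp [hT.out]) (by simp)]

theorem integral_muG_eq {E : Type*} [NormedAddCommGroup E] [NormedSpace ℝ E]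
    (g : AddCircle T × E3 → E) :
    ∫ p, g p ∂(muG T)
      = T⁻¹ • ∫ p, g p ∂((volume : Measure (AddCircle T)).prod (volume : Measure E3)) := by
  rw [volume_prod_eq_smul_muG, integral_smul_measure, ENNReal.toReal_ofReal hT.out.le, smul_smul,
    inv_mul_cancel₀ hT.out.ne', one_smul]

theorem integral_muT_eq {E : Type*} [NormedAddCommGroup E] [NormedSpace ℝ E]
    (g : AddCircle T → E) : ∫ t, g t ∂(muT T) = T⁻¹ • ∫ t, g t := by
  rw [volume_eq_smul_muT, integral_smul_measure, ENNReal.toReal_ofReal hT.out.le, smul_smul,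
    inv_mul_cancel₀ hT.out.ne', one_smul]

/-- The factor `T⁻¹` appears because `muT` has total mass one while the cells have length `T`; it
cancels the factor `T` in `perFluct`. -/
theorem unfold_muT {E : Type*} [NormedAddCommGroup E] [NormedSpace ℝ E] [CompleteSpace E]
    {g : ℝ → E} (hg : IntegrableOn g (Set.Ioi 0)) :
    (∀ᵐ t ∂(muT T), Summable fun n : ℕ => ‖g (tau t + n * T)‖) ∧
    Integrable (fun t => ∑' n : ℕ, ‖g (tau t + n * T)‖) (muT T) ∧
    Integrable (fun t => ∑' n : ℕ, g (tau t + n * T)) (muT T) ∧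
    ∫ t, ∑' n : ℕ, g (tau t + n * T) ∂(muT T) = T⁻¹ • ∫ s in Set.Ioi 0, g s ∧
    ∫ t, ∑' n : ℕ, ‖g (tau t + n * T)‖ ∂(muT T) = T⁻¹ * ∫ s in Set.Ioi 0, ‖g s‖ := by
  rw [← iUnion_Ioc_add_natCast_mul hT.out] at hg ⊢
  obtain ⟨h1, h2, h3, h4, h5⟩ := integral_tsum_comp_measurePreserving (fun n => measurableSet_Ioc)
    (pairwise_disjoint_Ioc_natCast_mul hT.out)
    (fun n : ℕ => measurePreserving_tau_add (T := T) n) hg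
  rw [integrable_muT_iff, integrable_muT_iff, integral_muT_eq, integral_muT_eq, h4, h5]
  refine ⟨?_, h2, h3, rfl, rfl⟩
  rw [volume_eq_smul_muT] at h1
  exact (Measure.absolutelyContinuous_smul (by simp [hT.out])).ae_le h1

theorem unfold_muG {E : Type*} [NormedAddCommGroup E] [NormedSpace ℝ E] [CompleteSpace E]
    {g : ℝ × E3 → E} (hg : Integrable g ((volume.restrict (Set.Ioi 0)).prod volume)) :
    (∀ᵐ p ∂(muG T), Summable fun n : ℕ => ‖g (tau p.1 + n * T, p.2)‖) ∧
    Integrable (fun p => ∑' n : ℕ, ‖g (tau p.1 + n * T, p.2)‖) (muG T) ∧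
    Integrable (fun p => ∑' n : ℕ, g (tau p.1 + n * T, p.2)) (muG T) ∧
    ∫ p, ∑' n : ℕ, g (tau p.1 + n * T, p.2) ∂(muG T)
      = T⁻¹ • ∫ q, g q ∂((volume.restrict (Set.Ioi 0)).prod volume) := by
  have e : ∀ s : Set ℝ, (volume.restrict s).prod (volume : Measure E3)
      = ((volume : Measure ℝ).prod (volume : Measure E3)).restrict (s ×ˢ Set.univ) := by
    intro s
    rw [← Measure.prod_restrict, Measure.restrict_univ]
  rw [e] at hg ⊢
  have hU : ⋃ n : ℕ, Set.Ioc (n * T) (n * T + T) ×ˢ (Set.univ : Set E3)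
      = Set.Ioi 0 ×ˢ Set.univ := by
    rw [← iUnion_Ioc_add_natCast_mul hT.out, Set.iUnion_prod_const]
  rw [← hU] at hg ⊢
  obtain ⟨h1, h2, h3, h4, h5⟩ := integral_tsum_comp_measurePreserving
    (ζ := (volume : Measure (AddCircle T)).prod (volume : Measure E3))
    (ν := (volume : Measure ℝ).prod (volume : Measure E3))
    (e := fun (n : ℕ) (p : AddCircle T × E3) => (tau p.1 + n * T, p.2))
    (A := fun n : ℕ => Set.Ioc (n * T) (n * T + T) ×ˢ (Set.univ : Set E3))
    (fun n => measurableSet_Ioc.prod MeasurableSet.univ)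
    (fun m n hmn => Set.disjoint_prod.2 (Or.inl (pairwise_disjoint_Ioc_natCast_mul hT.out hmn)))
    (fun n : ℕ => by
      have := (measurePreserving_tau_add (T := T) n).prod (MeasurePreserving.id (volume : Measure E3))
      rw [e] at this
      exact this) hg
  rw [integrable_muG_iff, integrable_muG_iff, integral_muG_eq, h4]
  refine ⟨?_, h2, h3, rfl⟩
  rw [volume_prod_eq_smul_muG] at h1
  exact (Measure.absolutelyContinuous_smul (by simp [hT.out])).ae_le h1

end Torus

/-! ### The purely periodic kernel -/

/-- The candidate for the entries of `D_x^β Γ_⊥`. -/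
def perKernel (T : ℝ) [Fact (0 < T)] (lam : ℝ) (j l : Fin 3) (β : Fin 3 → ℕ) :
    AddCircle T × E3 → ℝ :=
  fun p => perFluct T (fun s => kern lam j l β s p.2) (tau p.1)

/-- A lower bound for the parabolic distance along the drift. -/
def parabolicDist (lam r s : ℝ) : ℝ := if s < r / (2 * (|lam| + 1)) then r / 2 else Real.sqrt s

/-- As long as `s (|λ| + 1) < r / 2`, the drift cannot bring the point within `r / 2` of the origin;
afterwards `√s` alone is kept. The `+ 1` keeps the threshold finite for `λ = 0`. -/
theorem parabolicDist_le (lam : ℝ) {r s : ℝ} (hs : 0 < s) {z : E3} (hz : r ≤ ‖z‖) :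
    parabolicDist lam r s ≤ Real.sqrt s + ‖z + s • drift lam‖ := by
  unfold parabolicDist
  split_ifs with h
  · rw [lt_div_iff₀ (by positivity)] at h
    have h1 : ‖z‖ ≤ ‖z + s • drift lam‖ + s * |lam| := by
      have := norm_sub_le (z + s • drift lam) (s • drift lam)
      rwa [add_sub_cancel_right, norm_smul, norm_drift, Real.norm_of_nonneg hs.le] at this
    have := Real.sqrt_nonneg s
    nlinarith
  · linarith [norm_nonneg (z + s • drift lam)]

theorem parabolicDist_pos (lam : ℝ) {r s : ℝ} (hr : 0 < r) (hs : 0 < s) :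
    0 < parabolicDist lam r s := by
  unfold parabolicDist
  split_ifs
  · positivity
  · exact Real.sqrt_pos.2 hs

theorem exists_lower_parabolicDist (lam : ℝ) {R : ℝ} (hR : 0 < R) :
    ∃ κ : ℝ, 0 < κ ∧ ∀ r s, R ≤ r → 0 < s → κ * Real.sqrt (r + s) ≤ parabolicDist lam r s := by
  -- Early times have `s ≤ r`, so `√(r + s) ≤ √(4r)` and `√R ≤ √r` give the first constant. Late
  -- times have `r ≤ 2(|λ| + 1)s`, so `r + s ≤ (2|λ| + 3)s` gives the second.
  refine ⟨min (Real.sqrt R / 4) (Real.sqrt (2 * |lam| + 3))⁻¹, by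
    have := Real.sqrt_pos.2 hR; positivity, fun r s hr hs => ?_⟩
  have hr0 : 0 < r := hR.trans_le hr
  unfold parabolicDist
  split_ifs with h
  · rw [lt_div_iff₀ (by positivity)] at h
    have hsr : s ≤ r := by nlinarith [abs_nonneg lam]
    calc _ ≤ Real.sqrt R / 4 * Real.sqrt (r + s) := by gcongr; exact min_le_left _ _
      _ ≤ Real.sqrt r / 4 * Real.sqrt (4 * r) := by gcongr; linarith
      _ = r / 2 := by
        rw [Real.sqrt_mul (by norm_num), show (4 : ℝ) = 2 ^ 2 by norm_num,
          Real.sqrt_sq (by norm_num)]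
        have := Real.mul_self_sqrt hr0.le
        linarith
  · rw [not_lt, div_le_iff₀ (by positivity)] at h
    have h1 : Real.sqrt (r + s) ≤ Real.sqrt (2 * |lam| + 3) * Real.sqrt s := by
      rw [← Real.sqrt_mul (by positivity)]
      exact Real.sqrt_le_sqrt (by linarith)
    have h2 : 0 < Real.sqrt (2 * |lam| + 3) := Real.sqrt_pos.2 (by positivity)
    calc _ ≤ (Real.sqrt (2 * |lam| + 3))⁻¹ * (Real.sqrt (2 * |lam| + 3) * Real.sqrt s) := by
          gcongr; exact min_le_right _ _
      _ = Real.sqrt s := by field_simp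

theorem near_parabolicDist (lam : ℝ) {r : ℝ} (hr : 0 < r) :
    ∃ s₀ > 0, ∀ s, 0 < s → s < s₀ → r / 2 ≤ parabolicDist lam r s := by
  refine ⟨r / (2 * (|lam| + 1)), by positivity, fun s _ h => ?_⟩
  rw [parabolicDist, if_pos h]

/-- The constants `κ` and `A` are chosen before `x`; this is what makes the resulting decay uniform
over `‖x‖ ≥ R`. -/
theorem exists_oseenFamily_kern (lam : ℝ) (j l : Fin 3) {R : ℝ} (hR : 0 < R) :
    ∃ (κ : ℝ) (A : (Fin 3 → ℕ) → ℝ), 0 < κ ∧ (∀ β, 0 ≤ A β) ∧ ∀ x : E3, R ≤ ‖x‖ →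
      OseenFamily lam κ R 3 A ‖x‖ (parabolicDist lam ‖x‖) (fun β s => kern lam j l β s x) := by
  obtain ⟨κ, hκ, h⟩ := exists_lower_parabolicDist lam hR
  choose A hA hb using exists_kern_le lam j l
  refine ⟨κ, A, hκ, hA, fun x hx => ?_⟩
  have hx0 : 0 < ‖x‖ := hR.trans_le hx
  exact
    { le_r := hx
      deriv := fun β s hs => hasDerivAt_kern_time lam j l β hs x
      bound := fun β s hs => (hb β s hs x).trans (by
        have h1 := parabolicDist_pos lam hx0 hs
        have h2 := parabolicDist_le lam hs (le_refl ‖x‖)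
        have h3 := hA β
        gcongr)
      pos := fun s hs => parabolicDist_pos lam hx0 hs
      lower := fun s hs => h ‖x‖ s hx hs
      near := near_parabolicDist lam hx0 }

/-- The mean value theorem on the segment from `x` to `x - y` costs one spatial derivative, so the
base exponent rises from `3` to `4`. The segment stays at distance at least `‖x‖ / 2` from the
origin, hence the radius `‖x‖ / 2`, and `‖y‖ ≤ R` goes into the constant. -/
theorem exists_oseenFamily_kern_sub (lam : ℝ) (j l : Fin 3) {R : ℝ} (hR : 0 < R) :
    ∃ (κ : ℝ) (A : (Fin 3 → ℕ) → ℝ), 0 < κ ∧ (∀ β, 0 ≤ A β) ∧ ∀ x y : E3, 2 * R ≤ ‖x‖ → ‖y‖ ≤ R →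
      OseenFamily lam κ R 4 A (‖x‖ / 2) (parabolicDist lam (‖x‖ / 2))
        (fun β s => kern lam j l β s (x - y) - kern lam j l β s x) := by
  obtain ⟨κ, hκ, h⟩ := exists_lower_parabolicDist lam hR
  choose A hA hb using exists_kern_le lam j l
  refine ⟨κ, fun β => ∑ i, R * A (β + Pi.single i 1), hκ,
    fun β => Finset.sum_nonneg fun i _ => mul_nonneg hR.le (hA _), fun x y hx hy => ?_⟩
  have hr : R ≤ ‖x‖ / 2 := by linarith
  have hx0 : 0 < ‖x‖ / 2 := hR.trans_le hr
  refine
    { le_r := hr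
      deriv := fun β s hs => ?_
      bound := fun β s hs => ?_
      pos := fun s hs => parabolicDist_pos lam hx0 hs
      lower := fun s hs => h _ s hr hs
      near := near_parabolicDist lam hx0 }
  · refine ((hasDerivAt_kern_time lam j l β hs (x - y)).sub
      (hasDerivAt_kern_time lam j l β hs x)).congr_deriv ?_
    rw [Finset.sum_sub_distrib]; ring
  · set P := parabolicDist lam (‖x‖ / 2) s with hP
    have hPpos : 0 < P := parabolicDist_pos lam hx0 hs
    set B := (∑ i, R * A (β + Pi.single i 1)) / P ^ (4 + len β) with hB
    have key := (convex_Icc (0 : ℝ) 1).norm_image_sub_le_of_norm_hasDerivWithin_le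
      (f := fun r : ℝ => kern lam j l β s (x + r • (-y))) (C := B)
      (fun r _ => (hasDerivAt_kern_line lam j l β hs x (-y) r).hasDerivWithinAt)
      (fun r hr' => ?_) (x := 0) (y := 1) (by simp) (by simp)
    · simpa [sub_eq_add_neg] using key
    · have hz : ‖x‖ / 2 ≤ ‖x + r • (-y)‖ := by
        have h1 : ‖x‖ ≤ ‖x + r • (-y)‖ + r * ‖y‖ := by
          have := norm_sub_le (x + r • (-y)) (r • (-y))
          rwa [add_sub_cancel_right, norm_smul, norm_neg, Real.norm_of_nonneg hr'.1] at this
        have : r * ‖y‖ ≤ 1 * R := mul_le_mul hr'.2 hy (norm_nonneg _) zero_le_one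
        linarith
      rw [hB, Finset.sum_div]
      refine (norm_sum_le _ _).trans (Finset.sum_le_sum fun i _ => ?_)
      rw [norm_mul, mul_div_assoc]
      refine mul_le_mul ?_ ?_ (norm_nonneg _) hR.le
      · rw [PiLp.neg_apply, norm_neg]
        exact (PiLp.norm_apply_le y i).trans hy
      · refine (hb (β + Pi.single i 1) s hs _).trans ?_
        rw [len_add_single, show 3 + (len β + 1) = 4 + len β by ring]
        have h2 := parabolicDist_le lam hs hz
        have h3 := hA (β + Pi.single i 1)
        gcongr

theorem perFluct_sub (T : ℝ) {g h : ℝ → ℝ} {t : ℝ} (hg : IntegrableOn g (Set.Ioi 0))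
    (hh : IntegrableOn h (Set.Ioi 0)) (hg' : Summable fun n : ℕ => g (t + n * T))
    (hh' : Summable fun n : ℕ => h (t + n * T)) :
    perFluct T (fun s => g s - h s) t = perFluct T g t - perFluct T h t := by
  rw [perFluct, perFluct, perFluct, perSum, hg'.tsum_sub hh', integral_sub hg hh, perSum, perSum]
  ring

section Decay

variable (T : ℝ) [hT : Fact (0 < T)] (lam : ℝ) (j l : Fin 3)

theorem exists_perKernel_le (β : Fin 3 → ℕ) {R : ℝ} (hR : 0 < R) :
    ∃ C : ℝ, 0 ≤ C ∧ ∀ (t : AddCircle T) (x : E3), R ≤ ‖x‖ →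
      |perKernel T lam j l β (t, x)| ≤ C / ‖x‖ ^ (3 + len β) := by
  obtain ⟨κ, A, hκ, hA, h⟩ := exists_oseenFamily_kern lam j l hR
  obtain ⟨C, hC, hC'⟩ := OseenFamily.exists_perFluct_le lam hκ hR hT.out le_rfl hA β
  exact ⟨C, hC, fun t x hx => hC' _ _ _ (h x hx) (tau t) (tau_pos t) (tau_le t)⟩

theorem integrableOn_kern (β : Fin 3 → ℕ) {x : E3} (hx : x ≠ 0) :
    IntegrableOn (fun s => kern lam j l β s x) (Set.Ioi 0) := by
  have hR : 0 < ‖x‖ := norm_pos_iff.2 hx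
  obtain ⟨κ, A, hκ, hA, h⟩ := exists_oseenFamily_kern lam j l hR
  exact (h x le_rfl).integrableOn hκ hR le_rfl hA β

theorem summable_kern (β : Fin 3 → ℕ) {x : E3} (hx : x ≠ 0) {t : ℝ} (ht : 0 < t) :
    Summable fun n : ℕ => kern lam j l β (t + n * T) x := by
  have hR : 0 < ‖x‖ := norm_pos_iff.2 hx
  obtain ⟨κ, A, hκ, hA, h⟩ := exists_oseenFamily_kern lam j l hR
  exact ((h x le_rfl).summable hκ hR le_rfl hA hT.out β).2.2 t ht

theorem exists_perKernel_sub_le (β : Fin 3 → ℕ) {R : ℝ} (hR : 0 < R) :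
    ∃ C : ℝ, 0 ≤ C ∧ ∀ (t : AddCircle T) (x y : E3), 2 * R ≤ ‖x‖ → ‖y‖ ≤ R →
      |perKernel T lam j l β (t, x - y) - perKernel T lam j l β (t, x)|
        ≤ C / ‖x‖ ^ (4 + len β) := by
  obtain ⟨κ, A, hκ, hA, h⟩ := exists_oseenFamily_kern_sub lam j l hR
  obtain ⟨C, hC, hC'⟩ := OseenFamily.exists_perFluct_le lam hκ hR hT.out
    (by norm_num : 3 ≤ 4) hA β
  refine ⟨C * 2 ^ (4 + len β), by positivity, fun t x y hx hy => ?_⟩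
  have h1 := hC' _ _ _ (h x y hx hy) (tau t) (tau_pos t) (tau_le t)
  have hx0 : x ≠ 0 := norm_pos_iff.1 (by linarith)
  have hxy0 : x - y ≠ 0 := by
    rw [sub_ne_zero]; rintro rfl; linarith
  rw [perFluct_sub T (integrableOn_kern lam j l β hxy0) (integrableOn_kern lam j l β hx0)
    (summable_kern T lam j l β hxy0 (tau_pos t)) (summable_kern T lam j l β hx0 (tau_pos t))] at h1
  refine h1.trans (le_of_eq ?_)
  have : 0 < ‖x‖ := norm_pos_iff.2 hx0
  rw [div_pow]; field_simp

theorem slice_integrable_perKernel (β : Fin 3 → ℕ) {x : E3} (hx : x ≠ 0) :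
    Integrable (fun t => perKernel T lam j l β (t, x)) (muT T) :=
  ((unfold_muT (integrableOn_kern lam j l β hx)).2.2.1.const_mul T).sub
    (integrable_const (∫ s in Set.Ioi 0, kern lam j l β s x))

/-- The periodized sum and the mean each contribute one copy of the `L¹(0, ∞)` norm, the first by
unfolding. -/
theorem integral_abs_perKernel_sub_le (β : Fin 3 → ℕ) {x x' : E3} (hx : x ≠ 0) (hx' : x' ≠ 0) :
    ∫ t, |perKernel T lam j l β (t, x') - perKernel T lam j l β (t, x)| ∂(muT T)
      ≤ 2 * ∫ s in Set.Ioi 0, |kern lam j l β s x' - kern lam j l β s x| := by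
  set d : ℝ → ℝ := fun s => kern lam j l β s x' - kern lam j l β s x with hd
  have hdi : IntegrableOn d (Set.Ioi 0) :=
    (integrableOn_kern lam j l β hx').sub (integrableOn_kern lam j l β hx)
  obtain ⟨h1, h2, h3, h4, h5⟩ := unfold_muT (T := T) hdi
  have hTpos := hT.out
  calc _ ≤ ∫ t, (T * (∑' n : ℕ, ‖d (tau t + n * T)‖) + ∫ s in Set.Ioi 0, ‖d s‖) ∂(muT T) := by
        refine integral_mono ?_ ((h2.const_mul T).add (integrable_const _)) fun t => ?_
        · exact ((slice_integrable_perKernel T lam j l β hx').sub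
            (slice_integrable_perKernel T lam j l β hx)).abs
        · have e : perKernel T lam j l β (t, x') - perKernel T lam j l β (t, x)
              = perFluct T d (tau t) :=
            (perFluct_sub T (integrableOn_kern lam j l β hx') (integrableOn_kern lam j l β hx)
              (summable_kern T lam j l β hx' (tau_pos t))
              (summable_kern T lam j l β hx (tau_pos t))).symm
          simp only
          rw [e, perFluct]
          refine (abs_sub _ _).trans (add_le_add ?_ ?_)
          · rw [abs_mul, abs_of_pos hTpos]
            gcongr
            have hs : Summable fun n : ℕ => d (tau t + n * T) :=
              (summable_kern T lam j l β hx' (tau_pos t)).sub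
                (summable_kern T lam j l β hx (tau_pos t))
            exact norm_tsum_le_tsum_norm hs.norm
          · exact norm_integral_le_integral_norm d
    _ = 2 * ∫ s in Set.Ioi 0, ‖d s‖ := by
        rw [integral_add (h2.const_mul T) (integrable_const _), integral_const_mul, h5,
          integral_const]
        simp only [Measure.real, measure_univ, ENNReal.toReal_one, one_smul]
        field_simp
        ring

/-- Dominated convergence in `s`: for each `s > 0` the kernel is continuous in `x`, and the crude
bound dominates uniformly on `‖x'‖ ≥ ‖x‖ / 2`. -/
theorem slice_continuous_perKernel (β : Fin 3 → ℕ) {x : E3} (hx : x ≠ 0) :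
    Tendsto (fun x' => ∫ t, |perKernel T lam j l β (t, x') - perKernel T lam j l β (t, x)| ∂(muT T))
      (𝓝 x) (𝓝 0) := by
  have hx0 : 0 < ‖x‖ := norm_pos_iff.2 hx
  set R := ‖x‖ / 2 with hR
  have hR0 : 0 < R := by positivity
  obtain ⟨κ, A, hκ, hA, h⟩ := exists_oseenFamily_kern lam j l hR0
  have hnhds : ∀ᶠ x' in 𝓝 x, R ≤ ‖x'‖ :=
    (continuous_norm.tendsto x).eventually (le_mem_nhds (by linarith))
  have hlim : Tendsto (fun x' => ∫ s in Set.Ioi 0, |kern lam j l β s x' - kern lam j l β s x|)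
      (𝓝 x) (𝓝 (∫ s in Set.Ioi (0 : ℝ), 0)) := by
    have hcr : ∀ z : E3, R ≤ ‖z‖ → ∀ s, 0 < s → |kern lam j l β s z| ≤
        crudeConst κ R 3 A β / Real.sqrt R ^ len β * decayWeight R s := by
      intro z hz s hs
      refine ((h z hz).crude hκ hR0 le_rfl hA β hs).trans ?_
      have h1 := crudeConst_nonneg (R := R) (a := 3) hκ hA β
      have h2 := decayWeight_nonneg hR0 hs.le
      have h3 : 0 < Real.sqrt R := Real.sqrt_pos.2 hR0
      gcongr
    refine tendsto_integral_filter_of_dominated_convergence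
      (fun s => 2 * (crudeConst κ R 3 A β / Real.sqrt R ^ len β * decayWeight R s)) ?_ ?_
      (((integrableOn_decayWeight hR0).const_mul _).const_mul _) ?_
    · filter_upwards [hnhds] with x' hx'
      have hx'0 : x' ≠ 0 := norm_pos_iff.1 (hR0.trans_le hx')
      exact (((integrableOn_kern lam j l β hx'0).sub (integrableOn_kern lam j l β hx)).abs).1
    · filter_upwards [hnhds] with x' hx'
      filter_upwards [ae_restrict_mem measurableSet_Ioi] with s hs
      rw [Real.norm_eq_abs, abs_abs]
      have h1 := hcr x' hx' s hs
      have h2 := hcr x (by linarith) s hs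
      linarith [abs_sub (kern lam j l β s x') (kern lam j l β s x)]
    · filter_upwards [ae_restrict_mem measurableSet_Ioi] with s hs
      have hc := ((continuous_kern lam j l β hs).sub
        (continuous_const (y := kern lam j l β s x))).abs.tendsto x
      simpa using hc
  rw [integral_zero] at hlim
  refine squeeze_zero' (Eventually.of_forall fun x' => integral_nonneg fun t => abs_nonneg _) ?_
    (by simpa using hlim.const_mul 2)
  filter_upwards [hnhds] with x' hx'
  exact integral_abs_perKernel_sub_le T lam j l β hx (norm_pos_iff.1 (hR0.trans_le hx'))

end Decay

/-! ### Weighted integrability -/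

/-- The integrable function `|y|^{-5/2} (1 + |y|)^{-4}`. -/
def singWeight (y : E3) : ℝ := ‖y‖ ^ (-(5 / 2) : ℝ) * ((1 + ‖y‖) ^ 4)⁻¹

theorem singWeight_nonneg (y : E3) : 0 ≤ singWeight y := by unfold singWeight; positivity

theorem measurable_singWeight : Measurable singWeight := by unfold singWeight; fun_prop

theorem integrable_singWeight : Integrable singWeight := by
  have h := integrable_fun_norm_addHaar (volume : Measure E3)
    (f := fun r : ℝ => r ^ (-(5 / 2) : ℝ) * ((1 + r) ^ 4)⁻¹)
  refine h.2 ?_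
  rw [finrank_euclideanSpace_fin]
  simp only [smul_eq_mul, Nat.add_one_sub_one]
  have e : ∀ r : ℝ, 0 < r → r ^ 2 * (r ^ (-(5 / 2) : ℝ) * ((1 + r) ^ 4)⁻¹)
      = r ^ (-(1 / 2) : ℝ) * ((1 + r) ^ 4)⁻¹ := by
    intro r hr
    rw [← mul_assoc, ← Real.rpow_natCast r 2, ← Real.rpow_add hr]
    norm_num
  rw [← Set.Ioc_union_Ioi_eq_Ioi zero_le_one]
  refine IntegrableOn.union ?_ ?_
  · have h1 : IntegrableOn (fun r : ℝ => r ^ (-(1 / 2) : ℝ)) (Set.Ioc 0 1) :=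
      (intervalIntegral.intervalIntegrable_rpow' (by norm_num)).1
    refine Integrable.mono' h1 (by fun_prop) ?_
    filter_upwards [ae_restrict_mem measurableSet_Ioc] with r hr
    rw [e r hr.1, Real.norm_of_nonneg (by have := hr.1; positivity)]
    refine mul_le_of_le_one_right (Real.rpow_nonneg hr.1.le _) (inv_le_one_of_one_le₀ ?_)
    exact one_le_pow₀ (by linarith [hr.1])
  · have h1 : IntegrableOn (fun r : ℝ => r ^ (-4 : ℝ)) (Set.Ioi 1) :=
      integrableOn_Ioi_rpow_of_lt (by norm_num) one_pos
    refine Integrable.mono' h1 (by fun_prop) ?_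
    filter_upwards [ae_restrict_mem measurableSet_Ioi] with r hr
    have hr1 : (1 : ℝ) < r := hr
    have hr0 : 0 < r := by linarith
    rw [e r hr0, Real.norm_of_nonneg (by positivity)]
    have h2 : r ^ (-(1 / 2) : ℝ) ≤ 1 := Real.rpow_le_one_of_one_le_of_nonpos hr1.le (by norm_num)
    have h4 : r ^ (-4 : ℝ) = (r ^ (4 : ℝ))⁻¹ := Real.rpow_neg hr0.le 4
    have h3 : ((1 + r) ^ 4)⁻¹ ≤ (r ^ (4 : ℝ))⁻¹ := by
      rw [show (4 : ℝ) = (4 : ℕ) by norm_num, Real.rpow_natCast]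
      gcongr
      linarith
    rw [h4, ← one_mul (r ^ (4 : ℝ))⁻¹]
    exact mul_le_mul h2 h3 (by positivity) zero_le_one

theorem integrable_inv_one_add_norm_pow : Integrable fun x : E3 => ((1 + ‖x‖) ^ 4)⁻¹ := by
  have h := integrable_one_add_norm (E := E3) (μ := volume) (r := 4)
    (by rw [finrank_euclideanSpace_fin]; norm_num)
  refine h.congr (Eventually.of_forall fun x => ?_)
  simp only
  rw [Real.rpow_neg (by positivity), show (4 : ℝ) = (4 : ℕ) by norm_num, Real.rpow_natCast]

/-- `|kern| (1 + |x|)^{-4}` is integrable on `(0, ∞) × ℝ³`. -/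
theorem integrable_kern_mul_weight (lam : ℝ) (j l : Fin 3) {β : Fin 3 → ℕ} (hβ : len β ≤ 1) :
    Integrable (fun p : ℝ × E3 => kern lam j l β p.1 p.2 * ((1 + ‖p.2‖) ^ 4)⁻¹)
      ((volume.restrict (Set.Ioi 0)).prod volume) := by
  obtain ⟨C, hC, hb⟩ := exists_kern_le lam j l β
  have hmeas : Measurable fun p : ℝ × E3 => kern lam j l β p.1 p.2 * ((1 + ‖p.2‖) ^ 4)⁻¹ :=
    (measurable_kern lam j l β).mul (by fun_prop)
  have e : (volume.restrict (Set.Ioi (0 : ℝ))).prod (volume : Measure E3)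
      = ((volume.restrict (Set.Ioc (0 : ℝ) 1)).prod volume)
        + ((volume.restrict (Set.Ioi (1 : ℝ))).prod volume) := by
    rw [← Measure.add_prod, ← Measure.restrict_union (by
      rw [Set.disjoint_left]; intro a h1 h2; exact absurd h1.2 (not_le.2 h2)) measurableSet_Ioi,
      Set.Ioc_union_Ioi_eq_Ioi zero_le_one]
  rw [e, integrable_add_measure]
  have hmem : ∀ {S : Set ℝ}, MeasurableSet S →
      ∀ᵐ p : ℝ × E3 ∂((volume.restrict S).prod volume), p.1 ∈ S := fun hS =>
    Measure.quasiMeasurePreserving_fst.ae (ae_restrict_mem hS)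
  constructor
  -- Times `s ≤ 1`: the singularity at the moving point `x + sλe₁ = 0` is split into a power of `s`
  -- and a power of the distance, both integrable.
  · have hw : Integrable (fun p : ℝ × E3 => p.1 ^ (-(3 / 4) : ℝ) * singWeight (p.2 + p.1 • drift lam))
        ((volume.restrict (Set.Ioc (0 : ℝ) 1)).prod volume) := by
      have hsw := measurable_singWeight
      have hm : Measurable fun p : ℝ × E3 =>
          p.1 ^ (-(3 / 4) : ℝ) * singWeight (p.2 + p.1 • drift lam) :=
        Measurable.mul (by fun_prop) (hsw.comp (by fun_prop))
      rw [integrable_prod_iff hm.aestronglyMeasurable]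
      constructor
      · exact Eventually.of_forall fun s =>
          (integrable_singWeight.comp_add_right (s • drift lam)).const_mul (s ^ (-(3 / 4) : ℝ))
      · have h1 : IntegrableOn (fun s : ℝ => s ^ (-(3 / 4) : ℝ) * ∫ y, singWeight y)
            (Set.Ioc 0 1) :=
          ((intervalIntegral.intervalIntegrable_rpow' (by norm_num)).1).mul_const _
        refine h1.congr ?_
        filter_upwards [ae_restrict_mem measurableSet_Ioc] with s hs
        have h2 : ∀ y : E3, ‖s ^ (-(3 / 4) : ℝ) * singWeight (y + s • drift lam)‖
            = s ^ (-(3 / 4) : ℝ) * singWeight (y + s • drift lam) := fun y =>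
          Real.norm_of_nonneg (mul_nonneg (Real.rpow_nonneg hs.1.le _) (singWeight_nonneg _))
        simp only [h2]
        rw [integral_const_mul, integral_add_right_eq_self (fun y => singWeight y)]
    refine (hw.const_mul (C * (1 + |lam|) ^ 4)).mono' hmeas.aestronglyMeasurable ?_
    have hne : ∀ᵐ p : ℝ × E3 ∂((volume.restrict (Set.Ioc (0 : ℝ) 1)).prod volume),
        p.2 + p.1 • drift lam ≠ 0 := by
      rw [Measure.ae_prod_iff_ae_ae]
      · refine Eventually.of_forall fun s => ?_
        have : ∀ᵐ y : E3, y ≠ -(s • drift lam) := by simp [ae_iff]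
        filter_upwards [this] with y hy h0
        exact hy (eq_neg_of_add_eq_zero_left h0)
      · exact (measurableSet_eq_fun (by fun_prop) (by fun_prop)).compl
    filter_upwards [hmem measurableSet_Ioc, hne] with p hp hp0
    obtain ⟨s, x⟩ := p
    simp only at hp hp0 ⊢
    set y := x + s • drift lam with hy
    have hs : 0 < s := hp.1
    have hypos : 0 < ‖y‖ := norm_pos_iff.2 hp0
    rw [norm_mul, Real.norm_of_nonneg (by positivity : (0 : ℝ) ≤ ((1 + ‖x‖) ^ 4)⁻¹), singWeight]
    -- With `σ = √s`, the exponents satisfy `3/2 + 5/2 = 4`, the order of the singularity when `len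
    -- β = 1`. For `len β = 0` the surplus is harmless because `σ ≤ 1`.
    have h1 : |kern lam j l β s x| ≤ C * (s ^ (-(3 / 4) : ℝ) * ‖y‖ ^ (-(5 / 2) : ℝ)) := by
      refine (hb s hs x).trans ?_
      rw [div_eq_mul_inv, Real.rpow_neg hs.le, Real.rpow_neg hypos.le, ← mul_inv]
      refine mul_le_mul_of_nonneg_left (inv_anti₀ (by positivity) ?_) hC
      set σ := Real.sqrt s with hσ
      have hσ0 : 0 < σ := Real.sqrt_pos.2 hs
      have hσ1 : σ ≤ 1 := Real.sqrt_le_one.2 hp.2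
      have e1 : s ^ (3 / 4 : ℝ) = σ ^ (3 / 2 : ℝ) := by
        rw [hσ, Real.sqrt_eq_rpow, ← Real.rpow_mul hs.le]; norm_num
      have hsum : 0 < σ + ‖y‖ := by positivity
      have e2 : ‖y‖ ^ (5 / 2 : ℝ) ≤ (σ + ‖y‖) ^ (5 / 2 : ℝ) :=
        Real.rpow_le_rpow hypos.le (by linarith) (by norm_num)
      rw [e1]
      rcases Nat.le_one_iff_eq_zero_or_eq_one.1 hβ with h0 | h0
      · have e3 : σ ^ (3 / 2 : ℝ) ≤ (σ + ‖y‖) ^ (1 / 2 : ℝ) :=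
          (Real.rpow_le_rpow_of_exponent_ge hσ0 hσ1 (by norm_num)).trans
            (Real.rpow_le_rpow hσ0.le (by linarith) (by norm_num))
        calc _ ≤ (σ + ‖y‖) ^ (1 / 2 : ℝ) * (σ + ‖y‖) ^ (5 / 2 : ℝ) := by gcongr
          _ = _ := by rw [← Real.rpow_add hsum, h0, ← hy, ← Real.rpow_natCast]; norm_num
      · have e3 : σ ^ (3 / 2 : ℝ) ≤ (σ + ‖y‖) ^ (3 / 2 : ℝ) :=
          Real.rpow_le_rpow hσ0.le (by linarith) (by norm_num)
        calc _ ≤ (σ + ‖y‖) ^ (3 / 2 : ℝ) * (σ + ‖y‖) ^ (5 / 2 : ℝ) := by gcongr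
          _ = _ := by rw [← Real.rpow_add hsum, h0, ← hy, ← Real.rpow_natCast]; norm_num
    -- For `s ≤ 1` the drift moves points by at most `|λ|`, so the weight may be evaluated at `y` in
    -- place of `x`.
    have h2 : ((1 + ‖x‖) ^ 4)⁻¹ ≤ (1 + |lam|) ^ 4 * ((1 + ‖y‖) ^ 4)⁻¹ := by
      rw [← div_eq_mul_inv, le_div_iff₀ (by positivity), inv_mul_le_iff₀ (by positivity), ← mul_pow]
      refine pow_le_pow_left₀ (by positivity) ?_ 4
      have h3 : ‖y‖ ≤ ‖x‖ + s * |lam| := by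
        refine (norm_add_le _ _).trans (le_of_eq ?_)
        rw [norm_smul, norm_drift, Real.norm_of_nonneg hs.le]
      have h4 : s * |lam| ≤ |lam| := mul_le_of_le_one_left (abs_nonneg _) hp.2
      nlinarith [norm_nonneg x, abs_nonneg lam, mul_nonneg (norm_nonneg x) (abs_nonneg lam)]
    calc |kern lam j l β s x| * ((1 + ‖x‖) ^ 4)⁻¹
        ≤ (C * (s ^ (-(3 / 4) : ℝ) * ‖y‖ ^ (-(5 / 2) : ℝ))) *
          ((1 + |lam|) ^ 4 * ((1 + ‖y‖) ^ 4)⁻¹) :=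
          mul_le_mul h1 h2 (by positivity) (by positivity)
      _ = _ := by ring
  -- Times `s > 1`: the bound `s^{-3/2}` is integrable in time, and the weight is integrable in
  -- space.
  · have hw : Integrable (fun p : ℝ × E3 => C * p.1 ^ (-(3 / 2) : ℝ) * ((1 + ‖p.2‖) ^ 4)⁻¹)
        ((volume.restrict (Set.Ioi (1 : ℝ))).prod volume) :=
      Integrable.mul_prod ((integrableOn_Ioi_rpow_of_lt (by norm_num) one_pos).const_mul C)
        integrable_inv_one_add_norm_pow
    refine hw.mono' hmeas.aestronglyMeasurable ?_
    filter_upwards [hmem measurableSet_Ioi] with p hp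
    obtain ⟨s, x⟩ := p
    simp only at hp ⊢
    have hs1 : 1 < s := hp
    have hs : 0 < s := by linarith
    rw [norm_mul, Real.norm_of_nonneg (by positivity : (0 : ℝ) ≤ ((1 + ‖x‖) ^ 4)⁻¹)]
    gcongr
    refine (hb s hs x).trans ?_
    rw [div_eq_mul_inv, Real.rpow_neg hs.le]
    refine mul_le_mul_of_nonneg_left (inv_anti₀ (by positivity) ?_) hC
    have h1 : 1 ≤ Real.sqrt s := Real.one_le_sqrt.2 hs1.le
    calc s ^ (3 / 2 : ℝ) = Real.sqrt s ^ 3 := by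
          rw [Real.sqrt_eq_rpow, ← Real.rpow_natCast, ← Real.rpow_mul hs.le]; norm_num
      _ ≤ Real.sqrt s ^ (3 + len β) := pow_le_pow_right₀ h1 (by omega)
      _ ≤ _ := by gcongr; linarith [norm_nonneg (x + s • drift lam)]

section Kernel

variable (T : ℝ) [hT : Fact (0 < T)] (lam : ℝ) (j l : Fin 3) {β : Fin 3 → ℕ}

/-- The kernel `∫_0^∞ kern ds` of the steady-state part. -/
def steadyKernel (lam : ℝ) (j l : Fin 3) (β : Fin 3 → ℕ) (x : E3) : ℝ :=
  ∫ s in Set.Ioi 0, kern lam j l β s x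

theorem integrable_steadyKernel_mul_weight (hβ : len β ≤ 1) :
    Integrable fun x : E3 => steadyKernel lam j l β x * ((1 + ‖x‖) ^ 4)⁻¹ := by
  have h := (integrable_kern_mul_weight lam j l hβ).integral_prod_right
  simp only [integral_mul_const] at h
  exact h

/-- This one weighted bound yields measurability, local integrability, the pairing with Schwartz
functions and the absolute convergence of the convolutions. -/
theorem integrable_perKernel_mul_weight (hβ : len β ≤ 1) :
    Integrable (fun p => perKernel T lam j l β p * ((1 + ‖p.2‖) ^ 4)⁻¹) (muG T) := by
  have h1 := (unfold_muG (T := T) (integrable_kern_mul_weight lam j l hβ)).2.2.1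
  have h2 : Integrable (fun p : AddCircle T × E3 =>
      (1 : ℝ) * (steadyKernel lam j l β p.2 * ((1 + ‖p.2‖) ^ 4)⁻¹)) (muG T) :=
    Integrable.mul_prod (integrable_const 1) (integrable_steadyKernel_mul_weight lam j l hβ)
  refine ((h1.const_mul T).sub h2).congr (Eventually.of_forall fun p => ?_)
  simp only [Pi.sub_apply, perKernel, perFluct, perSum, tsum_mul_right, steadyKernel]
  ring

theorem aestronglyMeasurable_perKernel (hβ : len β ≤ 1) :
    AEStronglyMeasurable (perKernel T lam j l β) (muG T) := by
  have h := (integrable_perKernel_mul_weight T lam j l hβ).1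
  have h2 : AEStronglyMeasurable (fun p : AddCircle T × E3 => (1 + ‖p.2‖) ^ 4) (muG T) :=
    Measurable.aestronglyMeasurable (by fun_prop)
  refine (h.mul h2).congr (Eventually.of_forall fun p => ?_)
  have : (0 : ℝ) < (1 + ‖p.2‖) ^ 4 := by positivity
  simp only [Pi.mul_apply]
  field_simp

theorem integrable_perKernel_mul (hβ : len β ≤ 1) {φ : AddCircle T × E3 → ℂ}
    (hφ : AEStronglyMeasurable φ (muG T)) {C : ℝ}
    (hb : ∀ p, ‖φ p‖ ≤ C * ((1 + ‖p.2‖) ^ 4)⁻¹) :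
    Integrable (fun p => (perKernel T lam j l β p : ℂ) * φ p) (muG T) := by
  refine ((integrable_perKernel_mul_weight T lam j l hβ).norm.const_mul C).mono'
    ((Complex.continuous_ofReal.comp_aestronglyMeasurable
      (aestronglyMeasurable_perKernel T lam j l hβ)).mul hφ) (Eventually.of_forall fun p => ?_)
  rw [norm_mul, Complex.norm_real, norm_mul,
    Real.norm_of_nonneg (by positivity : (0 : ℝ) ≤ ((1 + ‖p.2‖) ^ 4)⁻¹)]
  calc _ ≤ ‖perKernel T lam j l β p‖ * (C * ((1 + ‖p.2‖) ^ 4)⁻¹) := by gcongr; exact hb p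
    _ = _ := by ring

theorem locallyIntegrable_perKernel (hβ : len β ≤ 1) :
    LocallyIntegrable (perKernel T lam j l β) (muG T) := by
  rw [locallyIntegrable_iff]
  intro K hK
  have h := (integrable_perKernel_mul_weight T lam j l hβ).integrableOn (s := K)
  have h2 := h.mul_continuousOn (g' := fun p : AddCircle T × E3 => (1 + ‖p.2‖) ^ 4)
    (by fun_prop) hK
  refine h2.congr (Eventually.of_forall fun p => ?_)
  have : (0 : ℝ) < (1 + ‖p.2‖) ^ 4 := by positivity
  simp only
  field_simp

end Kernel

/-! ### Schwartz–Bruhat functions on `G` and their Fourier series in time -/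

section Schwartz

variable {T : ℝ} [hT : Fact (0 < T)] {φ : AddCircle T × E3 → ℂ}

theorem continuous_of_lift {F : Type*} [TopologicalSpace F] {f : AddCircle T × E3 → F}
    (h : Continuous (lift f)) : Continuous f := by
  have hq : IsOpenQuotientMap (Prod.map (fun s : ℝ => (s : AddCircle T)) (id : E3 → E3)) :=
    IsOpenQuotientMap.prodMap QuotientAddGroup.isOpenQuotientMap_mk IsOpenQuotientMap.id
  exact hq.continuous_comp_iff.1 h

theorem IsSchwartz.continuous (h : IsSchwartz φ) : Continuous φ :=
  continuous_of_lift h.smooth.continuous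

theorem IsSchwartz.exists_norm_le (h : IsSchwartz φ) (N : ℕ) :
    ∃ C : ℝ, 0 ≤ C ∧ ∀ p, ‖φ p‖ ≤ C * ((1 + ‖p.2‖) ^ N)⁻¹ := by
  obtain ⟨A, hA⟩ := h.decay 0 0
  obtain ⟨B, hB⟩ := h.decay N 0
  have hA' : ∀ p : AddCircle T × E3, ‖φ p‖ ≤ A := by
    intro p
    have := hA (tau p.1, p.2)
    simpa [lift, coe_tau] using this
  have hB' : ∀ p : AddCircle T × E3, ‖p.2‖ ^ N * ‖φ p‖ ≤ B := by
    intro p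
    have := hB (tau p.1, p.2)
    simpa [lift, coe_tau] using this
  have key : ∀ p : AddCircle T × E3, (1 + ‖p.2‖) ^ N * ‖φ p‖ ≤ 2 ^ (N - 1) * (A + B) := by
    intro p
    have h1 : (1 + ‖p.2‖) ^ N ≤ 2 ^ (N - 1) * (1 ^ N + ‖p.2‖ ^ N) :=
      add_pow_le zero_le_one (norm_nonneg _) N
    calc (1 + ‖p.2‖) ^ N * ‖φ p‖ ≤ 2 ^ (N - 1) * (1 ^ N + ‖p.2‖ ^ N) * ‖φ p‖ := by gcongr
      _ = 2 ^ (N - 1) * (‖φ p‖ + ‖p.2‖ ^ N * ‖φ p‖) := by rw [one_pow]; ring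
      _ ≤ _ := by gcongr; exacts [hA' p, hB' p]
  refine ⟨2 ^ (N - 1) * (A + B), ?_, fun p => ?_⟩
  · exact le_trans (by positivity) (key 0)
  · rw [← div_eq_mul_inv, le_div_iff₀ (by positivity), mul_comm]
    exact key p

/-- The directional derivative of a function on `G`. -/
def dirDeriv (v : ℝ × E3) (φ : AddCircle T × E3 → ℂ) (p : AddCircle T × E3) : ℂ :=
  fderiv ℝ (lift φ) (tau p.1, p.2) v

theorem fderiv_lift_congr (φ : AddCircle T × E3 → ℂ) {a b : ℝ} (hab : (a : AddCircle T) = b)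
    (x : E3) : fderiv ℝ (lift φ) (a, x) = fderiv ℝ (lift φ) (b, x) := by
  have h : (fun q : ℝ × E3 => lift φ (q + (a - b, 0))) = lift φ := by
    funext q
    simp [lift, hab]
  have h2 := fderiv_comp_add_right (𝕜 := ℝ) (f := lift φ) (x := (b, x)) ((a - b, 0) : ℝ × E3)
  rw [h] at h2
  rw [h2]
  simp

theorem lift_dirDeriv (v : ℝ × E3) (φ : AddCircle T × E3 → ℂ) :
    lift (dirDeriv v φ) = fun p => fderiv ℝ (lift φ) p v := by
  funext p
  obtain ⟨s, x⟩ := p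
  simp only [lift, dirDeriv]
  rw [fderiv_lift_congr φ (coe_tau (s : AddCircle T)) x]

theorem IsSchwartz.dirDeriv (h : IsSchwartz φ) (v : ℝ × E3) : IsSchwartz (dirDeriv v φ) := by
  have e : lift (TPOseen.dirDeriv v φ)
      = (ContinuousLinearMap.apply ℝ ℂ v) ∘ (fderiv ℝ (lift φ)) := by
    rw [lift_dirDeriv]; rfl
  have hs : ContDiff ℝ ∞ (fderiv ℝ (lift φ)) :=
    ContDiff.fderiv_right (m := ∞) h.smooth (by norm_num)
  refine ⟨?_, fun N n => ?_⟩
  · unfold SmoothOnG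
    rw [e]
    exact (ContinuousLinearMap.contDiff _).comp hs
  · obtain ⟨C, hC⟩ := h.decay N (n + 1)
    refine ⟨‖ContinuousLinearMap.apply ℝ ℂ v‖ * C, fun p => ?_⟩
    rw [e]
    have h1 := (ContinuousLinearMap.apply ℝ ℂ v).norm_iteratedFDeriv_comp_left
      (hs.contDiffAt (x := p)) (n := n) (by exact_mod_cast le_top)
    rw [norm_iteratedFDeriv_fderiv] at h1
    calc _ ≤ ‖p.2‖ ^ N * (‖ContinuousLinearMap.apply ℝ ℂ v‖ * ‖iteratedFDeriv ℝ (n + 1) (lift φ) p‖) := by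
          gcongr
      _ = ‖ContinuousLinearMap.apply ℝ ℂ v‖ * (‖p.2‖ ^ N * ‖iteratedFDeriv ℝ (n + 1) (lift φ) p‖) := by
          ring
      _ ≤ _ := by gcongr; exact hC p

theorem IsSchwartz.differentiable_lift (h : IsSchwartz φ) : Differentiable ℝ (lift φ) :=
  h.smooth.differentiable (by norm_num)

theorem IsSchwartz.hasFDerivAt_slice (h : IsSchwartz φ) (t : AddCircle T) (x : E3) :
    HasFDerivAt (fun x => φ (t, x))
      ((fderiv ℝ (lift φ) (tau t, x)).comp (ContinuousLinearMap.inr ℝ ℝ E3)) x := by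
  have h1 : HasFDerivAt (fun x : E3 => (tau t, x)) (ContinuousLinearMap.inr ℝ ℝ E3) x :=
    hasFDerivAt_prodMk_right _ _
  have h2 := (h.differentiable_lift (tau t, x)).hasFDerivAt.comp x h1
  refine h2.congr_of_eventuallyEq (Eventually.of_forall fun y => ?_)
  simp [lift, coe_tau]

theorem IsSchwartz.pd_eq_dirDeriv (h : IsSchwartz φ) (i : Fin 3) :
    (fun p : AddCircle T × E3 => pd i (fun x => φ (p.1, x)) p.2)
      = TPOseen.dirDeriv (0, EuclideanSpace.single i 1) φ := by
  funext p
  simp only [pd, (h.hasFDerivAt_slice p.1 p.2).fderiv, TPOseen.dirDeriv]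
  rfl

theorem IsSchwartz.integrable (h : IsSchwartz φ) : Integrable φ (muG T) := by
  obtain ⟨C, hC, hb⟩ := h.exists_norm_le 4
  refine (Integrable.mul_prod (integrable_const C) integrable_inv_one_add_norm_pow).mono'
    h.continuous.aestronglyMeasurable (Eventually.of_forall hb)

theorem norm_fourier_apply (k : ℤ) (t : AddCircle T) : ‖fourier k t‖ = 1 := Circle.norm_coe _

/-- The Fourier coefficient in time `∫ φ(t,x) e^{i (2π/T) k t} dt`. -/
def timeCoeff (φ : AddCircle T × E3 → ℂ) (k : ℤ) (x : E3) : ℂ :=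
  ∫ t, φ (t, x) * fourier k t ∂(muT T)

theorem timeCoeff_eq (φ : AddCircle T × E3 → ℂ) (k : ℤ) (x : E3) :
    timeCoeff φ k x = T⁻¹ * ∫ s in (0 : ℝ)..T, lift φ (s, x) * fourier k (s : AddCircle T) := by
  rw [timeCoeff, integral_muT_eq, ← AddCircle.intervalIntegral_preimage T 0, zero_add,
    Complex.real_smul, Complex.ofReal_inv]
  rfl

/-- Integration by parts over one period; the boundary terms cancel by periodicity. -/
theorem IsSchwartz.timeCoeff_dirDeriv (h : IsSchwartz φ) (k : ℤ) (x : E3) :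
    timeCoeff (TPOseen.dirDeriv (1, 0) φ) k x
      = -(2 * Real.pi * Complex.I * k / T) * timeCoeff φ k x := by
  have hd : ∀ s : ℝ, HasDerivAt (fun s => lift φ (s, x) * fourier k (s : AddCircle T))
      (lift (TPOseen.dirDeriv (1, 0) φ) (s, x) * fourier k (s : AddCircle T)
        + lift φ (s, x) * (2 * Real.pi * Complex.I * k / T * fourier k (s : AddCircle T))) s := by
    intro s
    refine HasDerivAt.mul ?_ (hasDerivAt_fourier T k s)
    rw [lift_dirDeriv]
    have h1 : HasDerivAt (fun s : ℝ => (s, x)) ((1, 0) : ℝ × E3) s :=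
      (hasDerivAt_id s).prodMk (hasDerivAt_const s x)
    exact (h.differentiable_lift (s, x)).hasFDerivAt.comp_hasDerivAt s h1
  have hc : Continuous fun s : ℝ => lift φ (s, x) :=
    h.smooth.continuous.comp (by fun_prop)
  have hc' : Continuous fun s : ℝ => lift (TPOseen.dirDeriv (1, 0) φ) (s, x) :=
    (h.dirDeriv (1, 0)).smooth.continuous.comp (by fun_prop)
  have hf : Continuous fun s : ℝ => fourier k (s : AddCircle T) :=
    (map_continuous _).comp (AddCircle.continuous_mk' T)
  have hi := intervalIntegral.integral_eq_sub_of_hasDerivAt (a := 0) (b := T) (fun s _ => hd s)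
    (((hc'.mul hf).add (hc.mul (continuous_const.mul hf))).intervalIntegrable 0 T)
  have hadd := intervalIntegral.integral_add (μ := volume) (a := 0) (b := T)
    (f := fun s => lift (TPOseen.dirDeriv (1, 0) φ) (s, x) * fourier k (s : AddCircle T))
    (g := fun s => lift φ (s, x) * (2 * Real.pi * Complex.I * k / T * fourier k (s : AddCircle T)))
    ((hc'.mul hf).intervalIntegrable 0 T)
    ((hc.mul (continuous_const.mul hf)).intervalIntegrable 0 T)
  rw [hadd] at hi
  have h0 : lift φ (T, x) * fourier k ((T : ℝ) : AddCircle T)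
      - lift φ (0, x) * fourier k ((0 : ℝ) : AddCircle T) = 0 := by
    simp [lift, AddCircle.coe_period]
  rw [h0] at hi
  have h2 : ∀ s : ℝ, lift φ (s, x) * (2 * Real.pi * Complex.I * k / T * fourier k (s : AddCircle T))
      = (2 * Real.pi * Complex.I * k / T) * (lift φ (s, x) * fourier k (s : AddCircle T)) := by
    intro s; ring
  simp only [h2] at hi
  rw [intervalIntegral.integral_const_mul] at hi
  rw [timeCoeff_eq, timeCoeff_eq]
  rw [Complex.ofReal_inv]
  linear_combination (T⁻¹ : ℂ) * hi

theorem IsSchwartz.exists_timeCoeff_le (h : IsSchwartz φ) (N : ℕ) :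
    ∃ C : ℝ, 0 ≤ C ∧ ∀ k x, ‖timeCoeff φ k x‖ ≤ C * ((1 + ‖x‖) ^ N)⁻¹ := by
  obtain ⟨C, hC, hb⟩ := h.exists_norm_le N
  refine ⟨C, hC, fun k x => ?_⟩
  have := norm_integral_le_of_norm_le_const (μ := muT T) (f := fun t => φ (t, x) * fourier k t)
    (C := C * ((1 + ‖x‖) ^ N)⁻¹) (Eventually.of_forall fun t => by
      rw [norm_mul, norm_fourier_apply, mul_one]; exact hb (t, x))
  rw [probReal_univ, mul_one] at this
  exact this

/-- Two integrations by parts in time give `k^{-2}`, summable and uniform in `x` under the spatial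
weight. -/
theorem IsSchwartz.exists_timeCoeff_le_div_sq (h : IsSchwartz φ) (N : ℕ) :
    ∃ C : ℝ, 0 ≤ C ∧ ∀ k : ℤ, k ≠ 0 → ∀ x,
      ‖timeCoeff φ k x‖ ≤ C * (1 / (k : ℝ) ^ 2) * ((1 + ‖x‖) ^ N)⁻¹ := by
  obtain ⟨C, hC, hb⟩ := ((h.dirDeriv (1, 0)).dirDeriv (1, 0)).exists_timeCoeff_le N
  have hT0 : 0 < T := hT.out
  refine ⟨C * (T / (2 * Real.pi)) ^ 2, by positivity, fun k hk x => ?_⟩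
  have h1 := hb k x
  rw [(h.dirDeriv _).timeCoeff_dirDeriv, h.timeCoeff_dirDeriv, ← mul_assoc, norm_mul] at h1
  have e : ‖-(2 * Real.pi * Complex.I * k / T) * -(2 * Real.pi * Complex.I * (k : ℂ) / T)‖
      = (2 * Real.pi / T) ^ 2 * (k : ℝ) ^ 2 := by
    simp only [norm_mul, norm_neg, norm_div, Complex.norm_I, Complex.norm_real, Complex.norm_intCast,
      Complex.norm_two, Real.norm_of_nonneg Real.pi_pos.le, Real.norm_of_nonneg hT0.le, mul_one]
    rw [← sq_abs (k : ℝ)]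
    ring
  rw [e] at h1
  have hk' : (0 : ℝ) < (k : ℝ) ^ 2 := by positivity
  have hp := Real.pi_pos
  rw [← le_div_iff₀' (by positivity)] at h1
  refine h1.trans (le_of_eq ?_)
  field_simp

theorem IsSchwartz.hasSum_timeCoeff (h : IsSchwartz φ) (t : AddCircle T) (x : E3) :
    HasSum (fun k : ℤ => timeCoeff φ k x * fourier (-k) t) (φ (t, x)) := by
  have hc : Continuous fun t => φ (t, x) := h.continuous.comp (by fun_prop)
  -- `timeCoeff` integrates against `e^{+i(2π/T)kt}`, so it is the usual coefficient of index `-k`.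
  have e : ∀ k, fourierCoeff (fun t => φ (t, x)) k = timeCoeff φ (-k) x := by
    intro k
    simp only [fourierCoeff, timeCoeff, smul_eq_mul, mul_comm]
  obtain ⟨C, hC, hb⟩ := h.exists_timeCoeff_le_div_sq 0
  have hs : Summable (fourierCoeff (⟨fun t => φ (t, x), hc⟩ : C(AddCircle T, ℂ))) := by
    have h1 : Summable fun k : ℤ => C * (1 / (k : ℝ) ^ 2) :=
      ((Real.summable_one_div_int_pow (p := 2)).2 (by norm_num)).mul_left C
    -- At `k = 0` the majorant `1 / k ^ 2` evaluates to `0` and bounds nothing, so that index is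
    -- left out.
    refine h1.of_norm_bounded_eventually ?_
    filter_upwards [(Set.finite_singleton (0 : ℤ)).compl_mem_cofinite] with k hk
    have h2 := hb (-k) (by simpa using hk) x
    have h3 := e k
    simp only [ContinuousMap.coe_mk, h3]
    simpa using h2
  have h2 := has_pointwise_sum_fourier_series_of_summable hs t
  have h3 := (Equiv.neg ℤ).hasSum_iff.2 h2
  refine h3.congr_fun fun k => ?_
  have := e (-k)
  simp only [Function.comp, Equiv.neg_apply, ContinuousMap.coe_mk, this, neg_neg, smul_eq_mul]

end Schwartz

/-! ### The Fourier transform of test functions on `ℤ × ℝ³` -/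

section DualFourier

variable {T : ℝ} [hT : Fact (0 < T)] {φ : AddCircle T × E3 → ℂ}

theorem norm_cexp_I_mul_inner (ξ x : E3) : ‖Complex.exp (Complex.I * (inner ℝ ξ x : ℝ))‖ = 1 := by
  rw [mul_comm]; exact Complex.norm_exp_ofReal_mul_I _

theorem IsSchwartz.integrable_mul_char (h : IsSchwartz φ) (k : ℤ) (ξ : E3) :
    Integrable (fun p : AddCircle T × E3 =>
      φ p * (fourier k p.1 * Complex.exp (Complex.I * (inner ℝ ξ p.2 : ℝ)))) (muG T) := by
  refine h.integrable.mul_bdd (c := 1) (Continuous.aestronglyMeasurable ?_)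
    (Eventually.of_forall fun p => ?_)
  · have : Continuous fun p : AddCircle T × E3 => fourier k p.1 :=
      (map_continuous (fourier k)).comp continuous_fst
    exact this.mul (by fun_prop)
  · rw [norm_mul, norm_fourier_apply, norm_cexp_I_mul_inner, one_mul]

theorem IsSchwartz.integrable_timeCoeff (h : IsSchwartz φ) (k : ℤ) :
    Integrable (timeCoeff φ k) := by
  have h1 := (h.integrable_mul_char k 0).integral_prod_right
  simpa [timeCoeff] using! h1

theorem IsSchwartz.dualFourier_eq (h : IsSchwartz φ) (k : ℤ) (ξ : E3) :
    dualFourier φ k ξ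
      = ∫ x, timeCoeff φ k x * Complex.exp (Complex.I * (inner ℝ ξ x : ℝ)) := by
  rw [dualFourier, muG, integral_prod_symm _ (h.integrable_mul_char k ξ)]
  congr 1
  funext x
  rw [timeCoeff, ← integral_mul_const]
  simp only [mul_assoc]

theorem exists_dualFourier_le (φ : AddCircle T × E3 → ℂ) :
    ∃ C : ℝ, 0 ≤ C ∧ ∀ k ξ, ‖dualFourier φ k ξ‖ ≤ C := by
  refine ⟨∫ p, ‖φ p‖ ∂(muG T), integral_nonneg fun _ => norm_nonneg _, fun k ξ => ?_⟩
  refine (norm_integral_le_integral_norm _).trans (le_of_eq ?_)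
  congr 1
  funext p
  rw [norm_mul, norm_mul, norm_fourier_apply, norm_cexp_I_mul_inner, one_mul, mul_one]

theorem hasFDerivAt_cexp_I_mul_inner (ξ x : E3) :
    HasFDerivAt (fun x : E3 => Complex.exp (Complex.I * (inner ℝ ξ x : ℝ)))
      (Complex.exp (Complex.I * (inner ℝ ξ x : ℝ)) •
        (Complex.I • (Complex.ofRealCLM.comp (innerSL ℝ ξ)))) x := by
  have h1 : HasFDerivAt (fun x : E3 => ((inner ℝ ξ x : ℝ) : ℂ))
      (Complex.ofRealCLM.comp (innerSL ℝ ξ)) x :=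
    (Complex.ofRealCLM.comp (innerSL ℝ ξ)).hasFDerivAt
  exact (h1.const_mul Complex.I).cexp

theorem IsSchwartz.dualFourier_dirDeriv (h : IsSchwartz φ) (i : Fin 3) (k : ℤ) (ξ : E3) :
    dualFourier (TPOseen.dirDeriv (0, EuclideanSpace.single i 1) φ) k ξ
      = -(Complex.I * ξ i) * dualFourier φ k ξ := by
  have hd := h.dirDeriv (0, EuclideanSpace.single i 1)
  have hg : ∀ x, fderiv ℝ (fun x : E3 => Complex.exp (Complex.I * (inner ℝ ξ x : ℝ))) x
      (EuclideanSpace.single i 1)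
      = Complex.I * ξ i * Complex.exp (Complex.I * (inner ℝ ξ x : ℝ)) := by
    intro x
    rw [(hasFDerivAt_cexp_I_mul_inner ξ x).fderiv]
    simp [EuclideanSpace.inner_single_right]
    ring
  have key : ∀ t : AddCircle T,
      ∫ x, TPOseen.dirDeriv (0, EuclideanSpace.single i 1) φ (t, x) *
        Complex.exp (Complex.I * (inner ℝ ξ x : ℝ))
      = -(Complex.I * ξ i) * ∫ x, φ (t, x) * Complex.exp (Complex.I * (inner ℝ ξ x : ℝ)) := by
    intro t
    have hI : ∀ {ψ : AddCircle T × E3 → ℂ}, IsSchwartz ψ →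
        Integrable fun x => ψ (t, x) * Complex.exp (Complex.I * (inner ℝ ξ x : ℝ)) := by
      intro ψ hψ
      obtain ⟨C, hC, hb⟩ := hψ.exists_norm_le 4
      have hc : Continuous fun x => ψ (t, x) := hψ.continuous.comp (by fun_prop)
      refine (integrable_inv_one_add_norm_pow.const_mul C).mono'
        (hc.mul (by fun_prop)).aestronglyMeasurable (Eventually.of_forall fun x => ?_)
      rw [norm_mul, norm_cexp_I_mul_inner, mul_one]
      exact hb (t, x)
    have hfd : ∀ x, fderiv ℝ (fun x => φ (t, x)) x (EuclideanSpace.single i 1)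
        = TPOseen.dirDeriv (0, EuclideanSpace.single i 1) φ (t, x) := fun x =>
      congrFun (h.pd_eq_dirDeriv i) (t, x)
    have e := integral_mul_fderiv_eq_neg_fderiv_mul_of_integrable (μ := (volume : Measure E3))
      (f := fun x => φ (t, x)) (g := fun x : E3 => Complex.exp (Complex.I * (inner ℝ ξ x : ℝ)))
      (v := EuclideanSpace.single i 1)
      (by simp only [hfd]; exact hI hd)
      (by
        simp only [hg]
        refine ((hI h).const_mul (Complex.I * ξ i)).congr (Eventually.of_forall fun x => ?_)
        simp only; ring)
      (hI h) (fun x _ => (h.hasFDerivAt_slice t x).differentiableAt)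
      (fun x _ => (hasFDerivAt_cexp_I_mul_inner ξ x).differentiableAt)
    simp only [hfd, hg] at e
    have e2 : ∀ x, φ (t, x) * (Complex.I * ξ i * Complex.exp (Complex.I * (inner ℝ ξ x : ℝ)))
        = (Complex.I * ξ i) * (φ (t, x) * Complex.exp (Complex.I * (inner ℝ ξ x : ℝ))) := by
      intro x; ring
    simp only [e2, integral_const_mul] at e
    linear_combination e
  have hF : ∀ {ψ : AddCircle T × E3 → ℂ}, IsSchwartz ψ → dualFourier ψ k ξ
      = ∫ t, fourier k t * (∫ x, ψ (t, x) * Complex.exp (Complex.I * (inner ℝ ξ x : ℝ))) ∂(muT T) := by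
    intro ψ hψ
    rw [dualFourier, muG, integral_prod _ (hψ.integrable_mul_char k ξ)]
    congr 1
    funext t
    rw [← integral_const_mul]
    congr 1
    funext x
    ring
  rw [hF hd, hF h, ← integral_const_mul]
  congr 1
  funext t
  rw [key t]
  ring

theorem norm_sq_eq_sum (ξ : E3) : ‖ξ‖ ^ 2 = ∑ i, ξ i ^ 2 := by
  rw [EuclideanSpace.norm_sq_eq]
  simp

/-- Multiplication by `|ξ|²` corresponds to `-Δ` acting on the test function. The bound is uniform
in `k`. -/
theorem exists_pow_mul_dualFourier_le (N : ℕ) : ∀ {φ : AddCircle T × E3 → ℂ}, IsSchwartz φ →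
    ∃ C : ℝ, 0 ≤ C ∧ ∀ k ξ, (‖ξ‖ ^ 2) ^ N * ‖dualFourier φ k ξ‖ ≤ C := by
  induction N with
  | zero => intro φ _; simpa using exists_dualFourier_le φ
  | succ N ih =>
    intro φ h
    have h2 : ∀ i : Fin 3, IsSchwartz (TPOseen.dirDeriv (0, EuclideanSpace.single i 1)
        (TPOseen.dirDeriv (0, EuclideanSpace.single i 1) φ)) := fun i => (h.dirDeriv _).dirDeriv _
    choose C hC hb using fun i => ih (h2 i)
    refine ⟨∑ i, C i, Finset.sum_nonneg fun i _ => hC i, fun k ξ => ?_⟩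
    rw [pow_succ, norm_sq_eq_sum, Finset.mul_sum, Finset.sum_mul]
    refine Finset.sum_le_sum fun i _ => ?_
    have h3 := hb i k ξ
    rw [(h.dirDeriv _).dualFourier_dirDeriv, h.dualFourier_dirDeriv, ← mul_assoc, norm_mul,
      norm_sq_eq_sum] at h3
    have e : ‖-(Complex.I * (ξ i : ℂ)) * -(Complex.I * (ξ i : ℂ))‖ = ξ i ^ 2 := by
      simp only [norm_mul, norm_neg, Complex.norm_I, Complex.norm_real, one_mul, Real.norm_eq_abs]
      rw [← sq, sq_abs]
    rw [e] at h3
    linarith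

theorem IsSchwartz.continuous_dualFourier (h : IsSchwartz φ) (k : ℤ) :
    Continuous (dualFourier φ k) := by
  refine continuous_of_dominated (bound := fun p => ‖φ p‖)
    (fun ξ => (h.integrable_mul_char k ξ).1) (fun ξ => Eventually.of_forall fun p => ?_)
    h.integrable.norm (Eventually.of_forall fun p => by fun_prop)
  rw [norm_mul, norm_mul, norm_fourier_apply, norm_cexp_I_mul_inner, one_mul, mul_one]

theorem eq_zero_or_single_of_len_le_one {α : Fin 3 → ℕ} (hα : len α ≤ 1) :
    α = 0 ∨ ∃ i, α = Pi.single i 1 := by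
  simp only [len, Fin.sum_univ_three] at hα
  by_cases h0 : α 0 = 1
  · right; refine ⟨0, ?_⟩; funext i; fin_cases i <;> simp <;> omega
  by_cases h1 : α 1 = 1
  · right; refine ⟨1, ?_⟩; funext i; fin_cases i <;> simp <;> omega
  by_cases h2 : α 2 = 1
  · right; refine ⟨2, ?_⟩; funext i; fin_cases i <;> simp <;> omega
  · left; funext i; fin_cases i <;> simp <;> omega

theorem mpd_zero {F : Type*} [NormedAddCommGroup F] [NormedSpace ℝ F] (g : E3 → F) :
    mpd 0 g = g := rfl

theorem mpd_single {F : Type*} [NormedAddCommGroup F] [NormedSpace ℝ F] (i : Fin 3) (g : E3 → F) :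
    mpd (Pi.single i 1) g = pd i g := by
  fin_cases i <;> rfl

/-- Integration by parts; the sign is the one that `distDeriv` compensates. -/
theorem IsSchwartz.dualFourier_mpd (h : IsSchwartz φ) {α : Fin 3 → ℕ} (hα : len α ≤ 1)
    (k : ℤ) (ξ : E3) :
    dualFourier (fun p : AddCircle T × E3 => TPOseen.mpd α (fun x => φ (p.1, x)) p.2) k ξ
      = (-1) ^ len α * mon α ξ * dualFourier φ k ξ := by
  rcases eq_zero_or_single_of_len_le_one hα with rfl | ⟨i, rfl⟩
  · simp [mpd_zero, len, mon]
  · simp only [mpd_single]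
    rw [h.pd_eq_dirDeriv, h.dualFourier_dirDeriv]
    have h1 := len_add_single 0 i 1
    have h2 := mon_add_single 0 i 1 ξ
    rw [zero_add] at h1 h2
    rw [h1, h2]
    simp [len, mon]

end DualFourier

/-! ### Identification of the periodized kernel with the distribution `D_x^β Γ_⊥` -/

section Pairing

variable {T : ℝ} [hT : Fact (0 < T)] {φ : AddCircle T × E3 → ℂ}
  (lam : ℝ) (j l : Fin 3) {β : Fin 3 → ℕ}

/-- This is the hypothesis of `laplace_fubini` at `s₀ = 0`, where no Gaussian factor helps. At the
origin `|ξ|^{-2}` is integrable in dimension three; at infinity six powers of decay of the test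
function suffice, whence the comparison with `singWeight`. -/
theorem IsSchwartz.integrable_symbol (h : IsSchwartz φ) (hβ : len β ≤ 1) (k : ℤ) :
    Integrable fun ξ => ‖osym j l β ξ * dualFourier φ k ξ‖ / ‖ξ‖ ^ 2 := by
  obtain ⟨A, hA, hb⟩ := (osym_symbolBound j l β).bound
  obtain ⟨C₀, hC₀, h₀⟩ := exists_pow_mul_dualFourier_le 0 h
  obtain ⟨C₁, hC₁, h₁⟩ := exists_pow_mul_dualFourier_le 3 h
  have hm : Measurable fun ξ => ‖osym j l β ξ * dualFourier φ k ξ‖ / ‖ξ‖ ^ 2 :=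
    (((osym_symbolBound j l β).measurable.mul (h.continuous_dualFourier k).measurable).norm).div
      (by fun_prop)
  refine (integrable_singWeight.const_mul (A * 16 * (C₀ + C₁))).mono' hm.aestronglyMeasurable ?_
  have hne : ∀ᵐ ξ : E3, ξ ≠ 0 := by simp [ae_iff]
  filter_upwards [hne] with ξ hξ
  have hr : 0 < ‖ξ‖ := norm_pos_iff.2 hξ
  rw [Real.norm_of_nonneg (by positivity), norm_mul]
  set r := ‖ξ‖ with hrd
  have hD0 : ‖dualFourier φ k ξ‖ ≤ C₀ := by simpa using h₀ k ξ
  have hD1 : r ^ 6 * ‖dualFourier φ k ξ‖ ≤ C₁ := by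
    have := h₁ k ξ
    rwa [← pow_mul] at this
  have hD : ‖dualFourier φ k ξ‖ ≤ (C₀ + C₁) * (1 + r ^ 6)⁻¹ := by
    rw [← div_eq_mul_inv, le_div_iff₀ (by positivity)]
    linarith
  have hcore : r ^ len β / r ^ 2 * (1 + r ^ 6)⁻¹ ≤ 16 * (r ^ (-(5 / 2) : ℝ) * ((1 + r) ^ 4)⁻¹) := by
    have e1 : r ^ (-(5 / 2) : ℝ) = r ^ (-(1 / 2) : ℝ) / r ^ 2 := by
      rw [← Real.rpow_natCast r 2, ← Real.rpow_sub hr]; norm_num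
    rw [e1]
    have key : r ^ len β * (1 + r) ^ 4 * r ^ (1 / 2 : ℝ) ≤ 16 * (1 + r ^ 6) := by
      rcases le_total r 1 with h1 | h1
      · have a1 : r ^ len β ≤ 1 := pow_le_one₀ hr.le h1
        have a2 : (1 + r) ^ 4 ≤ 2 ^ 4 := by gcongr; linarith
        have a3 : r ^ (1 / 2 : ℝ) ≤ 1 := Real.rpow_le_one hr.le h1 (by norm_num)
        calc _ ≤ 1 * 2 ^ 4 * (1 : ℝ) := by gcongr
          _ ≤ _ := by nlinarith [pow_pos hr 6]
      · have a1 : r ^ len β ≤ r := by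
          simpa using pow_le_pow_right₀ h1 hβ
        have a2 : (1 + r) ^ 4 ≤ (2 * r) ^ 4 := by gcongr; linarith
        have a3 : r ^ (1 / 2 : ℝ) ≤ r := by
          simpa using Real.rpow_le_rpow_of_exponent_le h1 (by norm_num : (1 / 2 : ℝ) ≤ 1)
        calc _ ≤ r * (2 * r) ^ 4 * r := by gcongr
          _ = 16 * r ^ 6 := by ring
          _ ≤ _ := by linarith
    have e2 : r ^ (-(1 / 2) : ℝ) = (r ^ (1 / 2 : ℝ))⁻¹ := Real.rpow_neg hr.le _
    have hp : 0 < r ^ (1 / 2 : ℝ) := Real.rpow_pos_of_pos hr _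
    rw [e2, div_mul_eq_mul_div, div_mul_eq_mul_div, ← mul_div_assoc]
    refine div_le_div_of_nonneg_right ?_ (by positivity)
    rw [← mul_inv, ← div_eq_mul_inv, ← div_eq_mul_inv, div_le_div_iff₀ (by positivity) (by positivity)]
    linarith
  calc ‖osym j l β ξ‖ * ‖dualFourier φ k ξ‖ / r ^ 2
      ≤ A * r ^ len β * ((C₀ + C₁) * (1 + r ^ 6)⁻¹) / r ^ 2 := by gcongr; exact hb ξ
    _ = A * (C₀ + C₁) * (r ^ len β / r ^ 2 * (1 + r ^ 6)⁻¹) := by ring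
    _ ≤ A * (C₀ + C₁) * (16 * (r ^ (-(5 / 2) : ℝ) * ((1 + r) ^ 4)⁻¹)) := by gcongr
    _ = _ := by rw [singWeight]; ring

/-- The contribution of the time frequency `k` to the pairing with `φ`. -/
def modeTerm (φ : AddCircle T × E3 → ℂ) (β : Fin 3 → ℕ) (k : ℤ) : ℂ :=
  ∫ p : ℝ × E3, (kern lam j l β p.1 p.2 : ℂ) * (timeCoeff φ k p.2 * fourier (-k) (p.1 : AddCircle T))
    ∂((volume.restrict (Set.Ioi 0)).prod volume)

theorem integrable_kern_mul (hβ : len β ≤ 1) {ψ : ℝ × E3 → ℂ}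
    (hψ : AEStronglyMeasurable ψ ((volume.restrict (Set.Ioi 0)).prod volume)) {C : ℝ}
    (hb : ∀ p, ‖ψ p‖ ≤ C * ((1 + ‖p.2‖) ^ 4)⁻¹) :
    Integrable (fun p : ℝ × E3 => (kern lam j l β p.1 p.2 : ℂ) * ψ p)
      ((volume.restrict (Set.Ioi 0)).prod volume) ∧
    ∫ p : ℝ × E3, ‖(kern lam j l β p.1 p.2 : ℂ) * ψ p‖ ∂((volume.restrict (Set.Ioi 0)).prod volume)
      ≤ C * ∫ p : ℝ × E3, ‖kern lam j l β p.1 p.2 * ((1 + ‖p.2‖) ^ 4)⁻¹‖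
        ∂((volume.restrict (Set.Ioi 0)).prod volume) := by
  have hw := (integrable_kern_mul_weight lam j l hβ).norm
  have hle : ∀ p : ℝ × E3, ‖(kern lam j l β p.1 p.2 : ℂ) * ψ p‖
      ≤ C * ‖kern lam j l β p.1 p.2 * ((1 + ‖p.2‖) ^ 4)⁻¹‖ := by
    intro p
    rw [norm_mul, Complex.norm_real, norm_mul,
      Real.norm_of_nonneg (by positivity : (0 : ℝ) ≤ ((1 + ‖p.2‖) ^ 4)⁻¹)]
    calc _ ≤ ‖kern lam j l β p.1 p.2‖ * (C * ((1 + ‖p.2‖) ^ 4)⁻¹) := by gcongr; exact hb p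
      _ = _ := by ring
  have hi : Integrable (fun p : ℝ × E3 => (kern lam j l β p.1 p.2 : ℂ) * ψ p)
      ((volume.restrict (Set.Ioi 0)).prod volume) :=
    (hw.const_mul C).mono' ((Complex.measurable_ofReal.comp
      (measurable_kern lam j l β)).aestronglyMeasurable.mul hψ) (Eventually.of_forall hle)
  refine ⟨hi, ?_⟩
  rw [← integral_const_mul]
  exact integral_mono hi.norm (hw.const_mul C) hle

theorem continuous_fourier_coe (k : ℤ) : Continuous fun s : ℝ => fourier k (s : AddCircle T) :=
  (map_continuous _).comp (AddCircle.continuous_mk' T)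

theorem IsSchwartz.aestronglyMeasurable_mode (h : IsSchwartz φ) (k : ℤ) :
    AEStronglyMeasurable (fun p : ℝ × E3 => timeCoeff φ k p.2 * fourier (-k) (p.1 : AddCircle T))
      ((volume.restrict (Set.Ioi 0)).prod volume) :=
  (h.integrable_timeCoeff k).1.comp_snd.mul
    ((continuous_fourier_coe (-k)).comp continuous_fst).aestronglyMeasurable

theorem IsSchwartz.integrable_mode (h : IsSchwartz φ) (hβ : len β ≤ 1) (k : ℤ) :
    Integrable (fun p : ℝ × E3 => (kern lam j l β p.1 p.2 : ℂ) *
      (timeCoeff φ k p.2 * fourier (-k) (p.1 : AddCircle T)))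
      ((volume.restrict (Set.Ioi 0)).prod volume) := by
  obtain ⟨C, hC, hb⟩ := h.exists_timeCoeff_le 4
  refine (integrable_kern_mul lam j l hβ (h.aestronglyMeasurable_mode k) (C := C) fun p => ?_).1
  rw [norm_mul, norm_fourier_apply, mul_one]
  exact hb k p.2

/-- The decay `k^{-2}` of the time coefficients allows the Fourier series of the test function to be
integrated term by term against the kernel. -/
theorem IsSchwartz.hasSum_modeTerm (h : IsSchwartz φ) (hβ : len β ≤ 1) :
    HasSum (modeTerm lam j l φ β) (∫ p : ℝ × E3, (kern lam j l β p.1 p.2 : ℂ) *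
      φ ((p.1 : AddCircle T), p.2) ∂((volume.restrict (Set.Ioi 0)).prod volume)) := by
  obtain ⟨C, hC, hb⟩ := h.exists_timeCoeff_le_div_sq 4
  have hs : Summable fun k : ℤ => ∫ p : ℝ × E3, ‖(kern lam j l β p.1 p.2 : ℂ) *
      (timeCoeff φ k p.2 * fourier (-k) (p.1 : AddCircle T))‖
      ∂((volume.restrict (Set.Ioi 0)).prod volume) := by
    have h1 : Summable fun k : ℤ => C * (1 / (k : ℝ) ^ 2) *
        ∫ p : ℝ × E3, ‖kern lam j l β p.1 p.2 * ((1 + ‖p.2‖) ^ 4)⁻¹‖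
        ∂((volume.restrict (Set.Ioi 0)).prod volume) :=
      (((Real.summable_one_div_int_pow (p := 2)).2 (by norm_num)).mul_left C).mul_right _
    refine h1.of_norm_bounded_eventually ?_
    filter_upwards [(Set.finite_singleton (0 : ℤ)).compl_mem_cofinite] with k hk
    rw [Real.norm_of_nonneg (integral_nonneg fun _ => norm_nonneg _)]
    refine (integrable_kern_mul lam j l hβ (h.aestronglyMeasurable_mode k)
      (C := C * (1 / (k : ℝ) ^ 2)) fun p => ?_).2
    rw [norm_mul, norm_fourier_apply, mul_one]
    exact hb k (by simpa using hk) p.2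
  have h2 := hasSum_integral_of_summable_integral_norm (fun k => h.integrable_mode lam j l hβ k) hs
  have e : ∀ p : ℝ × E3, ∑' k : ℤ, (kern lam j l β p.1 p.2 : ℂ) *
      (timeCoeff φ k p.2 * fourier (-k) (p.1 : AddCircle T))
      = (kern lam j l β p.1 p.2 : ℂ) * φ ((p.1 : AddCircle T), p.2) := fun p => by
    rw [tsum_mul_left, (h.hasSum_timeCoeff (p.1 : AddCircle T) p.2).tsum_eq]
  simp only [e] at h2
  exact h2

/-- For fixed `s` the `x`-integral turns the time coefficient into `dualFourier`, leaving the phase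
`e^{-s(|ξ|² + i(2πk/T - λξ₁))}`. The integral over `s` is then the Laplace integral of the resolvent
symbol. -/
theorem IsSchwartz.modeTerm_eq (h : IsSchwartz φ) (hβ : len β ≤ 1) (k : ℤ) :
    modeTerm lam j l φ β k = (((2 * Real.pi) ^ 3)⁻¹ : ℝ) *
      ∫ ξ, osym j l β ξ * dualFourier φ k ξ / (((‖ξ‖ ^ 2 : ℝ) : ℂ) +
        Complex.I * ((2 * Real.pi / T * k - lam * ξ 0 : ℝ) : ℂ)) := by
  set c : E3 → ℝ := fun ξ => 2 * Real.pi / T * k - lam * ξ 0 with hc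
  have hm : AEStronglyMeasurable (fun ξ => osym j l β ξ * dualFourier φ k ξ) :=
    (osym_symbolBound j l β).measurable.aestronglyMeasurable.mul
      (h.continuous_dualFourier k).aestronglyMeasurable
  have hL := (laplace_fubini hm (c := c) (by fun_prop) 0
    (by simpa using h.integrable_symbol j l hβ k)).2
  simp only [Complex.ofReal_zero, mul_zero, Complex.exp_zero, mul_one] at hL
  rw [modeTerm, integral_prod _ (h.integrable_mode lam j l hβ k), ← hL, ← integral_const_mul]
  refine setIntegral_congr_fun measurableSet_Ioi fun s hs => ?_
  have hs0 : 0 < s := hs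
  simp only [kern_ofReal, waveInt]
  -- At fixed `s > 0` the Gaussian in `ξ` and the decay of the test function in `x` make the double
  -- integral absolutely convergent.
  have hG : Integrable (fun p : E3 × E3 => (osym j l β p.2 *
      Complex.exp (((-(s * ‖p.2‖ ^ 2) : ℝ) : ℂ) + Complex.I * (inner ℝ p.2 (p.1 + s • drift lam) : ℝ)))
      * timeCoeff φ k p.1) (volume.prod volume) := by
    have h1 := (h.integrable_timeCoeff k).mul_prod
      ((osym_symbolBound j l β).integrable hs0 (s • drift lam))
    have h2 : Continuous fun p : E3 × E3 => Complex.exp (Complex.I * (inner ℝ p.2 p.1 : ℝ)) := by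
      fun_prop
    refine (h1.mul_bdd (c := 1) h2.aestronglyMeasurable
      (Eventually.of_forall fun p => (norm_cexp_I_mul_inner _ _).le)).congr
      (Eventually.of_forall fun p => ?_)
    simp only [inner_add_right, Complex.ofReal_add, mul_add, Complex.exp_add]
    ring
  have h3 : ∀ x : E3, ((((2 * Real.pi) ^ 3)⁻¹ : ℝ) : ℂ) * (∫ ξ, osym j l β ξ *
      Complex.exp (((-(s * ‖ξ‖ ^ 2) : ℝ) : ℂ) + Complex.I * (inner ℝ ξ (x + s • drift lam) : ℝ)))
      * (timeCoeff φ k x * fourier (-k) (s : AddCircle T))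
      = ((((2 * Real.pi) ^ 3)⁻¹ : ℝ) : ℂ) * fourier (-k) (s : AddCircle T) * ∫ ξ, (osym j l β ξ *
      Complex.exp (((-(s * ‖ξ‖ ^ 2) : ℝ) : ℂ) + Complex.I * (inner ℝ ξ (x + s • drift lam) : ℝ)))
      * timeCoeff φ k x := by
    intro x
    rw [integral_mul_const]
    ring
  simp only [h3]
  rw [integral_const_mul, mul_assoc, integral_integral_swap hG, ← integral_const_mul]
  congr 2
  funext ξ
  rw [h.dualFourier_eq, ← integral_const_mul, ← integral_const_mul, ← integral_mul_const]
  congr 1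
  funext x
  rw [inner_add_right, inner_smul_right, inner_drift, fourier_coe_apply]
  have : Complex.exp (-(((‖ξ‖ ^ 2 : ℝ) : ℂ) + Complex.I * (c ξ : ℂ)) * s)
      * Complex.exp (Complex.I * (inner ℝ ξ x : ℝ))
      = Complex.exp (2 * Real.pi * Complex.I * ((-k : ℤ) : ℂ) * s / T) *
        Complex.exp (((-(s * ‖ξ‖ ^ 2) : ℝ) : ℂ) +
          Complex.I * ((inner ℝ ξ x + s * (lam * ξ 0) : ℝ) : ℂ)) := by
    rw [← Complex.exp_add, ← Complex.exp_add]
    congr 1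
    simp only [hc]
    push_cast
    ring
  linear_combination (-osym j l β ξ * timeCoeff φ k x) * this

/-- Unfolding turns the periodized sum into the integral over all `s > 0`; the steady kernel does
not depend on time and pairs only with the mode `k = 0`. -/
theorem IsSchwartz.integral_perKernel_mul (h : IsSchwartz φ) (hβ : len β ≤ 1) :
    ∫ p, (perKernel T lam j l β p : ℂ) * φ p ∂(muG T)
      = (∫ p : ℝ × E3, (kern lam j l β p.1 p.2 : ℂ) * φ ((p.1 : AddCircle T), p.2)
          ∂((volume.restrict (Set.Ioi 0)).prod volume)) - modeTerm lam j l φ β 0 := by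
  have hT0 : 0 < T := hT.out
  obtain ⟨C, hC, hb⟩ := h.exists_norm_le 4
  have hg : Integrable (fun p : ℝ × E3 => (kern lam j l β p.1 p.2 : ℂ) *
      φ ((p.1 : AddCircle T), p.2)) ((volume.restrict (Set.Ioi 0)).prod volume) :=
    (integrable_kern_mul lam j l hβ (ψ := fun p => φ ((p.1 : AddCircle T), p.2))
      h.smooth.continuous.aestronglyMeasurable (C := C) fun p => hb _).1
  obtain ⟨-, -, hi, he⟩ := unfold_muG (T := T) hg
  -- The test function is periodic and therefore factors out of the sum over periods.
  have hcoe : ∀ (t : AddCircle T) (n : ℕ), ((tau t + n * T : ℝ) : AddCircle T) = t := by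
    intro t n
    rw [AddCircle.coe_add, coe_tau, ← nsmul_eq_mul, AddCircle.coe_nsmul, AddCircle.coe_period]
    simp
  have e1 : ∀ p : AddCircle T × E3, ∑' n : ℕ, ((kern lam j l β (tau p.1 + n * T) p.2 : ℝ) : ℂ) *
      φ (((tau p.1 + n * T : ℝ) : AddCircle T), p.2)
      = (perSum T (fun s => kern lam j l β s p.2) (tau p.1) : ℝ) * φ p := by
    intro p
    simp only [hcoe, perSum]
    rw [tsum_mul_right, Complex.ofReal_tsum]
  simp only [e1] at hi he
  have hst : Integrable (fun p : AddCircle T × E3 => (steadyKernel lam j l β p.2 : ℂ) * φ p)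
      (muG T) := by
    have hw := integrable_steadyKernel_mul_weight lam j l hβ
    have h2 : Integrable (fun p : AddCircle T × E3 => C *
        ‖steadyKernel lam j l β p.2 * ((1 + ‖p.2‖) ^ 4)⁻¹‖) (muG T) :=
      Integrable.mul_prod (integrable_const C) hw.norm
    have hsm : AEStronglyMeasurable (steadyKernel lam j l β) := by
      have h3 : StronglyMeasurable (Function.uncurry fun (x : E3) (s : ℝ) => kern lam j l β s x) :=
        ((measurable_kern lam j l β).comp measurable_swap).stronglyMeasurable
      exact (h3.integral_prod_right (ν := volume.restrict (Set.Ioi 0))).aestronglyMeasurable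
    refine h2.mono' ((Complex.continuous_ofReal.comp_aestronglyMeasurable
      hsm.comp_snd).mul h.continuous.aestronglyMeasurable) (Eventually.of_forall fun p => ?_)
    rw [norm_mul, Complex.norm_real, norm_mul,
      Real.norm_of_nonneg (by positivity : (0 : ℝ) ≤ ((1 + ‖p.2‖) ^ 4)⁻¹)]
    calc _ ≤ ‖steadyKernel lam j l β p.2‖ * (C * ((1 + ‖p.2‖) ^ 4)⁻¹) := by gcongr; exact hb p
      _ = _ := by ring
  have e2 : ∫ p, (steadyKernel lam j l β p.2 : ℂ) * φ p ∂(muG T) = modeTerm lam j l φ β 0 := by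
    rw [modeTerm, integral_prod_symm _ (h.integrable_mode lam j l hβ 0), muG,
      integral_prod_symm _ hst]
    congr 1
    funext x
    simp only [neg_zero, fourier_zero, mul_one]
    rw [integral_const_mul, integral_mul_const, steadyKernel, integral_complex_ofReal]
    simp only [timeCoeff, fourier_zero, mul_one]
  have e3 : ∀ p : AddCircle T × E3, (perKernel T lam j l β p : ℂ) * φ p
      = (T : ℂ) * ((perSum T (fun s => kern lam j l β s p.2) (tau p.1) : ℝ) * φ p)
        - (steadyKernel lam j l β p.2 : ℂ) * φ p := by
    intro p
    simp only [perKernel, perFluct, steadyKernel]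
    push_cast
    ring
  simp only [e3]
  rw [integral_sub (hi.const_mul _) hst, integral_const_mul, he, e2, Complex.real_smul,
    Complex.ofReal_inv, mul_inv_cancel_left₀ (by exact_mod_cast hT0.ne')]

theorem isFunction_perKernel (hβ : len β ≤ 1) :
    IsFunction (distDeriv β (GammaPerp T lam j l)) (perKernel T lam j l β) where
  locallyIntegrable := locallyIntegrable_perKernel T lam j l hβ
  slice_integrable _ hx := slice_integrable_perKernel T lam j l β hx
  slice_continuous _ hx := slice_continuous_perKernel T lam j l β hx
  pairing φ h := by
    obtain ⟨C, hC, hb⟩ := h.exists_norm_le 4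
    refine ⟨integrable_perKernel_mul T lam j l hβ h.continuous.aestronglyMeasurable hb, ?_⟩
    rw [h.integral_perKernel_mul lam j l hβ, distDeriv, GammaPerp, invFourierDist]
    simp only [h.dualFourier_mpd hβ]
    -- Removing the mode `0` from the series is the factor `1 - δ_ℤ(k)` in the symbol.
    have hsum := (h.hasSum_modeTerm lam j l hβ).sub
      (hasSum_ite_eq (0 : ℤ) (modeTerm lam j l φ β 0))
    rw [← hsum.tsum_eq, ← tsum_mul_left, ← tsum_mul_left]
    congr 1
    funext k
    have e : ∀ ξ, symbolPerp T lam j l k ξ * ((-1) ^ len β * mon β ξ * dualFourier φ k ξ)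
        = ((-1) ^ len β * (1 - if k = 0 then 1 else 0)) * (osym j l β ξ * dualFourier φ k ξ /
          (((‖ξ‖ ^ 2 : ℝ) : ℂ) + Complex.I * ((2 * Real.pi / T * k - lam * ξ 0 : ℝ) : ℂ))) := by
      intro ξ
      rw [symbolPerp, osym]
      ring
    simp only [e]
    rw [integral_const_mul]
    -- The sign in the distributional derivative cancels the one from integration by parts.
    have hone : ((-1 : ℂ) ^ len β) * (-1) ^ len β = 1 := by rw [← mul_pow]; simp
    by_cases hk : k = 0
    · simp [hk]
    · rw [h.modeTerm_eq lam j l hβ k]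
      simp only [hk, if_false, sub_zero, mul_one]
      linear_combination -((((2 * Real.pi) ^ 3)⁻¹ : ℝ) * ∫ ξ, osym j l β ξ * dualFourier φ k ξ /
        (((‖ξ‖ ^ 2 : ℝ) : ℂ) + Complex.I * ((2 * Real.pi / T * k - lam * ξ 0 : ℝ) : ℂ))) * hone

end Pairing

/-! ### Uniqueness of the slices of a representing function -/

section Uniqueness

variable {T : ℝ} [hT : Fact (0 < T)]

theorem isSchwartz_of_smoothOnG {φ : AddCircle T × E3 → ℂ} (hs : SmoothOnG φ) {S : Set E3}
    (hS : IsCompact S) (h0 : ∀ t x, x ∉ S → φ (t, x) = 0) : IsSchwartz φ := by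
  refine ⟨hs, fun N n => ?_⟩
  have hc : Continuous fun p : ℝ × E3 => ‖p.2‖ ^ N * ‖iteratedFDeriv ℝ n (lift φ) p‖ :=
    ((continuous_norm.comp continuous_snd).pow N).mul
      (hs.continuous_iteratedFDeriv (m := n) (by exact_mod_cast le_top)).norm
  obtain ⟨C, hC⟩ := ((isCompact_Icc (a := (0 : ℝ)) (b := T)).prod hS).exists_bound_of_continuousOn
    hc.continuousOn
  have hC0 : 0 ≤ max C 0 := le_max_right _ _
  refine ⟨max C 0, fun p => ?_⟩
  by_cases hp : p.2 ∈ S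
  · have hper : (fun q : ℝ × E3 => lift φ (q + (tau (p.1 : AddCircle T) - p.1, 0))) = lift φ := by
      funext q
      simp [lift, coe_tau]
    have h1 := iteratedFDeriv_comp_add_right (𝕜 := ℝ) (f := lift φ) n
      ((tau (p.1 : AddCircle T) - p.1, 0) : ℝ × E3) p
    rw [hper] at h1
    have h2 : p + ((tau (p.1 : AddCircle T) - p.1, 0) : ℝ × E3) = (tau (p.1 : AddCircle T), p.2) := by
      ext <;> simp
    rw [h2] at h1
    rw [h1]
    have h3 := hC (tau (p.1 : AddCircle T), p.2) 
      ⟨⟨(tau_pos (p.1 : AddCircle T)).le, tau_le (p.1 : AddCircle T)⟩, hp⟩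
    rw [Real.norm_of_nonneg (by positivity)] at h3
    exact h3.trans (le_max_left _ _)
  · have h1 : p ∉ tsupport (lift φ) := by
      have hsub : tsupport (lift φ) ⊆ Prod.snd ⁻¹' S := by
        refine closure_minimal (fun q hq => ?_) (hS.isClosed.preimage continuous_snd)
        by_contra hq'
        exact hq (h0 _ _ hq')
      exact fun h => hp (hsub h)
    have h2 : iteratedFDeriv ℝ n (lift φ) p = 0 := by
      by_contra h
      exact h1 (support_iteratedFDeriv_subset n h)
    rw [h2]
    simp

theorem isSchwartz_fourier_mul (k : ℤ) {ψ : E3 → ℝ} (hψ : ContDiff ℝ ∞ ψ)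
    (hc : HasCompactSupport ψ) :
    IsSchwartz fun p : AddCircle T × E3 => (ψ p.2 : ℂ) * fourier k p.1 := by
  refine isSchwartz_of_smoothOnG ?_ hc fun t x hx => ?_
  · have e : lift (fun p : AddCircle T × E3 => (ψ p.2 : ℂ) * fourier k p.1)
        = fun p : ℝ × E3 => (ψ p.2 : ℂ) * Complex.exp (2 * Real.pi * Complex.I * k * (p.1 : ℂ) / T) := by
      funext p
      simp only [lift, fourier_coe_apply]
    unfold SmoothOnG
    rw [e]
    have h1 : ContDiff ℝ ∞ fun p : ℝ × E3 => (ψ p.2 : ℂ) :=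
      Complex.ofRealCLM.contDiff.comp (hψ.comp contDiff_snd)
    have h2 : ContDiff ℝ ∞ fun p : ℝ × E3 => (p.1 : ℂ) := Complex.ofRealCLM.contDiff.comp contDiff_fst
    exact h1.mul (((contDiff_const.mul h2).div_const _).cexp)
  · simp [image_eq_zero_of_notMem_tsupport hx]

/-- Trigonometric polynomials are dense in the continuous functions, so the integral of `D` against
every continuous function vanishes. Thickened indicators then reach closed sets, and these determine
an integrable function. -/
theorem ae_eq_zero_of_fourierCoeff_eq_zero {D : AddCircle T → ℝ} (hD : Integrable D (muT T))
    (h : ∀ k : ℤ, ∫ t, (D t : ℂ) * fourier k t ∂(muT T) = 0) : D =ᵐ[muT T] 0 := by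
  have hDc : Integrable (fun t => (D t : ℂ)) (muT T) := hD.ofReal
  have hint : ∀ g : C(AddCircle T, ℂ), Integrable (fun t => (D t : ℂ) * g t) (muT T) := fun g =>
    hDc.mul_bdd (c := ‖g‖) (map_continuous g).aestronglyMeasurable
      (Eventually.of_forall fun t => g.norm_coe_le_norm t)
  let Λ₀ : C(AddCircle T, ℂ) →ₗ[ℂ] ℂ :=
    { toFun := fun g => ∫ t, (D t : ℂ) * g t ∂(muT T)
      map_add' := fun g g' => by
        simp only [ContinuousMap.add_apply, mul_add]
        exact integral_add (hint g) (hint g')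
      map_smul' := fun c g => by
        simp only [ContinuousMap.smul_apply, smul_eq_mul, RingHom.id_apply]
        rw [← integral_const_mul]
        congr 1
        funext t
        ring }
  let Λ : C(AddCircle T, ℂ) →L[ℂ] ℂ := Λ₀.mkContinuous (∫ t, ‖(D t : ℂ)‖ ∂(muT T)) fun g => by
    calc ‖∫ t, (D t : ℂ) * g t ∂(muT T)‖ ≤ ∫ t, ‖(D t : ℂ) * g t‖ ∂(muT T) :=
          norm_integral_le_integral_norm _
      _ ≤ ∫ t, ‖(D t : ℂ)‖ * ‖g‖ ∂(muT T) := by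
          refine integral_mono (hint g).norm (hDc.norm.mul_const _) fun t => ?_
          simp only [norm_mul]
          gcongr
          exact g.norm_coe_le_norm t
      _ = _ := integral_mul_const _ _
  have hker : (Submodule.span ℂ (Set.range (fourier (T := T)))).topologicalClosure
      ≤ LinearMap.ker (Λ : C(AddCircle T, ℂ) →ₗ[ℂ] ℂ) := by
    refine Submodule.topologicalClosure_minimal _ (Submodule.span_le.2 ?_) Λ.isClosed_ker
    rintro _ ⟨k, rfl⟩
    exact h k
  have hΛ : ∀ g : C(AddCircle T, ℂ), ∫ t, (D t : ℂ) * g t ∂(muT T) = 0 := fun g => by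
    have : g ∈ (Submodule.span ℂ (Set.range (fourier (T := T)))).topologicalClosure := by
      rw [span_fourier_closure_eq_top]; trivial
    exact hker this
  have hΛr : ∀ g : C(AddCircle T, ℝ), ∫ t, g t * D t ∂(muT T) = 0 := fun g => by
    have h1 := hΛ ⟨fun t => (g t : ℂ), Complex.continuous_ofReal.comp (map_continuous g)⟩
    simp only [ContinuousMap.coe_mk, ← Complex.ofReal_mul] at h1
    rw [integral_complex_ofReal] at h1
    simp only [mul_comm (g _)]
    exact_mod_cast h1
  refine ae_eq_zero_of_forall_setIntegral_isClosed_eq_zero hD fun s hs => ?_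
  set δ : ℕ → ℝ := fun n => 1 / ((n : ℝ) + 1) with hδ
  have δpos : ∀ n, 0 < δ n := fun n => by positivity
  have δlim : Tendsto δ atTop (𝓝 0) := tendsto_one_div_add_atTop_nhds_zero_nat
  have hlim := thickenedIndicator_tendsto_indicator_closure δpos δlim s
  rw [hs.closure_eq, tendsto_pi_nhds] at hlim
  have L : Tendsto (fun n => ∫ t, (thickenedIndicator (δpos n) s t : ℝ) * D t ∂(muT T)) atTop
      (𝓝 (∫ t, s.indicator D t ∂(muT T))) := by
    refine tendsto_integral_of_dominated_convergence (fun t => ‖D t‖) (fun n => ?_) hD.norm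
      (fun n => Eventually.of_forall fun t => ?_) (Eventually.of_forall fun t => ?_)
    · exact (NNReal.continuous_coe.comp
        (map_continuous (thickenedIndicator (δpos n) s))).aestronglyMeasurable.mul hD.1
    · rw [norm_mul, Real.norm_of_nonneg (NNReal.coe_nonneg _)]
      refine mul_le_of_le_one_left (norm_nonneg _) ?_
      exact_mod_cast thickenedIndicator_le_one (δpos n) s t
    · have h1 := ((NNReal.continuous_coe.tendsto _).comp (hlim t)).mul_const (D t)
      refine h1.congr' (Eventually.of_forall fun n => rfl) |>.trans (le_of_eq ?_)
      by_cases ht : t ∈ s <;> simp [ht]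
  rw [integral_indicator hs.measurableSet] at L
  have hz : ∀ n, ∫ t, (thickenedIndicator (δpos n) s t : ℝ) * D t ∂(muT T) = 0 := fun n =>
    hΛr ⟨fun t => (thickenedIndicator (δpos n) s t : ℝ), NNReal.continuous_coe.comp
        (map_continuous (thickenedIndicator (δpos n) s))⟩
  simp only [hz] at L
  exact (tendsto_nhds_unique L tendsto_const_nhds)

/-- The slices of a function representing a distribution are determined by the distribution. -/
theorem IsFunction.slice_ae_eq {u : (AddCircle T × E3 → ℂ) → ℂ} {K K' : AddCircle T × E3 → ℝ}
    (hK : IsFunction u K) (hK' : IsFunction u K') {x : E3} (hx : x ≠ 0) :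
    (fun t => K (t, x)) =ᵐ[muT T] fun t => K' (t, x) := by
  set D : AddCircle T × E3 → ℝ := fun p => K p - K' p with hDdef
  have hDl : LocallyIntegrable D (muG T) := hK.locallyIntegrable.sub hK'.locallyIntegrable
  have hDx : ∀ {x}, x ≠ 0 → Integrable (fun t => D (t, x)) (muT T) := fun hx =>
    (hK.slice_integrable _ hx).sub (hK'.slice_integrable _ hx)
  suffices hcoef : ∀ k : ℤ, ∀ x : E3, x ≠ 0 → ∫ t, (D (t, x) : ℂ) * fourier k t ∂(muT T) = 0 by
    have := ae_eq_zero_of_fourierCoeff_eq_zero (hDx hx) fun k => hcoef k x hx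
    filter_upwards [this] with t ht
    exact sub_eq_zero.1 ht
  intro k
  -- For fixed `k` the time coefficient of the difference is a function of `x` alone: continuous off
  -- the origin by continuity of the slices in `L¹`, and zero almost everywhere. Hence it vanishes
  -- at every `x ≠ 0`.
  set c : E3 → ℂ := fun x => ∫ t, (D (t, x) : ℂ) * fourier k t ∂(muT T) with hcdef
  have hmul : ∀ {x}, x ≠ 0 → Integrable (fun t => (D (t, x) : ℂ) * fourier k t) (muT T) :=
    fun hx => (hDx hx).ofReal.mul_bdd (c := 1) (map_continuous (fourier k)).aestronglyMeasurable
      (Eventually.of_forall fun t => (norm_fourier_apply k t).le)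
  have hcont : ContinuousOn c {0}ᶜ := by
    intro x hx
    have hx0 : x ≠ 0 := hx
    refine ContinuousAt.continuousWithinAt ?_
    rw [ContinuousAt, tendsto_iff_norm_sub_tendsto_zero]
    have hlim := (hK.slice_continuous x hx0).add (hK'.slice_continuous x hx0)
    rw [add_zero] at hlim
    refine squeeze_zero' (Eventually.of_forall fun _ => norm_nonneg _) ?_ hlim
    filter_upwards [isOpen_compl_singleton.mem_nhds hx0] with x' hx'
    have hx'0 : x' ≠ 0 := hx'
    have i1 := ((hK.slice_integrable _ hx'0).sub (hK.slice_integrable _ hx0)).abs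
    have i2 := ((hK'.slice_integrable _ hx'0).sub (hK'.slice_integrable _ hx0)).abs
    simp only [Pi.sub_apply] at i1 i2
    rw [hcdef]
    simp only
    rw [← integral_sub (hmul hx'0) (hmul hx0), ← integral_add i1 i2]
    refine norm_integral_le_of_norm_le (i1.add i2) (Eventually.of_forall fun t => ?_)
    rw [← sub_mul, norm_mul, norm_fourier_apply, mul_one, ← Complex.ofReal_sub, Complex.norm_real,
      Real.norm_eq_abs]
    simp only [hDdef]
    rw [show K (t, x') - K' (t, x') - (K (t, x) - K' (t, x))
      = (K (t, x') - K (t, x)) - (K' (t, x') - K' (t, x)) by ring]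
    exact abs_sub _ _
  have hloc : LocallyIntegrable c := by
    rw [locallyIntegrable_iff]
    intro S hS
    have h1 : IntegrableOn D (Set.univ ×ˢ S) (muG T) :=
      hDl.integrableOn_isCompact (isCompact_univ.prod hS)
    rw [IntegrableOn, muG, ← Measure.prod_restrict, Measure.restrict_univ] at h1
    have h2 : Integrable (fun p : AddCircle T × E3 => (D p : ℂ) * fourier k p.1)
        ((muT T).prod (volume.restrict S)) :=
      h1.ofReal.mul_bdd (c := 1)
        ((map_continuous (fourier k)).comp continuous_fst).aestronglyMeasurable
        (Eventually.of_forall fun t => (norm_fourier_apply k t.1).le)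
    exact h2.integral_prod_right
  have hzero : ∀ᵐ x : E3, c x = 0 := by
    -- The test functions `ψ(x) e^{i(2π/T)kt}` isolate the coefficient of index `k`.
    refine ae_eq_zero_of_integral_contDiff_smul_eq_zero hloc fun ψ hψ hψc => ?_
    have hφ := isSchwartz_fourier_mul (T := T) k hψ hψc
    obtain ⟨i1, e1⟩ := hK.pairing _ hφ
    obtain ⟨i2, e2⟩ := hK'.pairing _ hφ
    have h3 : ∫ p, ((D p : ℂ) * ((ψ p.2 : ℂ) * fourier k p.1)) ∂(muG T) = 0 := by
      simp only [hDdef, Complex.ofReal_sub, sub_mul]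
      rw [integral_sub i1 i2, e1, e2, sub_self]
    have i3 : Integrable (fun p : AddCircle T × E3 =>
        (D p : ℂ) * ((ψ p.2 : ℂ) * fourier k p.1)) (muG T) := by
      simp only [hDdef, Complex.ofReal_sub, sub_mul]
      exact i1.sub i2
    rw [muG, integral_prod_symm _ i3] at h3
    rw [← h3]
    congr 1
    funext x
    rw [hcdef]
    simp only [Complex.real_smul]
    rw [← integral_const_mul]
    congr 1
    funext t
    ring
  have heq := Measure.eqOn_open_of_ae_eq (μ := (volume : Measure E3)) (f := c) (g := fun _ => 0)
    (U := {0}ᶜ) (ae_restrict_of_ae hzero) isOpen_compl_singleton hcont continuousOn_const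
  exact fun x hx => heq hx

end Uniqueness

/-! ### Elementary bounds, and the data `f` with its steady part -/

theorem norm_toLp_sum_le {a : Fin 3 → Fin 3 → ℝ} {B : ℝ} (h : ∀ j l, |a j l| ≤ B) :
    ‖(WithLp.toLp 2 fun j => ∑ l, a j l : E3)‖ ≤ 9 * B := by
  have hB : 0 ≤ B := (abs_nonneg _).trans (h 0 0)
  have h1 : ∀ j, |∑ l, a j l| ≤ 3 * B := fun j =>
    (Finset.abs_sum_le_sum_abs _ _).trans
      ((Finset.sum_le_card_nsmul _ _ B fun l _ => h j l).trans (by simp))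
  rw [EuclideanSpace.norm_eq, Real.sqrt_le_left (by positivity)]
  calc ∑ j, ‖∑ l, a j l‖ ^ 2 ≤ ∑ _j : Fin 3, (3 * B) ^ 2 :=
        Finset.sum_le_sum fun j _ => pow_le_pow_left₀ (norm_nonneg _) (h1 j) 2
    _ = 27 * B ^ 2 := by simp; ring
    _ ≤ _ := by nlinarith [sq_nonneg B]

theorem abs_integral_le_of_support {X : Type*} [MeasurableSpace X] {μ : Measure X} {F : X → ℝ}
    {S : Set X} {B : ℝ} (hS : μ S < ⊤) (h0 : ∀ q, q ∉ S → F q = 0)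
    (hB : ∀ q ∈ S, |F q| ≤ B) : |∫ q, F q ∂μ| ≤ B * μ.real S := by
  rw [← setIntegral_eq_integral_of_forall_compl_eq_zero h0]
  exact norm_setIntegral_le_of_norm_le_const hS (f := F) hB

theorem le_sum_sum {C : Fin 3 → Fin 3 → ℝ} (hC : ∀ j l, 0 ≤ C j l) (j l : Fin 3) :
    C j l ≤ ∑ j, ∑ l, C j l :=
  (Finset.single_le_sum (f := fun l => C j l) (fun l _ => hC j l) (Finset.mem_univ l)).trans
    (Finset.single_le_sum (f := fun j => ∑ l, C j l)
      (fun j _ => Finset.sum_nonneg fun l _ => hC j l) (Finset.mem_univ j))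

section Data

variable {T : ℝ} [hT : Fact (0 < T)] {f : AddCircle T × E3 → E3} {R₀ : ℝ}

theorem eq_zero_of_tsupport_subset (hsupp : tsupport f ⊆ Set.univ ×ˢ Metric.ball (0 : E3) R₀)
    (t : AddCircle T) {x : E3} (hx : R₀ ≤ ‖x‖) : f (t, x) = 0 := by
  refine image_eq_zero_of_notMem_tsupport fun h => ?_
  have := (hsupp h).2
  rw [mem_ball_zero_iff] at this
  exact absurd hx (not_le.2 this)

theorem exists_norm_le_of_hasCompactSupport (hf : Continuous f) (hfc : HasCompactSupport f) :
    ∃ M : ℝ, 0 ≤ M ∧ ∀ p, ‖f p‖ ≤ M := by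
  obtain ⟨C, hC⟩ := hfc.exists_bound_of_continuous hf
  exact ⟨max C 0, le_max_right _ _, fun p => (hC p).trans (le_max_left _ _)⟩

theorem norm_steady_le {M : ℝ} (hb : ∀ p, ‖f p‖ ≤ M) (x : E3) : ‖steady f x‖ ≤ M := by
  have := norm_integral_le_of_norm_le_const (μ := muT T) (f := fun t => f (t, x))
    (C := M) (Eventually.of_forall fun t => hb (t, x))
  rwa [probReal_univ, mul_one] at this

theorem continuous_steady (hf : Continuous f) {M : ℝ} (hb : ∀ p, ‖f p‖ ≤ M) :
    Continuous (steady f) :=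
  continuous_of_dominated (bound := fun _ => M)
    (fun x => (hf.comp (by fun_prop : Continuous fun t : AddCircle T => (t, x))).aestronglyMeasurable)
    (fun x => Eventually.of_forall fun t => hb (t, x)) (integrable_const M)
    (Eventually.of_forall fun t => hf.comp (by fun_prop))

theorem steady_eq_zero (h0 : ∀ t x, R₀ ≤ ‖x‖ → f (t, x) = 0) {x : E3} (hx : R₀ ≤ ‖x‖) :
    steady f x = 0 := by
  simp [steady, h0 _ x hx]

end Data

/-! ### Convolution with the time-periodic kernel -/

section Convolution

variable {T : ℝ} [hT : Fact (0 < T)] (lam : ℝ) {α : Fin 3 → ℕ}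
  {g : AddCircle T × E3 → E3} {M R₀ : ℝ}

theorem abs_apply_le_norm (v : E3) (l : Fin 3) : |v l| ≤ ‖v‖ := PiLp.norm_apply_le v l

theorem measurePreserving_sub_left_muT (t : AddCircle T) :
    MeasurePreserving (fun s => t - s) (muT T) (muT T) :=
  Measure.measurePreserving_sub_left (muT T) t

theorem measurePreserving_sub_left_muG (p : AddCircle T × E3) :
    MeasurePreserving (fun q => p - q) (muG T) (muG T) :=
  (measurePreserving_sub_left_muT p.1).prod (Measure.measurePreserving_sub_left volume p.2)

/-- On the support of `g` one has `1 + ‖x - y‖ ≤ 1 + ‖x‖ + R₀`, so the weight under which the kernel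
is integrable may be inserted at a cost that is bounded for bounded `x`. -/
theorem integrable_perKernel_conv (hα : len α ≤ 1) (j l : Fin 3) (hgc : Continuous g)
    (hM : ∀ p, ‖g p‖ ≤ M) (hR : 0 < R₀) (h0 : ∀ t x, R₀ ≤ ‖x‖ → g (t, x) = 0)
    (p : AddCircle T × E3) :
    Integrable (fun q => perKernel T lam j l α (p - q) * g q l) (muG T) ∧
    |∫ q, perKernel T lam j l α (p - q) * g q l ∂(muG T)| ≤ M * (1 + ‖p.2‖ + R₀) ^ 4 *
      ∫ q, |perKernel T lam j l α q * ((1 + ‖q.2‖) ^ 4)⁻¹| ∂(muG T) := by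
  have hM0 : 0 ≤ M := (norm_nonneg _).trans (hM 0)
  have hw := (integrable_perKernel_mul_weight T lam j l hα).abs
  have hmp := measurePreserving_sub_left_muG p
  have hw' := hmp.integrable_comp_of_integrable hw
  have hme : MeasurableEmbedding fun q : AddCircle T × E3 => p - q :=
    (MeasurableEquiv.subLeft p).measurableEmbedding
  have hle : ∀ q, ‖perKernel T lam j l α (p - q) * g q l‖ ≤ M * (1 + ‖p.2‖ + R₀) ^ 4 *
      |perKernel T lam j l α (p - q) * ((1 + ‖(p - q).2‖) ^ 4)⁻¹| := by
    rintro ⟨s, y⟩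
    by_cases hy : R₀ ≤ ‖y‖
    · rw [h0 s y hy]; simp only [PiLp.zero_apply, mul_zero, norm_zero]; positivity
    · rw [norm_mul, Real.norm_eq_abs, Real.norm_eq_abs, abs_mul,
        abs_of_nonneg (by positivity : (0 : ℝ) ≤ ((1 + ‖(p - (s, y)).2‖) ^ 4)⁻¹)]
      have h1 : |g (s, y) l| ≤ M := (abs_apply_le_norm _ l).trans (hM _)
      have h2 : 1 ≤ (1 + ‖p.2‖ + R₀) ^ 4 * ((1 + ‖(p - (s, y)).2‖) ^ 4)⁻¹ := by
        rw [← div_eq_mul_inv, one_le_div (by positivity)]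
        refine pow_le_pow_left₀ (by positivity) ?_ 4
        have : ‖p.2 - y‖ ≤ ‖p.2‖ + ‖y‖ := norm_sub_le _ _
        simp only [Prod.snd_sub]
        linarith
      calc _ ≤ |perKernel T lam j l α (p - (s, y))| * M := by gcongr
        _ ≤ |perKernel T lam j l α (p - (s, y))| * M *
            ((1 + ‖p.2‖ + R₀) ^ 4 * ((1 + ‖(p - (s, y)).2‖) ^ 4)⁻¹) :=
            le_mul_of_one_le_right (by positivity) h2
        _ = _ := by ring
  have hm : AEStronglyMeasurable (fun q => perKernel T lam j l α (p - q) * g q l) (muG T) :=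
    ((aestronglyMeasurable_perKernel T lam j l hα).comp_measurePreserving hmp).mul
      ((EuclideanSpace.proj (𝕜 := ℝ) l).continuous.comp hgc).aestronglyMeasurable
  refine ⟨(hw'.const_mul _).mono' hm (Eventually.of_forall hle), ?_⟩
  refine (norm_integral_le_of_norm_le (hw'.const_mul _) (Eventually.of_forall hle)).trans
    (le_of_eq ?_)
  rw [integral_const_mul]
  congr 1
  exact hmp.integral_comp hme fun q => |perKernel T lam j l α q * ((1 + ‖q.2‖) ^ 4)⁻¹|

theorem muG_univ_prod_ball_lt_top (R₀ : ℝ) :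
    (muG T) (Set.univ ×ˢ Metric.ball (0 : E3) R₀) < ⊤ := by
  rw [muG, Measure.prod_prod, measure_univ, one_mul]
  exact measure_ball_lt_top

/-- Decay of the time-periodic convolution. -/
theorem exists_convG_perKernel_le (hα : len α ≤ 1) (hgc : Continuous g)
    (hM : ∀ p, ‖g p‖ ≤ M) (hR : 0 < R₀) (h0 : ∀ t x, R₀ ≤ ‖x‖ → g (t, x) = 0) (j l : Fin 3) :
    ∃ C : ℝ, 0 ≤ C ∧ ∀ (t : AddCircle T) (x : E3),
      |∫ q, perKernel T lam j l α ((t, x) - q) * g q l ∂(muG T)|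
        ≤ C * (1 + ‖x‖) ^ (-3 - (len α : ℝ)) := by
  have hM0 : 0 ≤ M := (norm_nonneg _).trans (hM 0)
  obtain ⟨C, hC, hb⟩ := exists_perKernel_le T lam j l α hR
  set V := (muG T).real (Set.univ ×ˢ Metric.ball (0 : E3) R₀)
  set W := ∫ q, |perKernel T lam j l α q * ((1 + ‖q.2‖) ^ 4)⁻¹| ∂(muG T) with hW
  have hW0 : 0 ≤ W := integral_nonneg fun _ => abs_nonneg _
  set n := 3 + len α with hn
  have hrpow : ∀ x : E3, (1 + ‖x‖) ^ (-3 - (len α : ℝ)) = ((1 + ‖x‖) ^ n)⁻¹ := by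
    intro x
    rw [← Real.rpow_natCast, ← Real.rpow_neg (by positivity), hn]
    congr 1
    push_cast
    ring
  refine ⟨M * (1 + 2 * R₀ + R₀) ^ 4 * W * (1 + 2 * R₀) ^ n +
    C * M * V * (2 * ((1 + 2 * R₀) / (2 * R₀))) ^ n, by positivity, fun t x => ?_⟩
  rw [hrpow]
  -- Near the support only boundedness is needed. For `‖x‖ ≥ 2R₀`, all points `x - y` have norm at
  -- least `‖x‖ / 2 ≥ R₀`, and the pointwise decay of the kernel applies.
  rcases lt_or_ge ‖x‖ (2 * R₀) with hx | hx
  · refine ((integrable_perKernel_conv lam hα j l hgc hM hR h0 (t, x)).2).trans ?_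
    calc M * (1 + ‖x‖ + R₀) ^ 4 * W ≤ M * (1 + 2 * R₀ + R₀) ^ 4 * W := by gcongr
      _ ≤ M * (1 + 2 * R₀ + R₀) ^ 4 * W * ((1 + 2 * R₀) ^ n * ((1 + ‖x‖) ^ n)⁻¹) := by
          refine le_mul_of_one_le_right (by positivity) ?_
          rw [← div_eq_mul_inv, one_le_div (by positivity)]
          gcongr
      _ = M * (1 + 2 * R₀ + R₀) ^ 4 * W * (1 + 2 * R₀) ^ n * ((1 + ‖x‖) ^ n)⁻¹ := by ring
      _ ≤ _ := by gcongr; exact le_add_of_nonneg_right (by positivity)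
  · have hx0 : 0 < ‖x‖ := by linarith
    have h1 : |∫ q, perKernel T lam j l α ((t, x) - q) * g q l ∂(muG T)|
        ≤ (C / (‖x‖ / 2) ^ n * M) * V := by
      refine abs_integral_le_of_support (muG_univ_prod_ball_lt_top R₀) (fun q hq => ?_)
        fun q hq => ?_
      · obtain ⟨s, y⟩ := q
        have : R₀ ≤ ‖y‖ := by simpa using hq
        simp [h0 s y this]
      · obtain ⟨s, y⟩ := q
        have hy : ‖y‖ < R₀ := by simpa using hq
        have h3 : ‖x‖ / 2 ≤ ‖x - y‖ := by
          have := norm_sub_norm_le x y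
          linarith
        rw [abs_mul]
        refine mul_le_mul ?_ ((abs_apply_le_norm _ l).trans (hM _)) (abs_nonneg _) (by positivity)
        refine (hb (t - s) (x - y) (by linarith)).trans ?_
        gcongr
    refine h1.trans ?_
    have h2 : (1 + ‖x‖) / 2 ≤ (1 + 2 * R₀) / (2 * R₀) * (‖x‖ / 2) := by
      rw [div_mul_eq_mul_div, le_div_iff₀ (by positivity)]
      nlinarith
    have h4 : 1 / (‖x‖ / 2) ^ n ≤ (2 * ((1 + 2 * R₀) / (2 * R₀))) ^ n * ((1 + ‖x‖) ^ n)⁻¹ := by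
      rw [← div_eq_mul_inv, div_le_div_iff₀ (by positivity) (by positivity), one_mul, ← mul_pow]
      refine pow_le_pow_left₀ (by positivity) ?_ n
      linarith
    calc C / (‖x‖ / 2) ^ n * M * V = C * M * V * (1 / (‖x‖ / 2) ^ n) := by ring
      _ ≤ C * M * V * ((2 * ((1 + 2 * R₀) / (2 * R₀))) ^ n * ((1 + ‖x‖) ^ n)⁻¹) := by gcongr
      _ = C * M * V * (2 * ((1 + 2 * R₀) / (2 * R₀))) ^ n * ((1 + ‖x‖) ^ n)⁻¹ := by ring
      _ ≤ _ := by gcongr; exact le_add_of_nonneg_left (by positivity)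

theorem integrable_space_of_support (hgc : Continuous g) (h0 : ∀ t x, R₀ ≤ ‖x‖ → g (t, x) = 0)
    (s : AddCircle T) : Integrable fun y => g (s, y) := by
  refine (hgc.comp (by fun_prop : Continuous fun y : E3 => (s, y))).integrable_of_hasCompactSupport ?_
  refine HasCompactSupport.intro (isCompact_closedBall (0 : E3) R₀) fun y hy => h0 s y ?_
  rw [mem_closedBall_zero_iff, not_le] at hy
  exact hy.le

theorem integral_apply_eq (hgc : Continuous g) (h0 : ∀ t x, R₀ ≤ ‖x‖ → g (t, x) = 0)
    (s : AddCircle T) (l : Fin 3) : (∫ y, g (s, y)) l = ∫ y, g (s, y) l :=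
  ((EuclideanSpace.proj (𝕜 := ℝ) l).integral_comp_comm
    (integrable_space_of_support hgc h0 s)).symm

theorem integrable_slice_mul (hgc : Continuous g) (hM : ∀ p, ‖g p‖ ≤ M)
    (h0 : ∀ t x, R₀ ≤ ‖x‖ → g (t, x) = 0) {k : AddCircle T → ℝ} (hk : Integrable k (muT T))
    (t : AddCircle T) (l : Fin 3) :
    Integrable (fun q => k (t - q.1) * g q l) (muG T) := by
  have hk' := (measurePreserving_sub_left_muT t).integrable_comp_of_integrable hk
  have hb : Integrable ((Metric.closedBall (0 : E3) R₀).indicator fun _ => M) :=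
    (integrable_indicator_iff measurableSet_closedBall).2
      (integrableOn_const measure_closedBall_lt_top.ne)
  refine (hk'.norm.mul_prod hb).mono' (hk'.1.comp_fst.mul
    ((EuclideanSpace.proj (𝕜 := ℝ) l).continuous.comp hgc).aestronglyMeasurable)
    (Eventually.of_forall fun q => ?_)
  obtain ⟨s, y⟩ := q
  rw [norm_mul]
  simp only [Function.comp]
  refine mul_le_mul_of_nonneg_left ?_ (norm_nonneg _)
  by_cases hy : y ∈ Metric.closedBall (0 : E3) R₀
  · rw [Set.indicator_of_mem hy]
    exact (abs_apply_le_norm _ l).trans (hM _)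
  · rw [Set.indicator_of_notMem hy, h0 s y (by
      rw [mem_closedBall_zero_iff, not_le] at hy; exact hy.le)]
    simp

/-- Written as an integral over `G`, the leading term can be subtracted from the full convolution
under one integral sign. -/
theorem convT_term (hgc : Continuous g) (hM : ∀ p, ‖g p‖ ≤ M)
    (h0 : ∀ t x, R₀ ≤ ‖x‖ → g (t, x) = 0) {k : AddCircle T → ℝ} (hk : Integrable k (muT T))
    (t : AddCircle T) (l : Fin 3) :
    Integrable (fun s => k (t - s) * (∫ y, g (s, y)) l) (muT T) ∧
    ∫ s, k (t - s) * (∫ y, g (s, y)) l ∂(muT T) = ∫ q, k (t - q.1) * g q l ∂(muG T) := by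
  have hi := integrable_slice_mul hgc hM h0 hk t l
  have e : ∀ s, ∫ y, k (t - s) * g (s, y) l = k (t - s) * (∫ y, g (s, y)) l := fun s => by
    rw [integral_const_mul, integral_apply_eq hgc h0]
  constructor
  · have := hi.integral_prod_left
    simp only [e] at this
    exact this
  · rw [muG, integral_prod _ hi]
    simp only [e]

/-- The leading term of the time-periodic convolution. -/
theorem exists_convG_sub_convT_perKernel_le (hα : len α ≤ 1) (hgc : Continuous g)
    (hM : ∀ p, ‖g p‖ ≤ M) (hR : 0 < R₀) (h0 : ∀ t x, R₀ ≤ ‖x‖ → g (t, x) = 0) (j l : Fin 3) :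
    ∃ C : ℝ, 0 ≤ C ∧ ∀ (t : AddCircle T) (x : E3), 2 * R₀ ≤ ‖x‖ →
      |(∫ q, perKernel T lam j l α ((t, x) - q) * g q l ∂(muG T)) -
        ∫ s, perKernel T lam j l α (t - s, x) * (∫ y, g (s, y)) l ∂(muT T)|
        ≤ C * ‖x‖ ^ (-4 - (len α : ℝ)) := by
  have hM0 : 0 ≤ M := (norm_nonneg _).trans (hM 0)
  obtain ⟨C, hC, hb⟩ := exists_perKernel_sub_le T lam j l α hR
  set V := (muG T).real (Set.univ ×ˢ Metric.ball (0 : E3) R₀)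
  refine ⟨C * M * V, by positivity, fun t x hx => ?_⟩
  have hx0 : 0 < ‖x‖ := by linarith
  have hk := slice_integrable_perKernel T lam j l α (norm_pos_iff.1 hx0)
  rw [(convT_term hgc hM h0 hk t l).2, ← integral_sub
    (integrable_perKernel_conv lam hα j l hgc hM hR h0 (t, x)).1
    (integrable_slice_mul hgc hM h0 hk t l)]
  have e : ‖x‖ ^ (-4 - (len α : ℝ)) = (‖x‖ ^ (4 + len α))⁻¹ := by
    rw [← Real.rpow_natCast, ← Real.rpow_neg (by positivity)]
    congr 1
    push_cast
    ring
  rw [e]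
  refine (abs_integral_le_of_support (muG_univ_prod_ball_lt_top R₀)
    (B := C / ‖x‖ ^ (4 + len α) * M) (fun q hq => ?_) fun q hq => ?_).trans (le_of_eq ?_)
  · obtain ⟨s, y⟩ := q
    have : R₀ ≤ ‖y‖ := by simpa using hq
    simp [h0 s y this]
  · obtain ⟨s, y⟩ := q
    have hy : ‖y‖ < R₀ := by simpa using hq
    rw [← sub_mul, abs_mul]
    exact mul_le_mul (hb (t - s) x y hx hy.le) ((abs_apply_le_norm _ l).trans (hM _))
      (abs_nonneg _) (by positivity)
  · ring

/-- Fubini needs a measurable set, so the comparison is made between strongly measurable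
representatives; the exceptional slice `x = 0` is null. -/
theorem ae_eq_of_slice_ae_eq {K K' : AddCircle T × E3 → ℝ}
    (hK : AEStronglyMeasurable K (muG T)) (hK' : AEStronglyMeasurable K' (muG T))
    (h : ∀ x : E3, x ≠ 0 → (fun t => K (t, x)) =ᵐ[muT T] fun t => K' (t, x)) :
    K =ᵐ[muG T] K' := by
  have hmeas : MeasurableSet {p : E3 × AddCircle T | hK.mk K p.swap = hK'.mk K' p.swap} :=
    measurableSet_eq_fun (hK.stronglyMeasurable_mk.measurable.comp measurable_swap)
      (hK'.stronglyMeasurable_mk.measurable.comp measurable_swap)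
  have hswap : MeasurePreserving (Prod.swap : E3 × AddCircle T → AddCircle T × E3)
      ((volume : Measure E3).prod (muT T)) (muG T) := Measure.measurePreserving_swap
  have h1 := Measure.ae_ae_of_ae_prod (hswap.quasiMeasurePreserving.ae hK.ae_eq_mk)
  have h2 := Measure.ae_ae_of_ae_prod (hswap.quasiMeasurePreserving.ae hK'.ae_eq_mk)
  have hne : ∀ᵐ x : E3, x ≠ 0 := by simp [ae_iff]
  have h3 : ∀ᵐ p ∂((volume : Measure E3).prod (muT T)),
      hK.mk K p.swap = hK'.mk K' p.swap := by
    rw [Measure.ae_prod_iff_ae_ae hmeas]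
    filter_upwards [h1, h2, hne] with x hx1 hx2 hx
    filter_upwards [hx1, hx2, h x hx] with t ht1 ht2 ht
    simp only [Prod.swap_prod_mk] at ht1 ht2 ⊢
    rw [← ht1, ← ht2, ht]
  have hswap' : MeasurePreserving (Prod.swap : AddCircle T × E3 → E3 × AddCircle T)
      (muG T) ((volume : Measure E3).prod (muT T)) := Measure.measurePreserving_swap
  have h4 : ∀ᵐ p ∂(muG T), hK.mk K p = hK'.mk K' p := by
    simpa using hswap'.quasiMeasurePreserving.ae h3
  filter_upwards [hK.ae_eq_mk, hK'.ae_eq_mk, h4] with p a b c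
  rw [a, b, c]

/-- An arbitrary representative `K` agrees with `perKernel` on almost all of each slice `x ≠ 0`,
hence almost everywhere on `G`. Both convolutions ignore null sets, so the estimates for `perKernel`
carry over. -/
theorem periodic_estimates {f : AddCircle T × E3 → E3} (hf : Continuous f)
    (hfc : HasCompactSupport f) (hR : 0 < R₀)
    (hsupp : tsupport f ⊆ Set.univ ×ˢ Metric.ball (0 : E3) R₀) (hα : len α ≤ 1)
    {K : Fin 3 → Fin 3 → AddCircle T × E3 → ℝ}
    (hK : ∀ j l, IsFunction (distDeriv α (GammaPerp T lam j l)) (K j l)) :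
    (∃ C : ℝ, 0 < C ∧ ∀ (t : AddCircle T) (x : E3),
      ConvGExists K (purelyPeriodic f) (t, x) ∧
      ‖convG K (purelyPeriodic f) (t, x)‖ ≤ C * (1 + ‖x‖) ^ (-3 - (len α : ℝ))) ∧
    (∃ C : ℝ, 0 < C ∧ ∀ (t : AddCircle T) (x : E3), 2 * R₀ ≤ ‖x‖ →
      ConvTExists (fun j l s => K j l (s, x)) (fun s => ∫ y, purelyPeriodic f (s, y)) t ∧
      ‖convG K (purelyPeriodic f) (t, x) - convT (fun j l s => K j l (s, x))
          (fun s => ∫ y, purelyPeriodic f (s, y)) t‖ ≤ C * ‖x‖ ^ (-4 - (len α : ℝ))) := by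
  obtain ⟨M, hM0, hM⟩ := exists_norm_le_of_hasCompactSupport hf hfc
  have hf0 : ∀ (t : AddCircle T) (x : E3), R₀ ≤ ‖x‖ → f (t, x) = 0 :=
    fun t x hx => eq_zero_of_tsupport_subset hsupp t hx
  set g := purelyPeriodic f with hg
  have hgc : Continuous g := hf.sub ((continuous_steady hf hM).comp continuous_snd)
  have hgM : ∀ p, ‖g p‖ ≤ 2 * M := fun p => by
    have := norm_sub_le (f p) (steady f p.2)
    have := hM p
    have := norm_steady_le hM p.2
    simp only [hg, purelyPeriodic]
    linarith
  have hg0 : ∀ t x, R₀ ≤ ‖x‖ → g (t, x) = 0 := fun t x hx => by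
    simp [hg, purelyPeriodic, hf0 t x hx, steady_eq_zero hf0 hx]
  have hslice : ∀ j l (x : E3), x ≠ 0 →
      (fun t => K j l (t, x)) =ᵐ[muT T] fun t => perKernel T lam j l α (t, x) := fun j l x hx =>
    (hK j l).slice_ae_eq (isFunction_perKernel lam j l hα) hx
  have hKm : ∀ j l, K j l =ᵐ[muG T] perKernel T lam j l α := fun j l =>
    ae_eq_of_slice_ae_eq (hK j l).locallyIntegrable.aestronglyMeasurable
      (aestronglyMeasurable_perKernel T lam j l hα) (hslice j l)
  have hG : ∀ j l p, (fun q => K j l (p - q) * g q l)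
      =ᵐ[muG T] fun q => perKernel T lam j l α (p - q) * g q l := fun j l p => by
    filter_upwards [(measurePreserving_sub_left_muG p).quasiMeasurePreserving.ae (hKm j l)]
      with q hq
    rw [hq]
  have hTt : ∀ j l t (x : E3), x ≠ 0 → (fun s => K j l (t - s, x) * (∫ y, g (s, y)) l)
      =ᵐ[muT T] fun s => perKernel T lam j l α (t - s, x) * (∫ y, g (s, y)) l :=
    fun j l t x hx => by
    filter_upwards [(measurePreserving_sub_left_muT t).quasiMeasurePreserving.ae (hslice j l x hx)]
      with s hs
    rw [hs]
  constructor
  · choose C hC hb using fun j l => exists_convG_perKernel_le lam hα hgc hgM hR hg0 j l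
    set C' := ∑ j, ∑ l, C j l with hC'
    have hCle : ∀ j l, C j l ≤ C' := le_sum_sum hC
    have hC0 : 0 ≤ C' := (hC 0 0).trans (hCle 0 0)
    -- The factor `9` comes from `norm_toLp_sum_le`; the `+ 1` makes the constant strictly positive.
    refine ⟨9 * C' + 1, by positivity, fun t x => ⟨fun j l => ?_, ?_⟩⟩
    · exact (integrable_perKernel_conv lam hα j l hgc hgM hR hg0 (t, x)).1.congr (hG j l _).symm
    · have h1 : ∀ j l, |∫ q, K j l ((t, x) - q) * g q l ∂(muG T)|
          ≤ C' * (1 + ‖x‖) ^ (-3 - (len α : ℝ)) := fun j l => by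
        rw [integral_congr_ae (hG j l (t, x))]
        refine (hb j l t x).trans ?_
        have := hCle j l
        gcongr
      refine (norm_toLp_sum_le h1).trans ?_
      rw [← mul_assoc]
      have : (0 : ℝ) ≤ (1 + ‖x‖) ^ (-3 - (len α : ℝ)) := by positivity
      nlinarith
  · choose C hC hb using fun j l => exists_convG_sub_convT_perKernel_le lam hα hgc hgM hR hg0 j l
    set C' := ∑ j, ∑ l, C j l with hC'
    have hCle : ∀ j l, C j l ≤ C' := le_sum_sum hC
    have hC0 : 0 ≤ C' := (hC 0 0).trans (hCle 0 0)
    refine ⟨9 * C' + 1, by positivity, fun t x hx => ?_⟩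
    have hx0 : 0 < ‖x‖ := by linarith
    have hxne : x ≠ 0 := norm_pos_iff.1 hx0
    refine ⟨fun j l => ?_, ?_⟩
    · exact (convT_term hgc hgM hg0 (slice_integrable_perKernel T lam j l α hxne) t l).1.congr
        (hTt j l t x hxne).symm
    · have e : convG K g (t, x) - convT (fun j l s => K j l (s, x)) (fun s => ∫ y, g (s, y)) t
          = WithLp.toLp 2 fun j => ∑ l, ((∫ q, K j l ((t, x) - q) * g q l ∂(muG T)) -
            ∫ s, K j l (t - s, x) * (∫ y, g (s, y)) l ∂(muT T)) := by
        ext j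
        simp [convG, convT, Finset.sum_sub_distrib]
      have h1 : ∀ j l, |(∫ q, K j l ((t, x) - q) * g q l ∂(muG T)) -
            ∫ s, K j l (t - s, x) * (∫ y, g (s, y)) l ∂(muT T)|
          ≤ C' * ‖x‖ ^ (-4 - (len α : ℝ)) := fun j l => by
        rw [integral_congr_ae (hG j l (t, x)), integral_congr_ae (hTt j l t x hxne)]
        refine (hb j l t x hx).trans ?_
        have := hCle j l
        gcongr
      rw [e]
      refine (norm_toLp_sum_le h1).trans ?_
      rw [← mul_assoc]
      have : (0 : ℝ) ≤ ‖x‖ ^ (-4 - (len α : ℝ)) := by positivity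
      nlinarith

end Convolution

/-! ### The profile of the Oseen potential -/

/-- The derivatives `∫_0^1 (-θ)^m e^{-θτ} dθ` of `τ ↦ (1 - e^{-τ}) / τ`. -/
def prof (m : ℕ) (τ : ℝ) : ℝ := ∫ θ in (0 : ℝ)..1, (-θ) ^ m * Real.exp (-(θ * τ))

theorem hasDerivAt_prof (m : ℕ) (τ : ℝ) : HasDerivAt (prof m) (prof (m + 1) τ) τ := by
  refine (intervalIntegral.hasDerivAt_integral_of_dominated_loc_of_deriv_le
    (F := fun τ θ => (-θ) ^ m * Real.exp (-(θ * τ)))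
    (F' := fun τ θ => (-θ) ^ (m + 1) * Real.exp (-(θ * τ)))
    (bound := fun _ => Real.exp (|τ| + 1)) (Metric.ball_mem_nhds τ one_pos)
    (Eventually.of_forall fun τ => Continuous.aestronglyMeasurable (by fun_prop))
    (Continuous.intervalIntegrable (by fun_prop) _ _)
    (Continuous.aestronglyMeasurable (by fun_prop))
    (Eventually.of_forall fun θ hθ σ hσ => ?_) (by simp)
    (Eventually.of_forall fun θ hθ σ hσ => ?_)).2
  · rw [Set.uIoc_of_le zero_le_one] at hθ
    have h1 : |σ| ≤ |τ| + 1 := by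
      have := abs_sub_abs_le_abs_sub σ τ
      rw [Metric.mem_ball, Real.dist_eq] at hσ
      linarith
    rw [norm_mul, norm_pow, norm_neg, Real.norm_of_nonneg hθ.1.le,
      Real.norm_of_nonneg (Real.exp_pos _).le]
    refine (mul_le_of_le_one_left (Real.exp_pos _).le (pow_le_one₀ hθ.1.le hθ.2)).trans
      (Real.exp_le_exp.2 ?_)
    calc -(θ * σ) ≤ |θ * σ| := neg_le_abs _
      _ = θ * |σ| := by rw [abs_mul, abs_of_pos hθ.1]
      _ ≤ |σ| := mul_le_of_le_one_left (abs_nonneg _) hθ.2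
      _ ≤ _ := h1
  · have h1 : HasDerivAt (fun σ : ℝ => -(θ * σ)) (-θ) σ := by
      simpa using ((hasDerivAt_id σ).const_mul θ).fun_neg
    exact (h1.exp.const_mul ((-θ) ^ m)).congr_deriv (by ring)

theorem continuous_prof (m : ℕ) : Continuous (prof m) :=
  continuous_iff_continuousAt.2 fun τ => (hasDerivAt_prof m τ).continuousAt

theorem prof_zero_eq {τ : ℝ} (hτ : τ ≠ 0) : prof 0 τ = (1 - Real.exp (-τ)) / τ := by
  have h : ∀ θ : ℝ, HasDerivAt (fun θ : ℝ => -Real.exp (-(θ * τ)) / τ)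
      ((-θ) ^ 0 * Real.exp (-(θ * τ))) θ := by
    intro θ
    have h1 : HasDerivAt (fun θ : ℝ => -(θ * τ)) (-τ) θ := by
      simpa using ((hasDerivAt_id θ).mul_const τ).fun_neg
    refine ((h1.exp.fun_neg).div_const τ).congr_deriv ?_
    field_simp
  rw [prof, intervalIntegral.integral_eq_sub_of_hasDerivAt (fun θ _ => h θ)
    (Continuous.intervalIntegrable (by fun_prop) _ _)]
  simp
  ring

/-- For `θ ≤ 1` one has `θ^m (1 + τ)^m ≤ (1 + θτ)^m`, which half of the exponential absorbs. The
last factor `1 + τ` is paid for by integrating the other half over `θ`. -/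
theorem exists_prof_le (m : ℕ) :
    ∃ C : ℝ, 0 ≤ C ∧ ∀ τ : ℝ, 0 ≤ τ → |prof m τ| * (1 + τ) ^ (m + 1) ≤ C := by
  have h1 : ∀ u : ℝ, 0 ≤ u → (1 + u) ^ m * Real.exp (-(u / 2)) ≤
      m.factorial * 2 ^ m * Real.exp (1 / 2) := by
    intro u hu
    have h := Real.pow_div_factorial_le_exp ((1 + u) / 2) (by positivity) m
    rw [div_le_iff₀ (by positivity), div_pow, div_le_iff₀ (by positivity)] at h
    calc (1 + u) ^ m * Real.exp (-(u / 2))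
        ≤ Real.exp ((1 + u) / 2) * m.factorial * 2 ^ m * Real.exp (-(u / 2)) := by gcongr
      _ = m.factorial * 2 ^ m * (Real.exp ((1 + u) / 2) * Real.exp (-(u / 2))) := by ring
      _ = _ := by rw [← Real.exp_add]; congr 2; ring
  set A : ℝ := m.factorial * 2 ^ m * Real.exp (1 / 2) with hA
  have hA0 : 0 ≤ A := by positivity
  -- The `3` bounds `(1 + τ) ∫₀¹ e^{-θτ/2} dθ`: the summand `1` contributes at most `1` and `τ` at
  -- most `2`.
  refine ⟨A * 3, by positivity, fun τ hτ => ?_⟩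
  have hc : Continuous fun θ : ℝ => A * ((1 + τ) * Real.exp (-(θ * τ / 2))) := by fun_prop
  have h2 : |prof m τ| * (1 + τ) ^ (m + 1)
      ≤ ∫ θ in (0 : ℝ)..1, A * ((1 + τ) * Real.exp (-(θ * τ / 2))) := by
    rw [← abs_of_nonneg (by positivity : (0 : ℝ) ≤ (1 + τ) ^ (m + 1)), ← abs_mul, prof,
      ← intervalIntegral.integral_mul_const, ← Real.norm_eq_abs]
    refine intervalIntegral.norm_integral_le_of_norm_le zero_le_one
      (Eventually.of_forall fun θ hθ => ?_) (hc.intervalIntegrable (μ := volume) _ _)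
    rw [norm_mul, norm_mul, norm_pow, norm_neg, Real.norm_of_nonneg hθ.1.le,
      Real.norm_of_nonneg (Real.exp_pos _).le, Real.norm_of_nonneg (by positivity)]
    have h3 := h1 (θ * τ) (mul_nonneg hθ.1.le hτ)
    have h4 : θ ^ m * (1 + τ) ^ m ≤ (1 + θ * τ) ^ m := by
      rw [← mul_pow]
      refine pow_le_pow_left₀ (mul_nonneg hθ.1.le (by linarith)) ?_ m
      nlinarith [hθ.2]
    have h5 : Real.exp (-(θ * τ)) = Real.exp (-(θ * τ / 2)) * Real.exp (-(θ * τ / 2)) := by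
      rw [← Real.exp_add]; congr 1; ring
    calc θ ^ m * Real.exp (-(θ * τ)) * (1 + τ) ^ (m + 1)
        = (θ ^ m * (1 + τ) ^ m) * Real.exp (-(θ * τ / 2)) *
          ((1 + τ) * Real.exp (-(θ * τ / 2))) := by rw [h5]; ring
      _ ≤ (1 + θ * τ) ^ m * Real.exp (-(θ * τ / 2)) * ((1 + τ) * Real.exp (-(θ * τ / 2))) := by
          gcongr
      _ ≤ _ := by gcongr
  refine h2.trans ?_
  rw [intervalIntegral.integral_const_mul]
  refine mul_le_mul_of_nonneg_left ?_ hA0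
  have e : ∀ θ : ℝ, (1 + τ) * Real.exp (-(θ * τ / 2))
      = Real.exp (-(θ * τ / 2)) + 2 * (τ / 2 * Real.exp (-(θ * τ / 2))) := fun θ => by ring
  simp only [e]
  have c1 : Continuous fun θ : ℝ => Real.exp (-(θ * τ / 2)) := by fun_prop
  have c2 : Continuous fun θ : ℝ => 2 * (τ / 2 * Real.exp (-(θ * τ / 2))) := by fun_prop
  rw [intervalIntegral.integral_add (c1.intervalIntegrable _ _) (c2.intervalIntegrable _ _),
    intervalIntegral.integral_const_mul]
  have i1 : ∫ θ in (0 : ℝ)..1, Real.exp (-(θ * τ / 2)) ≤ 1 := by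
    have := intervalIntegral.integral_mono_on (μ := volume) zero_le_one (c1.intervalIntegrable 0 1)
      (continuous_const.intervalIntegrable 0 1) (g := fun _ => (1 : ℝ)) fun θ hθ => by
        rw [Real.exp_le_one_iff]
        have := mul_nonneg hθ.1 hτ
        linarith
    simpa using this
  have i2 : ∫ θ in (0 : ℝ)..1, τ / 2 * Real.exp (-(θ * τ / 2)) ≤ 1 := by
    have h : ∀ θ : ℝ, HasDerivAt (fun θ : ℝ => -Real.exp (-(θ * τ / 2)))
        (τ / 2 * Real.exp (-(θ * τ / 2))) θ := by
      intro θ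
      have h1 : HasDerivAt (fun θ : ℝ => -(θ * τ / 2)) (-(τ / 2)) θ := by
        simpa using (((hasDerivAt_id θ).mul_const τ).div_const 2).fun_neg
      exact h1.exp.fun_neg.congr_deriv (by ring)
    rw [intervalIntegral.integral_eq_sub_of_hasDerivAt (fun θ _ => h θ)
      (Continuous.intervalIntegrable (by fun_prop) _ _)]
    have := Real.exp_pos (-(1 * τ / 2))
    simp only [zero_mul, zero_div, neg_zero, Real.exp_zero]
    linarith
  linarith

/-- The profile `E(v) = ∫_0^v (1 - e^{-τ}) / τ dτ`. -/
def oseenProfile (v : ℝ) : ℝ := ∫ τ in (0 : ℝ)..v, prof 0 τ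

theorem hasDerivAt_oseenProfile (v : ℝ) : HasDerivAt oseenProfile (prof 0 v) v :=
  intervalIntegral.integral_hasDerivAt_right ((continuous_prof 0).intervalIntegrable _ _)
    (continuous_prof 0).stronglyMeasurable.stronglyMeasurableAtFilter (continuous_prof 0).continuousAt

theorem iteratedDeriv_prof (n : ℕ) : ∀ m, iteratedDeriv n (prof m) = prof (m + n) := by
  induction n with
  | zero => intro m; simp
  | succ n ih =>
    intro m
    rw [iteratedDeriv_succ', show deriv (prof m) = prof (m + 1) from
      funext fun τ => (hasDerivAt_prof m τ).deriv, ih]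
    congr 1
    ring

theorem iteratedDeriv_oseenProfile (n : ℕ) : iteratedDeriv (n + 1) oseenProfile = prof n := by
  rw [iteratedDeriv_succ', show deriv oseenProfile = prof 0 from
    funext fun τ => (hasDerivAt_oseenProfile τ).deriv, iteratedDeriv_prof, zero_add]

theorem contDiff_oseenProfile : ContDiff ℝ ∞ oseenProfile := by
  refine contDiff_of_differentiable_iteratedDeriv fun m _ => ?_
  cases m with
  | zero => exact fun v => by simpa using (hasDerivAt_oseenProfile v).differentiableAt
  | succ n => rw [iteratedDeriv_oseenProfile]; exact fun v => (hasDerivAt_prof n v).differentiableAt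

theorem oseenPotential_eq (lam : ℝ) (x : E3) :
    oseenPotential lam x = oseenProfile (wake (lam • x) / 2) := by
  refine intervalIntegral.integral_congr_ae ?_
  -- At `τ = 0` the quotient evaluates to `0` and `prof 0` to `1`; the integral does not see this.
  have : ∀ᵐ τ : ℝ, τ ≠ 0 := by simp [ae_iff]
  filter_upwards [this] with τ hτ _
  rw [prof_zero_eq hτ]

/-! ### The wake function -/

theorem wake_smul (lam : ℝ) (x : E3) : wake (lam • x) = |lam| * ‖x‖ + lam * x 0 := by
  simp [wake, norm_smul]

theorem wake_nonneg (x : E3) : 0 ≤ wake x := by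
  have := abs_apply_le_norm x 0
  have := neg_le_abs (x 0)
  unfold wake
  linarith

theorem wake_le (x : E3) : wake x ≤ 2 * ‖x‖ := by
  have := abs_apply_le_norm x 0
  have := le_abs_self (x 0)
  unfold wake
  linarith

theorem wake_sub_le (x y : E3) : wake x ≤ wake (x - y) + 2 * ‖y‖ := by
  have h1 := abs_apply_le_norm y 0
  have h2 := le_abs_self (y 0)
  have h3 := norm_sub_norm_le x y
  simp only [wake, PiLp.sub_apply]
  linarith

theorem contDiffAt_wake (lam : ℝ) {x : E3} (hx : x ≠ 0) :
    ContDiffAt ℝ ∞ (fun x : E3 => wake (lam • x)) x := by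
  simp only [wake_smul]
  have h1 : ContDiffAt ℝ ∞ (fun x : E3 => ‖x‖) x := contDiffAt_norm ℝ hx
  have h2 : ContDiff ℝ ∞ (fun x : E3 => x 0) := (EuclideanSpace.proj (𝕜 := ℝ) (0 : Fin 3)).contDiff
  exact (contDiffAt_const.mul h1).add (contDiffAt_const.mul h2.contDiffAt)

/-- The gradient is `|λ| x/|x| + λe₁`, with square `2λ² + 2|λ|λ x₁/|x|`. Its smallness inside the
wake is the source of the anisotropic decay. -/
theorem norm_fderiv_wake_sq (lam : ℝ) {x : E3} (hx : x ≠ 0) :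
    ‖fderiv ℝ (fun x : E3 => wake (lam • x)) x‖ ^ 2 = 2 * |lam| * wake (lam • x) / ‖x‖ := by
  have hx0 : 0 < ‖x‖ := norm_pos_iff.2 hx
  have h1 : HasFDerivAt (fun x : E3 => ‖x‖) (‖x‖⁻¹ • innerSL ℝ x) x := by
    have h := (hasStrictFDerivAt_norm_sq x).hasFDerivAt.sqrt (by positivity)
    simp only [Real.sqrt_sq (norm_nonneg _)] at h
    refine h.congr_fderiv ?_
    ext v
    simp only [smul_apply, smul_eq_mul, nsmul_eq_mul]
    push_cast
    field_simp
  have h2 : HasFDerivAt (fun x : E3 => x 0) (innerSL ℝ (EuclideanSpace.single (0 : Fin 3) (1 : ℝ))) x := by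
    refine ((EuclideanSpace.proj (𝕜 := ℝ) (0 : Fin 3)).hasFDerivAt (x := x)).congr_fderiv ?_
    ext v
    simp [EuclideanSpace.inner_single_left]
  have h3 : HasFDerivAt (fun x : E3 => wake (lam • x))
      (innerSL ℝ ((|lam| * ‖x‖⁻¹) • x + lam • EuclideanSpace.single (0 : Fin 3) (1 : ℝ))) x := by
    simp only [wake_smul]
    refine ((h1.const_mul |lam|).add (h2.const_mul lam)).congr_fderiv ?_
    ext v
    simp
    ring
  rw [h3.fderiv, innerSL_apply_norm, ← real_inner_self_eq_norm_sq]
  simp only [inner_add_left, inner_add_right, inner_smul_left, inner_smul_right,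
    real_inner_self_eq_norm_sq, EuclideanSpace.inner_single_left, EuclideanSpace.inner_single_right,
    wake_smul]
  simp
  field_simp
  linear_combination (-‖x‖) * sq_abs lam

theorem contDiffOn_of_forall_ne {u : E3 → ℝ} (h : ∀ x ≠ 0, ContDiffAt ℝ ∞ u x) :
    ContDiffOn ℝ ∞ u {0}ᶜ := fun x hx => (h x hx).contDiffWithinAt

/-- Derivatives of a positively homogeneous function of degree one. -/
theorem exists_iteratedFDeriv_homogeneous_le {f : E3 → ℝ} (hf : ∀ x ≠ 0, ContDiffAt ℝ ∞ f x)
    (hhom : ∀ (c : ℝ) x, 0 < c → f (c • x) = c * f x) (i : ℕ) :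
    ∃ M : ℝ, 0 ≤ M ∧ ∀ x : E3, x ≠ 0 → ‖iteratedFDeriv ℝ i f x‖ * ‖x‖ ^ i ≤ M * ‖x‖ := by
  have hcont : ContinuousOn (iteratedFDeriv ℝ i f) {0}ᶜ :=
    ((contDiffOn_of_forall_ne hf).continuousOn_iteratedFDerivWithin (m := i)
      (by exact_mod_cast le_top) isOpen_compl_singleton.uniqueDiffOn).congr
      fun x hx => (iteratedFDerivWithin_of_isOpen i isOpen_compl_singleton hx).symm
  obtain ⟨M, hM⟩ := (isCompact_sphere (0 : E3) 1).exists_bound_of_continuousOn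
    (hcont.mono fun x hx => by
      rw [mem_sphere_zero_iff_norm] at hx
      exact fun h => by rw [Set.mem_singleton_iff] at h; simp [h] at hx)
  refine ⟨max M 0, le_max_right _ _, fun x hx => ?_⟩
  have hx0 : 0 < ‖x‖ := norm_pos_iff.2 hx
  set c := ‖x‖⁻¹ with hc
  have hc0 : 0 < c := inv_pos.2 hx0
  set L : E3 →L[ℝ] E3 := c • ContinuousLinearMap.id ℝ E3 with hL
  have hLx : ∀ y, L y = c • y := fun y => rfl
  have hLnorm : ‖L‖ ≤ c := by
    rw [hL, norm_smul, Real.norm_of_nonneg hc0.le]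
    exact mul_le_of_le_one_right hc0.le ContinuousLinearMap.norm_id_le
  have hpre : L ⁻¹' {0}ᶜ = ({0}ᶜ : Set E3) := by
    ext y
    simp [hLx, hc0.ne']
  have hLx' : L x ∈ ({0}ᶜ : Set E3) := by simp [hLx, hc0.ne', hx]
  have h1 := L.iteratedFDerivWithin_comp_right (contDiffOn_of_forall_ne hf)
    isOpen_compl_singleton.uniqueDiffOn
    (by rw [hpre]; exact isOpen_compl_singleton.uniqueDiffOn) hLx' (i := i)
    (by exact_mod_cast le_top)
  rw [hpre, iteratedFDerivWithin_of_isOpen i isOpen_compl_singleton (by simpa using hx),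
    iteratedFDerivWithin_of_isOpen i isOpen_compl_singleton hLx'] at h1
  have h2 : f ∘ L = c • f := by
    funext y
    simp [hLx, hhom c y hc0]
  rw [h2, iteratedFDeriv_const_smul_apply ((hf x hx).of_le (by exact_mod_cast le_top))] at h1
  have h3 : c * ‖iteratedFDeriv ℝ i f x‖ ≤ max M 0 * c ^ i := by
    have e : ‖c • iteratedFDeriv ℝ i f x‖ = c * ‖iteratedFDeriv ℝ i f x‖ := by
      rw [norm_smul, Real.norm_of_nonneg hc0.le]
    rw [← e, h1]
    refine (ContinuousMultilinearMap.norm_compContinuousLinearMap_le _ _).trans ?_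
    rw [Finset.prod_const, Finset.card_univ, Fintype.card_fin]
    have h4 : ‖iteratedFDeriv ℝ i f (L x)‖ ≤ M := hM _ (by
      rw [mem_sphere_zero_iff_norm, hLx, norm_smul, Real.norm_of_nonneg hc0.le, hc,
        inv_mul_cancel₀ hx0.ne'])
    exact mul_le_mul (h4.trans (le_max_left _ _)) (pow_le_pow_left₀ (norm_nonneg _) hLnorm i)
      (by positivity) (le_max_right _ _)
  have h5 : c ^ i * ‖x‖ ^ i = 1 := by rw [← mul_pow, hc, inv_mul_cancel₀ hx0.ne', one_pow]
  have h6 : c * ‖x‖ = 1 := inv_mul_cancel₀ hx0.ne'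
  calc ‖iteratedFDeriv ℝ i f x‖ * ‖x‖ ^ i
      = c * ‖iteratedFDeriv ℝ i f x‖ * (‖x‖ ^ i * ‖x‖) := by
        linear_combination (-‖iteratedFDeriv ℝ i f x‖ * ‖x‖ ^ i) * h6
    _ ≤ max M 0 * c ^ i * (‖x‖ ^ i * ‖x‖) := by gcongr
    _ = max M 0 * ‖x‖ := by linear_combination (max M 0 * ‖x‖) * h5

/-- The wake function of the rescaled variable. -/
def swake (lam : ℝ) (x : E3) : ℝ := wake (lam • x)

theorem swake_nonneg (lam : ℝ) (x : E3) : 0 ≤ swake lam x := wake_nonneg _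

theorem swake_le (lam : ℝ) (x : E3) : swake lam x ≤ 2 * |lam| * ‖x‖ := by
  have := wake_le (lam • x)
  rw [norm_smul, Real.norm_eq_abs] at this
  unfold swake
  linarith

theorem swake_sub_le (lam : ℝ) (x y : E3) : swake lam x ≤ swake lam (x - y) + 2 * |lam| * ‖y‖ := by
  have := wake_sub_le (lam • x) (lam • y)
  rw [norm_smul, Real.norm_eq_abs, ← smul_sub] at this
  unfold swake
  linarith

theorem contDiffAt_swake (lam : ℝ) {x : E3} (hx : x ≠ 0) : ContDiffAt ℝ ∞ (swake lam) x :=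
  contDiffAt_wake lam hx

theorem exists_iteratedFDeriv_swake_le (lam : ℝ) (i : ℕ) :
    ∃ M : ℝ, 0 ≤ M ∧ ∀ x : E3, x ≠ 0 →
      ‖iteratedFDeriv ℝ i (swake lam) x‖ * ‖x‖ ^ i ≤ M * ‖x‖ := by
  refine exists_iteratedFDeriv_homogeneous_le (fun x hx => contDiffAt_wake lam hx)
    (fun c x hc => ?_) i
  simp only [wake_smul, norm_smul, PiLp.smul_apply, smul_eq_mul, Real.norm_of_nonneg hc.le]
  ring

/-! ### Derivative bounds for the Oseen potential -/

theorem contDiffAt_oseenPotential (lam : ℝ) {x : E3} (hx : x ≠ 0) :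
    ContDiffAt ℝ ∞ (oseenPotential lam) x := by
  have e : oseenPotential lam = fun x => oseenProfile (swake lam x / 2) :=
    funext fun x => oseenPotential_eq lam x
  rw [e]
  exact contDiff_oseenProfile.contDiffAt.comp x ((contDiffAt_wake lam hx).div_const 2)

/-- Chain rule bound for the Oseen potential, with a free scale `ρ`. -/
theorem norm_iteratedFDeriv_oseenPotential_le (lam : ℝ) {x : E3} (hx : x ≠ 0) {ρ : ℝ} (hρ : 0 < ρ)
    {k : ℕ} (hk : 1 ≤ k) {C D : ℝ} (hC0 : 0 ≤ C)
    (hC : ∀ i, i < k → (ρ / 2) ^ (i + 1) * |prof i (swake lam x / 2)| ≤ C)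
    (hD : ∀ i, 1 ≤ i → i ≤ k → ‖iteratedFDeriv ℝ i (swake lam) x‖ ≤ ρ * D ^ i) :
    ‖iteratedFDeriv ℝ k (oseenPotential lam) x‖ ≤ k.factorial * C * D ^ k := by
  set E₀ := oseenProfile (swake lam x / 2) with hE₀
  -- The profile itself has no bound by `C`; subtracting its value at `x` makes the zeroth-order
  -- term vanish without changing derivatives of order `k ≥ 1`. Inner and outer function are
  -- rescaled by `ρ` in opposite directions.
  set G : ℝ → ℝ := fun v => oseenProfile (ρ / 2 * v) - E₀ with hG
  set F : E3 → ℝ := ρ⁻¹ • swake lam with hF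
  have hGc : ContDiff ℝ ∞ G := (contDiff_oseenProfile.comp (contDiff_const.mul contDiff_id)).sub
    contDiff_const
  have hFc : ∀ y ≠ 0, ContDiffAt ℝ ∞ F y := fun y hy => contDiffAt_const.smul (contDiffAt_wake lam hy)
  have hGF : G ∘ F = fun y => oseenPotential lam y - E₀ := by
    funext y
    simp only [hG, hF, Function.comp, Pi.smul_apply, smul_eq_mul, oseenPotential_eq]
    congr 2
    simp only [swake]
    field_simp
  have hiG : ∀ i v, iteratedDeriv (i + 1) G v = (ρ / 2) ^ (i + 1) * prof i (ρ / 2 * v) := by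
    intro i v
    have h1 : deriv G = deriv fun v => oseenProfile (ρ / 2 * v) := by
      funext v
      exact deriv_sub_const _
    rw [iteratedDeriv_succ', h1, ← iteratedDeriv_succ',
      iteratedDeriv_comp_const_mul (contDiff_oseenProfile.of_le (by exact_mod_cast le_top)) (ρ / 2),
      iteratedDeriv_oseenProfile]
  have hFx : ρ / 2 * F x = swake lam x / 2 := by
    simp only [hF, Pi.smul_apply, smul_eq_mul]
    field_simp
  have key := norm_iteratedFDerivWithin_comp_le (n := k) (s := {0}ᶜ) (t := Set.univ) (x := x) (C := C)
    (D := D) hGc.contDiffOn (contDiffOn_of_forall_ne hFc) (by exact_mod_cast le_top)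
    uniqueDiffOn_univ isOpen_compl_singleton.uniqueDiffOn (Set.mapsTo_univ _ _)
    (by simpa using hx) (fun i hi => ?_) (fun i hi1 hi => ?_)
  · rw [iteratedFDerivWithin_of_isOpen k isOpen_compl_singleton (by simpa using hx), hGF] at key
    obtain ⟨k, rfl⟩ : ∃ m, k = m + 1 := ⟨k - 1, by omega⟩
    rw [← norm_iteratedFDeriv_fderiv] at key ⊢
    have h1 : fderiv ℝ (fun y => oseenPotential lam y - E₀) = fderiv ℝ (oseenPotential lam) :=
      funext fun y => fderiv_sub_const _
    rwa [h1] at key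
  · rw [iteratedFDerivWithin_univ, norm_iteratedFDeriv_eq_norm_iteratedDeriv]
    cases i with
    | zero => simp only [iteratedDeriv_zero, hG, hFx, hE₀, sub_self, norm_zero, hC0]
    | succ i =>
      rw [hiG, hFx, norm_mul, Real.norm_of_nonneg (by positivity)]
      exact hC i (by omega)
  · rw [iteratedFDerivWithin_of_isOpen i isOpen_compl_singleton (by simpa using hx), hF,
      iteratedFDeriv_const_smul_apply ((contDiffAt_swake lam hx).of_le (by exact_mod_cast le_top)),
      norm_smul, Real.norm_of_nonneg (by positivity), inv_mul_le_iff₀ hρ]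
    exact hD i hi1 hi

/-- Near the origin the wake function behaves like any function homogeneous of degree one. The scale
`ρ = ‖x‖` then gives order `‖x‖^{1-k}`. -/
theorem exists_oseenPotential_near (lam : ℝ) {k : ℕ} (hk : 1 ≤ k) :
    ∃ C : ℝ, 0 ≤ C ∧ ∀ x : E3, x ≠ 0 → ‖x‖ ≤ 1 →
      ‖iteratedFDeriv ℝ k (oseenPotential lam) x‖ * ‖x‖ ^ k ≤ C * ‖x‖ := by
  choose A hA hprof using exists_prof_le
  choose M hM hsw using exists_iteratedFDeriv_swake_le lam
  set A' := ∑ i ∈ Finset.range k, A i with hA'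
  set C₀ := 1 + ∑ i ∈ Finset.range (k + 1), M i with hC₀
  have hA'0 : 0 ≤ A' := Finset.sum_nonneg fun i _ => hA i
  have hC₀1 : 1 ≤ C₀ := le_add_of_nonneg_right (Finset.sum_nonneg fun i _ => hM i)
  refine ⟨k.factorial * A' * C₀ ^ k, by positivity, fun x hx hx1 => ?_⟩
  have hx0 : 0 < ‖x‖ := norm_pos_iff.2 hx
  have h := norm_iteratedFDeriv_oseenPotential_le lam hx hx0 hk (C := A' * ‖x‖) (D := C₀ / ‖x‖)
    (by positivity) (fun i hi => ?_) (fun i hi1 hi => ?_)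
  · calc _ ≤ k.factorial * (A' * ‖x‖) * (C₀ / ‖x‖) ^ k * ‖x‖ ^ k := by gcongr
      _ = _ := by rw [div_pow]; field_simp
  · have h1 := hprof i (swake lam x / 2) (by linarith [swake_nonneg lam x])
    have h2 : |prof i (swake lam x / 2)| ≤ A i :=
      (le_mul_of_one_le_right (abs_nonneg _)
        (one_le_pow₀ (by linarith [swake_nonneg lam x]))).trans h1
    have h3 : (‖x‖ / 2) ^ (i + 1) ≤ ‖x‖ := by
      rw [pow_succ]
      have : (‖x‖ / 2) ^ i ≤ 1 := pow_le_one₀ (by positivity) (by linarith)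
      calc _ ≤ 1 * (‖x‖ / 2) := by gcongr
        _ ≤ _ := by linarith
    have h4 : A i ≤ A' :=
      Finset.single_le_sum (f := A) (fun i _ => hA i) (Finset.mem_range.2 hi)
    calc _ ≤ ‖x‖ * A' := by gcongr; exact h2.trans h4
      _ = _ := mul_comm _ _
  · have h1 := hsw i x hx
    have h2 : M i ≤ ∑ i ∈ Finset.range (k + 1), M i :=
      Finset.single_le_sum (f := M) (fun i _ => hM i) (Finset.mem_range.2 (by omega))
    have h3 : M i ≤ C₀ ^ i := (by linarith : M i ≤ C₀).trans (le_self_pow₀ hC₀1 (by omega))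
    rw [div_pow, ← mul_div_assoc, le_div_iff₀ (by positivity)]
    refine h1.trans ?_
    rw [mul_comm]
    gcongr

/-- Chain rule at the scale `ρ = 1 + s`, with `D` a multiple of `1/w` and `w² = ‖x‖(1 + s)`. The
decay of `prof` cancels the powers of `1 + s`, and each derivative of the wake function costs at
most one factor `1/w` relative to `1 + s`. -/
theorem exists_oseenPotential_far (lam : ℝ) {k : ℕ} (hk : 1 ≤ k) {r : ℝ} (hr : 0 < r) :
    ∃ C : ℝ, 0 ≤ C ∧ ∀ x : E3, r ≤ ‖x‖ →
      ‖iteratedFDeriv ℝ k (oseenPotential lam) x‖ * Real.sqrt (‖x‖ * (1 + swake lam x)) ^ k ≤ C := by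
  choose A hA hprof using exists_prof_le
  choose M hM hsw using exists_iteratedFDeriv_swake_le lam
  set A' := ∑ i ∈ Finset.range k, A i with hA'
  set q := 1 + Real.sqrt (1 / r + 2 * |lam|) with hq
  set C₀ := 1 + Real.sqrt (2 * |lam|) + ∑ i ∈ Finset.range (k + 1), M i * q ^ i with hC₀
  have hA'0 : 0 ≤ A' := Finset.sum_nonneg fun i _ => hA i
  have hq1 : 1 ≤ q := le_add_of_nonneg_right (Real.sqrt_nonneg _)
  have hsum0 : 0 ≤ ∑ i ∈ Finset.range (k + 1), M i * q ^ i :=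
    Finset.sum_nonneg fun i _ => mul_nonneg (hM i) (by positivity)
  have hsq0 := Real.sqrt_nonneg (2 * |lam|)
  have hC₀1 : 1 ≤ C₀ := by rw [hC₀]; linarith
  refine ⟨k.factorial * A' * C₀ ^ k, by positivity, fun x hxr => ?_⟩
  have hx0 : 0 < ‖x‖ := hr.trans_le hxr
  have hx : x ≠ 0 := norm_pos_iff.1 hx0
  have hs := swake_nonneg lam x
  set s := swake lam x with hsdef
  set w := Real.sqrt (‖x‖ * (1 + s)) with hw
  have hw0 : 0 < w := Real.sqrt_pos.2 (by positivity)
  have hw2 : w ^ 2 = ‖x‖ * (1 + s) := Real.sq_sqrt (by positivity)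
  have h := norm_iteratedFDeriv_oseenPotential_le lam hx (ρ := 1 + s) (by positivity) hk (C := A')
    (D := C₀ / w) hA'0 (fun i hi => ?_) (fun i hi1 hi => ?_)
  · calc _ ≤ k.factorial * A' * (C₀ / w) ^ k * w ^ k := by gcongr
      _ = _ := by rw [div_pow]; field_simp
  · have h1 := hprof i (s / 2) (by linarith)
    have h4 : A i ≤ A' :=
      Finset.single_le_sum (f := A) (fun i _ => hA i) (Finset.mem_range.2 hi)
    refine le_trans ?_ (h1.trans h4)
    rw [mul_comm]
    gcongr
    linarith
  · rcases Nat.lt_or_ge i 2 with hi2 | hi2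
    -- First order: homogeneity would give only a bounded gradient, which is not enough inside the
    -- wake, so the exact formula for the gradient is used.
    · obtain rfl : i = 1 := by omega
      have e : ‖iteratedFDeriv ℝ 1 (swake lam) x‖ = ‖fderiv ℝ (swake lam) x‖ := by
        rw [← zero_add 1, ← norm_iteratedFDeriv_fderiv, norm_iteratedFDeriv_zero]
      have h1 : ‖fderiv ℝ (swake lam) x‖ ^ 2 = 2 * |lam| * s / ‖x‖ := norm_fderiv_wake_sq lam hx
      rw [e, pow_one]
      refine le_of_sq_le_sq ?_ (by positivity)
      rw [h1, mul_pow, div_pow, hw2, div_le_iff₀ hx0]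
      have h2 : 2 * |lam| ≤ C₀ ^ 2 := by
        rw [← Real.sq_sqrt (by positivity : 0 ≤ 2 * |lam|)]
        exact pow_le_pow_left₀ hsq0 (by rw [hC₀]; linarith) 2
      have e2 : (1 + s) ^ 2 * (C₀ ^ 2 / (‖x‖ * (1 + s))) * ‖x‖ = C₀ ^ 2 * (1 + s) := by
        field_simp
      rw [e2]
      exact mul_le_mul h2 (by linarith) hs (by positivity)
    · have h1 := hsw i x hx
      have h2 : M i * q ^ i ≤ ∑ i ∈ Finset.range (k + 1), M i * q ^ i :=
        Finset.single_le_sum (f := fun i => M i * q ^ i)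
          (fun i _ => mul_nonneg (hM i) (by positivity)) (Finset.mem_range.2 (by omega))
      have h3 : M i * q ^ i ≤ C₀ ^ i :=
        (by rw [hC₀]; linarith : M i * q ^ i ≤ C₀).trans (le_self_pow₀ hC₀1 (by omega))
      -- From `1 ≤ ‖x‖ / r` and `s ≤ 2|λ|‖x‖`. Two factors of `w` are then spent exactly as `w² =
      -- ‖x‖(1 + s)` and the others are replaced by `q‖x‖`, so homogeneity suffices for orders two
      -- and above.
      have hwq : w ≤ q * ‖x‖ := by
        have h5 : w ≤ Real.sqrt (1 / r + 2 * |lam|) * ‖x‖ := by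
          rw [hw, Real.sqrt_le_left (by positivity), mul_pow, Real.sq_sqrt (by positivity), sq ‖x‖]
          have h6 : s ≤ 2 * |lam| * ‖x‖ := swake_le lam x
          have h7 : 1 ≤ 1 / r * ‖x‖ := by rw [one_div_mul_eq_div, one_le_div hr]; exact hxr
          calc ‖x‖ * (1 + s) ≤ ‖x‖ * (1 / r * ‖x‖ + 2 * |lam| * ‖x‖) := by gcongr
            _ = _ := by ring
        exact h5.trans (by gcongr; rw [hq]; linarith)
      obtain ⟨m, rfl⟩ : ∃ m, i = m + 2 := ⟨i - 2, by omega⟩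
      have h8 : w ^ (m + 2) ≤ (1 + s) * (q ^ (m + 2) * ‖x‖ ^ (m + 1)) := by
        calc w ^ (m + 2) = w ^ m * w ^ 2 := pow_add _ _ _
          _ ≤ (q * ‖x‖) ^ m * (‖x‖ * (1 + s)) := by rw [hw2]; gcongr
          _ = (1 + s) * (q ^ m * ‖x‖ ^ (m + 1)) := by rw [mul_pow, pow_succ]; ring
          _ ≤ _ := by gcongr; omega
      rw [div_pow, ← mul_div_assoc, le_div_iff₀ (by positivity)]
      have h9 : ‖iteratedFDeriv ℝ (m + 2) (swake lam) x‖ * ‖x‖ ^ (m + 1) ≤ M (m + 2) := by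
        have : ‖iteratedFDeriv ℝ (m + 2) (swake lam) x‖ * ‖x‖ ^ (m + 1) * ‖x‖ ≤ M (m + 2) * ‖x‖ := by
          calc _ = ‖iteratedFDeriv ℝ (m + 2) (swake lam) x‖ * ‖x‖ ^ (m + 2) := by ring
            _ ≤ _ := h1
        exact le_of_mul_le_mul_right this hx0
      calc _ ≤ ‖iteratedFDeriv ℝ (m + 2) (swake lam) x‖ *
            ((1 + s) * (q ^ (m + 2) * ‖x‖ ^ (m + 1))) := by gcongr
        _ = (‖iteratedFDeriv ℝ (m + 2) (swake lam) x‖ * ‖x‖ ^ (m + 1)) * q ^ (m + 2) * (1 + s) := by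
            ring
        _ ≤ M (m + 2) * q ^ (m + 2) * (1 + s) := by gcongr
        _ ≤ C₀ ^ (m + 2) * (1 + s) := by gcongr
        _ = _ := mul_comm _ _

/-! ### Derivatives of `Γ₀` as wake kernels -/

theorem contDiffAt_pd {u : E3 → ℝ} (i : Fin 3) {x : E3} (hu : ContDiffAt ℝ ∞ u x) :
    ContDiffAt ℝ ∞ (pd i u) x :=
  (hu.fderiv_right (m := ∞) (by norm_num)).clm_apply contDiffAt_const

theorem norm_iteratedFDeriv_pd_le {u : E3 → ℝ} (i : Fin 3) {x : E3} (hu : ContDiffAt ℝ ∞ u x)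
    (n : ℕ) : ‖iteratedFDeriv ℝ n (pd i u) x‖ ≤ ‖iteratedFDeriv ℝ (n + 1) u x‖ := by
  set L := ContinuousLinearMap.apply ℝ ℝ (EuclideanSpace.single i (1 : ℝ) : E3) with hL
  have hLn : ‖L‖ ≤ 1 := ContinuousLinearMap.opNorm_le_bound _ zero_le_one fun A => by
    rw [one_mul]
    refine (A.le_opNorm _).trans ?_
    simp
  have e : pd i u = L ∘ fderiv ℝ u := rfl
  rw [e, ← norm_iteratedFDeriv_fderiv]
  refine (L.norm_iteratedFDeriv_comp_left (hu.fderiv_right (m := ∞) (by norm_num)) (n := n)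
    (by exact_mod_cast le_top)).trans ?_
  exact mul_le_of_le_one_left (norm_nonneg _) hLn

theorem contDiffAt_mpd {u : E3 → ℝ} {α : Fin 3 → ℕ} (hα : len α ≤ 1) {x : E3}
    (hu : ContDiffAt ℝ ∞ u x) : ContDiffAt ℝ ∞ (mpd α u) x := by
  rcases eq_zero_or_single_of_len_le_one hα with rfl | ⟨i, rfl⟩
  · exact hu
  · rw [mpd_single]; exact contDiffAt_pd i hu

theorem norm_iteratedFDeriv_mpd_le {u : E3 → ℝ} {α : Fin 3 → ℕ} (hα : len α ≤ 1) {x : E3}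
    (hu : ContDiffAt ℝ ∞ u x) (n : ℕ) :
    ‖iteratedFDeriv ℝ n (mpd α u) x‖ ≤ ‖iteratedFDeriv ℝ (n + len α) u x‖ := by
  rcases eq_zero_or_single_of_len_le_one hα with rfl | ⟨i, rfl⟩
  · rw [mpd_zero, show len 0 = 0 from by simp [len], add_zero]
  · have h1 := len_add_single 0 i 1
    rw [zero_add] at h1
    rw [mpd_single, h1, show len 0 = 0 from by simp [len], zero_add]
    exact norm_iteratedFDeriv_pd_le i hu n

theorem Gamma0_eq (lam : ℝ) (j l : Fin 3) :
    Gamma0 lam j l = (1 / (4 * Real.pi * lam)) • ((if j = l then (1 : ℝ) else 0) •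
      (pd 0 (pd 0 (oseenPotential lam)) + pd 1 (pd 1 (oseenPotential lam))
        + pd 2 (pd 2 (oseenPotential lam))) - pd j (pd l (oseenPotential lam))) := by
  funext x
  simp only [Gamma0, lap, Fin.sum_univ_three, Pi.smul_apply, Pi.sub_apply, Pi.add_apply,
    smul_eq_mul, ite_mul, one_mul, zero_mul]

theorem contDiffAt_Gamma0 (lam : ℝ) (j l : Fin 3) {x : E3} (hx : x ≠ 0) :
    ContDiffAt ℝ ∞ (Gamma0 lam j l) x := by
  have h : ∀ a b, ContDiffAt ℝ ∞ (pd a (pd b (oseenPotential lam))) x := fun a b =>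
    contDiffAt_pd a (contDiffAt_pd b (contDiffAt_oseenPotential lam hx))
  rw [Gamma0_eq]
  exact contDiffAt_const.smul
    ((contDiffAt_const.smul (((h 0 0).add (h 1 1)).add (h 2 2))).sub (h j l))

theorem norm_iteratedFDeriv_Gamma0_le (lam : ℝ) (j l : Fin 3) {x : E3} (hx : x ≠ 0) (n : ℕ) :
    ‖iteratedFDeriv ℝ n (Gamma0 lam j l) x‖
      ≤ |1 / (4 * Real.pi * lam)| * 4 * ‖iteratedFDeriv ℝ (n + 2) (oseenPotential lam) x‖ := by
  set N := ‖iteratedFDeriv ℝ (n + 2) (oseenPotential lam) x‖ with hN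
  have hΦ := contDiffAt_oseenPotential lam hx
  have h : ∀ a b, ContDiffAt ℝ n (pd a (pd b (oseenPotential lam))) x := fun a b =>
    (contDiffAt_pd a (contDiffAt_pd b hΦ)).of_le (by exact_mod_cast le_top)
  have hb : ∀ a b, ‖iteratedFDeriv ℝ n (pd a (pd b (oseenPotential lam))) x‖ ≤ N := fun a b =>
    (norm_iteratedFDeriv_pd_le a (contDiffAt_pd b hΦ) n).trans
      (norm_iteratedFDeriv_pd_le b hΦ (n + 1))
  have h2sum : ContDiffAt ℝ n (pd 0 (pd 0 (oseenPotential lam)) + pd 1 (pd 1 (oseenPotential lam)))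
    x := (h 0 0).add (h 1 1)
  have hsum : ContDiffAt ℝ n (pd 0 (pd 0 (oseenPotential lam)) + pd 1 (pd 1 (oseenPotential lam))
      + pd 2 (pd 2 (oseenPotential lam))) x := h2sum.add (h 2 2)
  have hsmul : ContDiffAt ℝ n ((if j = l then (1 : ℝ) else 0) •
      (pd 0 (pd 0 (oseenPotential lam)) + pd 1 (pd 1 (oseenPotential lam))
        + pd 2 (pd 2 (oseenPotential lam)))) x := contDiffAt_const.smul hsum
  have hsub : ContDiffAt ℝ n ((if j = l then (1 : ℝ) else 0) •
      (pd 0 (pd 0 (oseenPotential lam)) + pd 1 (pd 1 (oseenPotential lam))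
        + pd 2 (pd 2 (oseenPotential lam))) - pd j (pd l (oseenPotential lam))) x :=
    hsmul.sub (h j l)
  rw [Gamma0_eq, iteratedFDeriv_const_smul_apply hsub, norm_smul, Real.norm_eq_abs, 
    mul_assoc |1 / (4 * Real.pi * lam)|]
  refine mul_le_mul_of_nonneg_left ?_ (abs_nonneg _)
  rw [iteratedFDeriv_sub_apply hsmul (h j l), iteratedFDeriv_const_smul_apply hsum,
    iteratedFDeriv_add_apply h2sum (h 2 2), iteratedFDeriv_add_apply (h 0 0) (h 1 1)]
  refine (norm_sub_le _ _).trans ?_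
  rw [norm_smul]
  have h1 : ‖(if j = l then (1 : ℝ) else 0)‖ ≤ 1 := by split_ifs <;> simp
  have h2 := norm_add₃_le (a := iteratedFDeriv ℝ n (pd 0 (pd 0 (oseenPotential lam))) x)
    (b := iteratedFDeriv ℝ n (pd 1 (pd 1 (oseenPotential lam))) x)
    (c := iteratedFDeriv ℝ n (pd 2 (pd 2 (oseenPotential lam))) x)
  have h3 := mul_le_mul h1 h2 (norm_nonneg _) zero_le_one
  linarith [hb j l, hb 0 0, hb 1 1, hb 2 2]

/-- The parabolic distance `(|x| (1 + s(λx)))^{1/2}`. -/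
def wakeDist (lam : ℝ) (x : E3) : ℝ := Real.sqrt (‖x‖ * (1 + swake lam x))

theorem wakeDist_nonneg (lam : ℝ) (x : E3) : 0 ≤ wakeDist lam x := Real.sqrt_nonneg _

theorem wakeDist_pos (lam : ℝ) {x : E3} (hx : x ≠ 0) : 0 < wakeDist lam x := by
  have := norm_pos_iff.2 hx
  have := swake_nonneg lam x
  exact Real.sqrt_pos.2 (by positivity)

/-- Kernels that behave like derivatives of order `m` of the Oseen potential. -/
structure WakeKernel (lam : ℝ) (m : ℕ) (k : E3 → ℝ) : Prop where
  smooth : ∀ x ≠ 0, ContDiffAt ℝ ∞ k x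
  near : ∃ C : ℝ, 0 ≤ C ∧ ∀ x : E3, x ≠ 0 → ‖x‖ ≤ 1 → |k x| * ‖x‖ ^ 2 ≤ C
  far : ∀ r : ℝ, 0 < r → ∃ C : ℝ, 0 ≤ C ∧ ∀ x : E3, r ≤ ‖x‖ → |k x| * wakeDist lam x ^ m ≤ C
  far_fderiv : ∀ r : ℝ, 0 < r → ∃ C : ℝ, 0 ≤ C ∧ ∀ x : E3, r ≤ ‖x‖ →
    ‖fderiv ℝ k x‖ * wakeDist lam x ^ (m + 1) ≤ C

/-- `Γ₀` is made of second derivatives of the potential, so `D^α Γ₀` has order `2 + |α|`. At the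
origin this is at worst `‖x‖^{-2}`, since `|α| ≤ 1`. -/
theorem wakeKernel_mpd_Gamma0 (lam : ℝ) (j l : Fin 3) {α : Fin 3 → ℕ} (hα : len α ≤ 1) :
    WakeKernel lam (2 + len α) (mpd α (Gamma0 lam j l)) := by
  set c := |1 / (4 * Real.pi * lam)| * 4 with hc
  have hc0 : 0 ≤ c := by positivity
  have hb : ∀ (n : ℕ) (x : E3), x ≠ 0 → ‖iteratedFDeriv ℝ n (mpd α (Gamma0 lam j l)) x‖
      ≤ c * ‖iteratedFDeriv ℝ (n + len α + 2) (oseenPotential lam) x‖ := fun n x hx =>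
    (norm_iteratedFDeriv_mpd_le hα (contDiffAt_Gamma0 lam j l hx) n).trans
      (norm_iteratedFDeriv_Gamma0_le lam j l hx _)
  have hb0 : ∀ x : E3, x ≠ 0 → |mpd α (Gamma0 lam j l) x|
      ≤ c * ‖iteratedFDeriv ℝ (2 + len α) (oseenPotential lam) x‖ := fun x hx => by
    have := hb 0 x hx
    rwa [norm_iteratedFDeriv_zero, Real.norm_eq_abs, show 0 + len α + 2 = 2 + len α by ring] at this
  have hb1 : ∀ x : E3, x ≠ 0 → ‖fderiv ℝ (mpd α (Gamma0 lam j l)) x‖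
      ≤ c * ‖iteratedFDeriv ℝ (2 + len α + 1) (oseenPotential lam) x‖ := fun x hx => by
    have := hb 1 x hx
    rwa [← zero_add 1, ← norm_iteratedFDeriv_fderiv, norm_iteratedFDeriv_zero,
      show 0 + 1 + len α + 2 = 2 + len α + 1 by ring] at this
  refine ⟨fun x hx => contDiffAt_mpd hα (contDiffAt_Gamma0 lam j l hx), ?_, fun r hr => ?_,
    fun r hr => ?_⟩
  · obtain ⟨C, hC, h⟩ := exists_oseenPotential_near lam (k := 2 + len α) (by omega)
    refine ⟨c * C, by positivity, fun x hx hx1 => ?_⟩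
    have hx0 : 0 < ‖x‖ := norm_pos_iff.2 hx
    have h1 := h x hx hx1
    have h2 : ‖iteratedFDeriv ℝ (2 + len α) (oseenPotential lam) x‖ * ‖x‖ ^ 2 ≤ C := by
      set A := ‖iteratedFDeriv ℝ (2 + len α) (oseenPotential lam) x‖
      rcases Nat.le_one_iff_eq_zero_or_eq_one.1 hα with h0 | h0
      · rw [h0] at h1
        exact h1.trans (mul_le_of_le_one_right hC hx1)
      · rw [h0] at h1
        have : A * ‖x‖ ^ 2 * ‖x‖ ≤ C * ‖x‖ := by
          calc _ = A * ‖x‖ ^ (2 + 1) := by ring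
            _ ≤ _ := h1
        exact le_of_mul_le_mul_right this hx0
    calc _ ≤ c * ‖iteratedFDeriv ℝ (2 + len α) (oseenPotential lam) x‖ * ‖x‖ ^ 2 := by
          gcongr; exact hb0 x hx
      _ = c * (‖iteratedFDeriv ℝ (2 + len α) (oseenPotential lam) x‖ * ‖x‖ ^ 2) := by ring
      _ ≤ _ := by gcongr
  · obtain ⟨C, hC, h⟩ := exists_oseenPotential_far lam (k := 2 + len α) (by omega) hr
    refine ⟨c * C, by positivity, fun x hx => ?_⟩
    have hx0 : x ≠ 0 := norm_pos_iff.1 (hr.trans_le hx)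
    have hw := wakeDist_nonneg lam x
    calc _ ≤ c * ‖iteratedFDeriv ℝ (2 + len α) (oseenPotential lam) x‖ *
          wakeDist lam x ^ (2 + len α) := by gcongr; exact hb0 x hx0
      _ = c * (‖iteratedFDeriv ℝ (2 + len α) (oseenPotential lam) x‖ *
          wakeDist lam x ^ (2 + len α)) := by ring
      _ ≤ _ := by gcongr; exact h x hx
  · obtain ⟨C, hC, h⟩ := exists_oseenPotential_far lam (k := 2 + len α + 1) (by omega) hr
    refine ⟨c * C, by positivity, fun x hx => ?_⟩
    have hx0 : x ≠ 0 := norm_pos_iff.1 (hr.trans_le hx)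
    have hw := wakeDist_nonneg lam x
    calc _ ≤ c * ‖iteratedFDeriv ℝ (2 + len α + 1) (oseenPotential lam) x‖ *
          wakeDist lam x ^ (2 + len α + 1) := by gcongr; exact hb1 x hx0
      _ = c * (‖iteratedFDeriv ℝ (2 + len α + 1) (oseenPotential lam) x‖ *
          wakeDist lam x ^ (2 + len α + 1)) := by ring
      _ ≤ _ := by gcongr; exact h x hx

/-! ### Convolution with wake kernels -/

namespace WakeKernel

variable {lam : ℝ} {m : ℕ} {k : E3 → ℝ}

theorem aestronglyMeasurable (hk : WakeKernel lam m k) : AEStronglyMeasurable k := by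
  have hc : ContinuousOn k {0}ᶜ := fun x hx => (hk.smooth x hx).continuousAt.continuousWithinAt
  have h1 := hc.aestronglyMeasurable (μ := (volume : Measure E3))
    (measurableSet_singleton (0 : E3)).compl
  rwa [Measure.restrict_eq_self_of_ae_mem (by simp [ae_iff])] at h1

theorem integrable_mul_weight (hk : WakeKernel lam m k) :
    Integrable fun x : E3 => k x * ((1 + ‖x‖) ^ 4)⁻¹ := by
  obtain ⟨A, hA, hnear⟩ := hk.near
  obtain ⟨B, hB, hfar⟩ := hk.far 1 one_pos
  refine ((integrable_singWeight.const_mul A).add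
    (integrable_inv_one_add_norm_pow.const_mul B)).mono'
    (hk.aestronglyMeasurable.mul (Measurable.aestronglyMeasurable (by fun_prop))) ?_
  have hne : ∀ᵐ x : E3, x ≠ 0 := by simp [ae_iff]
  filter_upwards [hne] with x hx
  have hx0 : 0 < ‖x‖ := norm_pos_iff.2 hx
  rw [norm_mul, Real.norm_of_nonneg (by positivity : (0 : ℝ) ≤ ((1 + ‖x‖) ^ 4)⁻¹),
    Real.norm_eq_abs]
  have hs := singWeight_nonneg x
  rcases le_total ‖x‖ 1 with h1 | h1
  · have h2 : |k x| ≤ A * ‖x‖ ^ (-(5 / 2) : ℝ) := by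
      have h3 : |k x| ≤ A * (‖x‖ ^ 2)⁻¹ := by
        rw [← div_eq_mul_inv, le_div_iff₀ (by positivity)]
        exact hnear x hx h1
      refine h3.trans (mul_le_mul_of_nonneg_left ?_ hA)
      rw [Real.rpow_neg hx0.le]
      refine inv_anti₀ (by positivity) ?_
      rw [← Real.rpow_natCast]
      exact Real.rpow_le_rpow_of_exponent_ge hx0 h1 (by norm_num)
    calc _ ≤ A * ‖x‖ ^ (-(5 / 2) : ℝ) * ((1 + ‖x‖) ^ 4)⁻¹ := by gcongr
      _ = A * singWeight x := by rw [singWeight]; ring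
      _ ≤ _ := le_add_of_nonneg_right (by positivity)
  · have h2 : 1 ≤ wakeDist lam x := by
      rw [wakeDist, Real.one_le_sqrt]
      have := swake_nonneg lam x
      nlinarith
    have h3 : |k x| ≤ B :=
      (le_mul_of_one_le_right (abs_nonneg _) (one_le_pow₀ h2)).trans (hfar x h1)
    calc _ ≤ B * ((1 + ‖x‖) ^ 4)⁻¹ := by gcongr
      _ ≤ _ := le_add_of_nonneg_left (by positivity)

variable {g : E3 → ℝ} {M R₀ : ℝ}

theorem integrable_conv (hk : WakeKernel lam m k) (hgc : Continuous g) (hM : ∀ y, |g y| ≤ M)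
    (hR : 0 < R₀) (h0 : ∀ y, R₀ ≤ ‖y‖ → g y = 0) (x : E3) :
    Integrable (fun y => k (x - y) * g y) ∧
    |∫ y, k (x - y) * g y| ≤ M * (1 + ‖x‖ + R₀) ^ 4 * ∫ y, |k y * ((1 + ‖y‖) ^ 4)⁻¹| := by
  have hM0 : 0 ≤ M := (abs_nonneg _).trans (hM 0)
  have hw' := hk.integrable_mul_weight.abs.comp_sub_left x
  have hle : ∀ y, ‖k (x - y) * g y‖ ≤ M * (1 + ‖x‖ + R₀) ^ 4 *
      |k (x - y) * ((1 + ‖x - y‖) ^ 4)⁻¹| := by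
    intro y
    by_cases hy : R₀ ≤ ‖y‖
    · rw [h0 y hy, mul_zero, norm_zero]; positivity
    · rw [norm_mul, Real.norm_eq_abs, Real.norm_eq_abs, abs_mul,
        abs_of_nonneg (by positivity : (0 : ℝ) ≤ ((1 + ‖x - y‖) ^ 4)⁻¹)]
      have h2 : 1 ≤ (1 + ‖x‖ + R₀) ^ 4 * ((1 + ‖x - y‖) ^ 4)⁻¹ := by
        rw [← div_eq_mul_inv, one_le_div (by positivity)]
        refine pow_le_pow_left₀ (by positivity) ?_ 4
        have : ‖x - y‖ ≤ ‖x‖ + ‖y‖ := norm_sub_le _ _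
        linarith
      calc _ ≤ |k (x - y)| * M := by gcongr; exact hM y
        _ ≤ |k (x - y)| * M * ((1 + ‖x‖ + R₀) ^ 4 * ((1 + ‖x - y‖) ^ 4)⁻¹) :=
            le_mul_of_one_le_right (by positivity) h2
        _ = _ := by ring
  have hm : AEStronglyMeasurable fun y => k (x - y) * g y :=
    (hk.aestronglyMeasurable.comp_measurePreserving
      (Measure.measurePreserving_sub_left volume x)).mul hgc.aestronglyMeasurable
  refine ⟨(hw'.const_mul _).mono' hm (Eventually.of_forall hle), ?_⟩
  refine (norm_integral_le_of_norm_le (hw'.const_mul _) (Eventually.of_forall hle)).trans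
    (le_of_eq ?_)
  rw [integral_const_mul, integral_sub_left_eq_self (fun y => |k y * ((1 + ‖y‖) ^ 4)⁻¹|)]

/-- A shift by at most `R₀ ≤ ‖x‖ / 2` changes `‖x‖` by at most a factor two, and it changes `1 + s`
by a bounded factor because the wake function is Lipschitz. -/
theorem wakeDist_le (lam : ℝ) {x y : E3} (hR : 0 < R₀) (hx : 2 * R₀ ≤ ‖x‖) (hy : ‖y‖ ≤ R₀) :
    wakeDist lam x ≤ Real.sqrt (2 * (1 + 2 * |lam| * R₀)) * wakeDist lam (x - y) := by
  rw [wakeDist, wakeDist, ← Real.sqrt_mul (by positivity)]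
  refine Real.sqrt_le_sqrt ?_
  have h1 : ‖x‖ ≤ 2 * ‖x - y‖ := by
    have := norm_sub_norm_le x y
    linarith
  have hs := swake_nonneg lam (x - y)
  have h2 : 1 + swake lam x ≤ (1 + 2 * |lam| * R₀) * (1 + swake lam (x - y)) := by
    have h3 := swake_sub_le lam x y
    have h4 : 2 * |lam| * ‖y‖ ≤ 2 * |lam| * R₀ := by gcongr
    have h5 : 0 ≤ 2 * |lam| * R₀ * swake lam (x - y) := by positivity
    linarith
  have hs' := swake_nonneg lam x
  calc _ ≤ (2 * ‖x - y‖) * ((1 + 2 * |lam| * R₀) * (1 + swake lam (x - y))) := by gcongr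
    _ = _ := by ring

theorem rpow_neg_half (n : ℕ) {X : ℝ} (hX : 0 ≤ X) :
    X ^ (-((n : ℝ) / 2)) = (Real.sqrt X ^ n)⁻¹ := by
  rw [Real.rpow_neg hX, Real.sqrt_eq_rpow, ← Real.rpow_natCast, ← Real.rpow_mul hX]
  congr 2
  ring

/-- Decay of the convolution with a wake kernel. -/
theorem exists_conv_le (hk : WakeKernel lam m k) (hgc : Continuous g) (hM : ∀ y, |g y| ≤ M)
    (hR : 0 < R₀) (h0 : ∀ y, R₀ ≤ ‖y‖ → g y = 0) :
    ∃ C : ℝ, 0 ≤ C ∧ ∀ x : E3,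
      |∫ y, k (x - y) * g y| ≤ C * ((1 + ‖x‖) * (1 + swake lam x)) ^ (-((m : ℝ) / 2)) := by
  have hM0 : 0 ≤ M := (abs_nonneg _).trans (hM 0)
  obtain ⟨A, hA, hfar⟩ := hk.far R₀ hR
  set V := (volume : Measure E3).real (Metric.ball (0 : E3) R₀)
  set I := ∫ y, |k y * ((1 + ‖y‖) ^ 4)⁻¹| with hI
  have hI0 : 0 ≤ I := integral_nonneg fun _ => abs_nonneg _
  set B := Real.sqrt (2 * (1 + 2 * |lam| * R₀)) with hB
  set b := Real.sqrt ((1 + 2 * R₀) / (2 * R₀)) with hb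
  set P := Real.sqrt ((1 + 2 * R₀) * (1 + 2 * |lam| * (2 * R₀))) with hP
  have hB0 : 0 ≤ B := Real.sqrt_nonneg _
  have hb0 : 0 ≤ b := Real.sqrt_nonneg _
  refine ⟨M * (1 + 2 * R₀ + R₀) ^ 4 * I * P ^ m + A * M * V * (b * B) ^ m, by positivity,
    fun x => ?_⟩
  have hs := swake_nonneg lam x
  rw [rpow_neg_half m (by positivity)]
  set W := Real.sqrt ((1 + ‖x‖) * (1 + swake lam x)) with hW
  have hW0 : 0 < W := Real.sqrt_pos.2 (by positivity)
  rcases lt_or_ge ‖x‖ (2 * R₀) with hx | hx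
  · refine ((hk.integrable_conv hgc hM hR h0 x).2).trans ?_
    have hWP : W ≤ P := by
      refine Real.sqrt_le_sqrt ?_
      have : swake lam x ≤ 2 * |lam| * (2 * R₀) := (swake_le lam x).trans (by gcongr)
      gcongr
    calc M * (1 + ‖x‖ + R₀) ^ 4 * I ≤ M * (1 + 2 * R₀ + R₀) ^ 4 * I := by gcongr
      _ ≤ M * (1 + 2 * R₀ + R₀) ^ 4 * I * (P ^ m * (W ^ m)⁻¹) := by
          refine le_mul_of_one_le_right (by positivity) ?_
          rw [← div_eq_mul_inv, one_le_div (by positivity)]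
          gcongr
      _ = M * (1 + 2 * R₀ + R₀) ^ 4 * I * P ^ m * (W ^ m)⁻¹ := by ring
      _ ≤ _ := by gcongr; exact le_add_of_nonneg_right (by positivity)
  · have hx0 : 0 < ‖x‖ := by linarith
    have hWw : W ≤ b * wakeDist lam x := by
      rw [hW, hb, wakeDist, ← Real.sqrt_mul (by positivity)]
      refine Real.sqrt_le_sqrt ?_
      have : 1 + ‖x‖ ≤ (1 + 2 * R₀) / (2 * R₀) * ‖x‖ := by
        rw [div_mul_eq_mul_div, le_div_iff₀ (by positivity)]
        nlinarith
      calc _ ≤ ((1 + 2 * R₀) / (2 * R₀) * ‖x‖) * (1 + swake lam x) := by gcongr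
        _ = _ := by ring
    have h1 : |∫ y, k (x - y) * g y| ≤ (A * (b * B) ^ m * (W ^ m)⁻¹ * M) * V := by
      refine abs_integral_le_of_support measure_ball_lt_top (fun y hy => ?_) fun y hy => ?_
      · have : R₀ ≤ ‖y‖ := by simpa using hy
        simp [h0 y this]
      · have hy' : ‖y‖ < R₀ := by simpa using hy
        have h3 : R₀ ≤ ‖x - y‖ := by
          have := norm_sub_norm_le x y
          linarith
        rw [abs_mul]
        refine mul_le_mul ?_ (hM y) (abs_nonneg _) (by positivity)
        rw [← div_eq_mul_inv, le_div_iff₀ (by positivity)]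
        have h4 := wakeDist_nonneg lam (x - y)
        have h5 : W ≤ b * B * wakeDist lam (x - y) := by
          refine hWw.trans ?_
          rw [mul_assoc]
          exact mul_le_mul_of_nonneg_left (wakeDist_le lam hR hx hy'.le) hb0
        calc |k (x - y)| * W ^ m ≤ |k (x - y)| * (b * B * wakeDist lam (x - y)) ^ m := by gcongr
          _ = (|k (x - y)| * wakeDist lam (x - y) ^ m) * (b * B) ^ m := by rw [mul_pow]; ring
          _ ≤ _ := by gcongr; exact hfar _ h3
    refine h1.trans ?_
    calc _ = A * M * V * (b * B) ^ m * (W ^ m)⁻¹ := by ring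
      _ ≤ _ := by gcongr; exact le_add_of_nonneg_left (by positivity)

/-- The leading term of the convolution with a wake kernel. -/
theorem exists_conv_sub_le (hk : WakeKernel lam m k) (hgc : Continuous g) (hM : ∀ y, |g y| ≤ M)
    (hR : 0 < R₀) (h0 : ∀ y, R₀ ≤ ‖y‖ → g y = 0) :
    ∃ C : ℝ, 0 ≤ C ∧ ∀ x : E3, 2 * R₀ ≤ ‖x‖ →
      |(∫ y, k (x - y) * g y) - k x * ∫ y, g y|
        ≤ C * (‖x‖ * (1 + swake lam x)) ^ (-(((m + 1 : ℕ) : ℝ) / 2)) := by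
  have hM0 : 0 ≤ M := (abs_nonneg _).trans (hM 0)
  obtain ⟨A, hA, hfar⟩ := hk.far_fderiv R₀ hR
  set V := (volume : Measure E3).real (Metric.ball (0 : E3) R₀)
  set B := Real.sqrt (2 * (1 + 2 * |lam| * R₀)) with hB
  have hB0 : 0 ≤ B := Real.sqrt_nonneg _
  refine ⟨A * B ^ (m + 1) * R₀ * M * V, by positivity, fun x hx => ?_⟩
  have hs := swake_nonneg lam x
  have hx0 : 0 < ‖x‖ := by linarith
  rw [rpow_neg_half (m + 1) (by positivity)]
  change _ ≤ _ * (wakeDist lam x ^ (m + 1))⁻¹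
  have hw0 := wakeDist_pos lam (norm_pos_iff.1 hx0)
  have hgi : Integrable g := hgc.integrable_of_hasCompactSupport
    (HasCompactSupport.intro (isCompact_closedBall (0 : E3) R₀) fun y hy => h0 y (by
      rw [mem_closedBall_zero_iff, not_le] at hy; exact hy.le))
  rw [← integral_const_mul, ← integral_sub (hk.integrable_conv hgc hM hR h0 x).1
    (hgi.const_mul _)]
  refine (abs_integral_le_of_support (measure_ball_lt_top (x := (0 : E3)) (r := R₀))
    (B := A * B ^ (m + 1) * (wakeDist lam x ^ (m + 1))⁻¹ * R₀ * M)
    (fun y hy => ?_) fun y hy => ?_).trans (le_of_eq ?_)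
  · have : R₀ ≤ ‖y‖ := by simpa using hy
    simp [h0 y this]
  · have hy' : ‖y‖ < R₀ := by simpa using hy
    rw [← sub_mul, abs_mul]
    refine mul_le_mul ?_ (hM y) (abs_nonneg _) (by positivity)
    -- The ball about `x` contains `x - y` and keeps distance `R₀` from the origin. The mean value
    -- theorem applies on it, with `wakeDist` at `z` comparable to that at `x`.
    have hball : ∀ z ∈ Metric.ball x R₀, ‖x - z‖ ≤ R₀ ∧ R₀ ≤ ‖z‖ := fun z hz => by
      rw [mem_ball_iff_norm'] at hz
      have := norm_sub_norm_le x z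
      exact ⟨hz.le, by linarith⟩
    have h1 := (convex_ball x R₀).norm_image_sub_le_of_norm_fderiv_le (𝕜 := ℝ) (f := k)
      (C := A * B ^ (m + 1) * (wakeDist lam x ^ (m + 1))⁻¹) (x := x) (y := x - y)
      (fun z hz => ((hk.smooth z (norm_pos_iff.1 (hR.trans_le (hball z hz).2))).differentiableAt
        (by simp))) (fun z hz => ?_) (Metric.mem_ball_self hR) (by
          rw [mem_ball_iff_norm']; simpa using hy')
    · refine h1.trans ?_
      gcongr
      simpa using hy'.le
    · obtain ⟨hz1, hz2⟩ := hball z hz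
      have h2 := wakeDist_le lam hR hx hz1
      rw [sub_sub_cancel] at h2
      have h4 := wakeDist_nonneg lam z
      rw [← div_eq_mul_inv, le_div_iff₀ (by positivity)]
      calc ‖fderiv ℝ k z‖ * wakeDist lam x ^ (m + 1)
          ≤ ‖fderiv ℝ k z‖ * (B * wakeDist lam z) ^ (m + 1) := by gcongr
        _ = (‖fderiv ℝ k z‖ * wakeDist lam z ^ (m + 1)) * B ^ (m + 1) := by rw [mul_pow]; ring
        _ ≤ _ := by gcongr; exact hfar z hz2
  · ring

end WakeKernel

/-- The order `m = 2 + |α|` gives the exponent `-m/2 = -1 - |α|/2`, and the leading-term estimate of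
order `m + 1` gives `-3/2 - |α|/2`. -/
theorem steady_estimates {T : ℝ} [hT : Fact (0 < T)] (lam : ℝ) {R₀ : ℝ} {α : Fin 3 → ℕ}
    {f : AddCircle T × E3 → E3} (hf : Continuous f)
    (hfc : HasCompactSupport f) (hR : 0 < R₀)
    (hsupp : tsupport f ⊆ Set.univ ×ˢ Metric.ball (0 : E3) R₀) (hα : len α ≤ 1) :
    (∃ C : ℝ, 0 < C ∧ ∀ x : E3,
      ConvExists (fun j l => mpd α (Gamma0 lam j l)) (steady f) x ∧
      ‖conv (fun j l => mpd α (Gamma0 lam j l)) (steady f) x‖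
        ≤ C * ((1 + ‖x‖) * (1 + wake (lam • x))) ^ (-1 - (len α : ℝ) / 2)) ∧
    (∃ C : ℝ, 0 < C ∧ ∀ x : E3, 2 * R₀ ≤ ‖x‖ →
      ‖conv (fun j l => mpd α (Gamma0 lam j l)) (steady f) x
          - act (fun j l => mpd α (Gamma0 lam j l) x) (∫ y, steady f y)‖
        ≤ C * (‖x‖ * (1 + wake (lam • x))) ^ (-(3 / 2) - (len α : ℝ) / 2)) := by
  obtain ⟨M, hM0, hM⟩ := exists_norm_le_of_hasCompactSupport hf hfc
  have hf0 : ∀ (t : AddCircle T) (x : E3), R₀ ≤ ‖x‖ → f (t, x) = 0 :=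
    fun t x hx => eq_zero_of_tsupport_subset hsupp t hx
  have hgv : Continuous (steady f) := continuous_steady hf hM
  have hgc : ∀ l : Fin 3, Continuous fun y => steady f y l := fun l =>
    (EuclideanSpace.proj (𝕜 := ℝ) l).continuous.comp hgv
  have hgM : ∀ (l : Fin 3) y, |steady f y l| ≤ M := fun l y =>
    (abs_apply_le_norm _ l).trans (norm_steady_le hM y)
  have hg0 : ∀ (l : Fin 3) y, R₀ ≤ ‖y‖ → steady f y l = 0 := fun l y hy => by
    rw [steady_eq_zero hf0 hy]; rfl
  have hk := fun j l => wakeKernel_mpd_Gamma0 lam j l hα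
  have hgi : Integrable (steady f) := hgv.integrable_of_hasCompactSupport
    (HasCompactSupport.intro (isCompact_closedBall (0 : E3) R₀) fun y hy => steady_eq_zero hf0 (by
      rw [mem_closedBall_zero_iff, not_le] at hy; exact hy.le))
  have hint : ∀ l : Fin 3, (∫ y, steady f y) l = ∫ y, steady f y l := fun l =>
    ((EuclideanSpace.proj (𝕜 := ℝ) l).integral_comp_comm hgi).symm
  constructor
  · choose C hC hb using fun j l => (hk j l).exists_conv_le (hgc l) (hgM l) hR (hg0 l)
    set C' := ∑ j, ∑ l, C j l with hC'
    have hCle : ∀ j l, C j l ≤ C' := le_sum_sum hC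
    have hC0 : 0 ≤ C' := (hC 0 0).trans (hCle 0 0)
    refine ⟨9 * C' + 1, by positivity, fun x => ⟨fun j l => ?_, ?_⟩⟩
    · exact ((hk j l).integrable_conv (hgc l) (hgM l) hR (hg0 l) x).1
    · have hs := wake_nonneg (lam • x)
      have hX : 0 ≤ ((1 + ‖x‖) * (1 + wake (lam • x))) ^ (-1 - (len α : ℝ) / 2) := by positivity
      have e : -(((2 + len α : ℕ) : ℝ) / 2) = -1 - (len α : ℝ) / 2 := by push_cast; ring
      rw [e] at hb
      refine (norm_toLp_sum_le fun j l => (hb j l x).trans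
        (mul_le_mul_of_nonneg_right (hCle j l) hX)).trans ?_
      rw [← mul_assoc]
      exact mul_le_mul_of_nonneg_right (by linarith) hX
  · choose C hC hb using fun j l => (hk j l).exists_conv_sub_le (hgc l) (hgM l) hR (hg0 l)
    set C' := ∑ j, ∑ l, C j l with hC'
    have hCle : ∀ j l, C j l ≤ C' := le_sum_sum hC
    have hC0 : 0 ≤ C' := (hC 0 0).trans (hCle 0 0)
    refine ⟨9 * C' + 1, by positivity, fun x hx => ?_⟩
    have hs := wake_nonneg (lam • x)
    have hX : 0 ≤ (‖x‖ * (1 + wake (lam • x))) ^ (-(3 / 2) - (len α : ℝ) / 2) := by positivity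
    have e : -(((2 + len α + 1 : ℕ) : ℝ) / 2) = -(3 / 2) - (len α : ℝ) / 2 := by push_cast; ring
    rw [e] at hb
    have e2 : conv (fun j l => mpd α (Gamma0 lam j l)) (steady f) x
          - act (fun j l => mpd α (Gamma0 lam j l) x) (∫ y, steady f y)
        = WithLp.toLp 2 fun j => ∑ l, ((∫ y, mpd α (Gamma0 lam j l) (x - y) * steady f y l)
            - mpd α (Gamma0 lam j l) x * ∫ y, steady f y l) := by
      ext j
      simp only [conv, act, PiLp.sub_apply, Finset.sum_sub_distrib, hint]
    rw [e2]
    refine (norm_toLp_sum_le fun j l => (hb j l x hx).trans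
      (mul_le_mul_of_nonneg_right (hCle j l) hX)).trans ?_
    rw [← mul_assoc]
    exact mul_le_mul_of_nonneg_right (by linarith) hX

end TPOseen

end

/-! ### The steady and the purely periodic estimates combined -/

theorem lemma3p4 (T : ℝ) [Fact (0 < T)] (lam : ℝ) (hlam : lam ≠ 0)
    (f : AddCircle T × TPOseen.E3 → TPOseen.E3) (hf : TPOseen.SmoothOnG f)
    (hfc : HasCompactSupport f) (R₀ : ℝ) (hR₀ : 0 < R₀)
    (hsupp : tsupport f ⊆ Set.univ ×ˢ Metric.ball (0 : TPOseen.E3) R₀)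
    (α : Fin 3 → ℕ) (hα : TPOseen.len α ≤ 1) :
    -- the steady-state part
    (∃ C : ℝ, 0 < C ∧ ∀ x : TPOseen.E3,
      TPOseen.ConvExists (fun j l => TPOseen.mpd α (TPOseen.Gamma0 lam j l)) (TPOseen.steady f) x ∧
      ‖TPOseen.conv (fun j l => TPOseen.mpd α (TPOseen.Gamma0 lam j l)) (TPOseen.steady f) x‖
        ≤ C * ((1 + ‖x‖) * (1 + TPOseen.wake (lam • x))) ^ (-1 - (TPOseen.len α : ℝ) / 2)) ∧
    (∃ C : ℝ, 0 < C ∧ ∀ x : TPOseen.E3, 2 * R₀ ≤ ‖x‖ →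
      ‖TPOseen.conv (fun j l => TPOseen.mpd α (TPOseen.Gamma0 lam j l)) (TPOseen.steady f) x
          - TPOseen.act (fun j l => TPOseen.mpd α (TPOseen.Gamma0 lam j l) x)
              (∫ y, TPOseen.steady f y)‖
        ≤ C * (‖x‖ * (1 + TPOseen.wake (lam • x))) ^ (-(3 / 2) - (TPOseen.len α : ℝ) / 2)) ∧
    -- the derivative of the purely periodic fundamental solution is a function
    (∃ K : Fin 3 → Fin 3 → AddCircle T × TPOseen.E3 → ℝ, ∀ j l,
      TPOseen.IsFunction (TPOseen.distDeriv α (TPOseen.GammaPerp T lam j l)) (K j l)) ∧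
    -- the purely periodic part
    (∀ K : Fin 3 → Fin 3 → AddCircle T × TPOseen.E3 → ℝ,
      (∀ j l, TPOseen.IsFunction (TPOseen.distDeriv α (TPOseen.GammaPerp T lam j l)) (K j l)) →
      (∃ C : ℝ, 0 < C ∧ ∀ (t : AddCircle T) (x : TPOseen.E3),
        TPOseen.ConvGExists K (TPOseen.purelyPeriodic f) (t, x) ∧
        ‖TPOseen.convG K (TPOseen.purelyPeriodic f) (t, x)‖
          ≤ C * (1 + ‖x‖) ^ (-3 - (TPOseen.len α : ℝ))) ∧
      (∃ C : ℝ, 0 < C ∧ ∀ (t : AddCircle T) (x : TPOseen.E3), 2 * R₀ ≤ ‖x‖ →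
        TPOseen.ConvTExists (fun j l s => K j l (s, x))
          (fun s => ∫ y, TPOseen.purelyPeriodic f (s, y)) t ∧
        ‖TPOseen.convG K (TPOseen.purelyPeriodic f) (t, x)
            - TPOseen.convT (fun j l s => K j l (s, x))
                (fun s => ∫ y, TPOseen.purelyPeriodic f (s, y)) t‖
          ≤ C * ‖x‖ ^ (-4 - (TPOseen.len α : ℝ)))) := by
  have hfcont : Continuous f := TPOseen.continuous_of_lift hf.continuous
  obtain ⟨h1, h2⟩ := TPOseen.steady_estimates lam hfcont hfc hR₀ hsupp hα
  exact ⟨h1, h2, ⟨fun j l => TPOseen.perKernel T lam j l α, fun j l =>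
    TPOseen.isFunction_perKernel lam j l hα⟩, fun K hK =>
    TPOseen.periodic_estimates lam hfcont hfc hR₀ hsupp hα hK⟩
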